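/- Let $d\ge 2$ and let $\Sigma\subset\mathbb{R}^d$ be a non-empty smooth embedded $(d-1)$-dimensional submanifold which is a closed subset of $\mathbb{R}^d$ and all of whose principal curvatures are non-zero at every point. For $\sigma\in\mathbb{R}$ let $H^\sigma(\Sigma)$ be the $L_2$-based Bessel potential space on $\Sigma$; its norm is computed from any fixed family of local graph charts and a subordinate smooth locally finite partition of unity, using $\|g\|_{H^\sigma(\mathbb{R}^{d-1})}^2=\int_{\mathbb{R}^{d-1}}(1+|z|)^{2\sigma}|\hat g(z)|^2\,dz$ in each chart. Let $k\ge 1$ be an integer, let $s,\ell\ge 0$ be real, and let $p\in[1,\infty)$. We say that $\mathrm{HDR}(\Sigma,k,s,\ell,p)$ holds if for every smooth compactly supported function $\phi$ on $\mathbb{R}^d$ there is a constant $C_\phi$ such that $$\big\|(\phi\,\nabla^k\hat f)\big|_{\Sigma}\big\|_{H^{-s}(\Sigma)}\le C_\phi\Big(\|f\|_{L_p(\mathbb{R}^d)}+\big\|(\phi\hat f)\big|_{\Sigma}\big\|_{H^{\ell}(\Sigma)}\Big)$$ for every Schwartz function $f$ on $\mathbb{R}^d$. Here $\nabla^k\hat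 f$ is the tensor of all derivatives of order $k$ of the Fourier transform $\hat f$. Put $$\sigma_p=\frac dp-\frac{d+1}{2},\qquad \kappa_p=\frac{d+1}{p}-\frac{d+3}{2}.$$ **Proposition.** If $\mathrm{HDR}(\Sigma,k,s,\ell,p)$ holds, then 1. $k\le s+\ell$; 2. $k\le s+1$; 3. $k<\sigma_p$ if $p>1$, and $k\le\sigma_1$ if $p=1$; 4. if $k>s$, then $k<s+\ell$ and $\dfrac{k\ell}{s+\ell-k}\le\kappa_p$; 5. $2k-s\le\kappa_p$. -/

import Mathlib

open MeasureTheory FourierTransform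
open scoped SchwartzMap ContDiff Manifold ENNReal NNReal

noncomputable section

/-- A graph chart of a subset `S` of `ℝ^d`: after the choice of orthonormal coordinates
`ℝ^d = ℝ^{d-1} × ℝ`, the part of `S` in the open set `V` is exactly the graph of a smooth function
`h` over the open set `U ⊆ ℝ^{d-1}`. -/
structure GraphChart {d : ℕ} (S : Set (EuclideanSpace ℝ (Fin d))) where
  coords : WithLp 2 (EuclideanSpace ℝ (Fin (d - 1)) × ℝ) ≃ₗᵢ[ℝ] EuclideanSpace ℝ (Fin d)
  U : Set (EuclideanSpace ℝ (Fin (d - 1)))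
  V : Set (EuclideanSpace ℝ (Fin d))
  h : EuclideanSpace ℝ (Fin (d - 1)) → ℝ
  isOpen_U : IsOpen U
  isOpen_V : IsOpen V
  contDiffOn_h : ContDiffOn ℝ ∞ h U
  inter_eq : S ∩ V = (fun ζ => coords (WithLp.toLp 2 (ζ, h ζ))) '' U

/-- The parametrization `ζ ↦ (ζ, h ζ)` of the part of `S` in a graph chart. -/
def GraphChart.param {d : ℕ} {S : Set (EuclideanSpace ℝ (Fin d))} (c : GraphChart S)
    (ζ : EuclideanSpace ℝ (Fin (d - 1))) : EuclideanSpace ℝ (Fin d) :=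
  c.coords (WithLp.toLp 2 (ζ, c.h ζ))

/-- `S` is a smooth embedded `(d-1)`-dimensional submanifold of `ℝ^d`: near each of its points it is
the graph of a smooth function over an open subset of a hyperplane. -/
def IsSmoothHypersurface {d : ℕ} (S : Set (EuclideanSpace ℝ (Fin d))) : Prop :=
  ∀ x ∈ S, ∃ c : GraphChart S, x ∈ c.V

/-- `κ` is a principal curvature of `S` at `x` (with respect to one of the two unit normals): it is
an eigenvalue of the second fundamental form `D²h(v, w) / √(1 + |∇h|²)` relative to the first
fundamental form `⟪v, w⟫ + Dh(v) Dh(w)`, both written in a graph chart around `x`. -/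
def IsPrincipalCurvature {d : ℕ} (S : Set (EuclideanSpace ℝ (Fin d)))
    (x : EuclideanSpace ℝ (Fin d)) (κ : ℝ) : Prop :=
  ∃ c : GraphChart S, ∃ ζ ∈ c.U, c.param ζ = x ∧
    ∃ v : EuclideanSpace ℝ (Fin (d - 1)), v ≠ 0 ∧ ∀ w : EuclideanSpace ℝ (Fin (d - 1)),
      fderiv ℝ (fderiv ℝ c.h) ζ v w / Real.sqrt (1 + ‖fderiv ℝ c.h ζ‖ ^ 2) =
        κ * (inner ℝ v w + fderiv ℝ c.h ζ v * fderiv ℝ c.h ζ w)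

/-- All principal curvatures of `S` are non-zero at every point. -/
def NonvanishingPrincipalCurvatures {d : ℕ} (S : Set (EuclideanSpace ℝ (Fin d))) : Prop :=
  ∀ x ∈ S, ∀ κ : ℝ, IsPrincipalCurvature S x κ → κ ≠ 0

/-- The data by which Sobolev norms on `S` are computed: graph charts covering `S`, and a smooth
locally finite partition of unity on `S` subordinate to them. -/
structure SobolevAtlas {d : ℕ} (S : Set (EuclideanSpace ℝ (Fin d))) where
  ι : Type
  chart : ι → GraphChart S
  partition : SmoothPartitionOfUnity ι 𝓘(ℝ, EuclideanSpace ℝ (Fin d)) (EuclideanSpace ℝ (Fin d)) S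
  isSubordinate : partition.IsSubordinate fun i => (chart i).V

/-- Every closed smooth hypersurface has such an atlas. -/
theorem IsSmoothHypersurface.nonempty_sobolevAtlas {d : ℕ} {S : Set (EuclideanSpace ℝ (Fin d))}
    (hS : IsSmoothHypersurface S) (hclosed : IsClosed S) : Nonempty (SobolevAtlas S) := by
  choose c hc using fun x : S => hS x.1 x.2
  obtain ⟨f, hf⟩ := SmoothPartitionOfUnity.exists_isSubordinate
    𝓘(ℝ, EuclideanSpace ℝ (Fin d)) hclosed (fun x : S => (c x).V) (fun x => (c x).isOpen_V)
    (fun x hx => Set.mem_iUnion.2 ⟨⟨x, hx⟩, hc ⟨x, hx⟩⟩)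
  exact ⟨⟨S, c, f, hf⟩⟩

/-- The Bessel potential norm `(∫ (1 + |z|)^{2σ} |𝓕 g (z)|² dz)^{1/2}` of order `σ ∈ ℝ` of a
(compactly supported smooth) vector-valued function on `ℝ^m`. -/
def sobolevNorm {m : ℕ} {W : Type*} [NormedAddCommGroup W] [NormedSpace ℂ W]
    (σ : ℝ) (g : EuclideanSpace ℝ (Fin m) → W) : ℝ≥0∞ :=
  (∫⁻ z, ENNReal.ofReal ((1 + ‖z‖) ^ (2 * σ)) * ‖𝓕 g z‖ₑ ^ 2) ^ (1 / 2 : ℝ)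

/-- The piece of `u` cut off by the `i`-th function of the partition of unity, read in the `i`-th
chart and extended by zero. -/
def SobolevAtlas.localPiece {d : ℕ} {S : Set (EuclideanSpace ℝ (Fin d))} (𝒜 : SobolevAtlas S)
    {W : Type*} [NormedAddCommGroup W] [NormedSpace ℂ W]
    (i : 𝒜.ι) (u : EuclideanSpace ℝ (Fin d) → W) : EuclideanSpace ℝ (Fin (d - 1)) → W :=
  (𝒜.chart i).U.indicator fun ζ =>
    ((𝒜.partition i ((𝒜.chart i).param ζ) : ℝ) : ℂ) • u ((𝒜.chart i).param ζ)

/-- The norm of `u|_S` in the Bessel potential space `H^σ(S)`, `σ ∈ ℝ`, for a compactly supported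
smooth function `u`. Only finitely many summands are then non-zero, and another atlas gives an
equivalent norm on the functions supported in a fixed compact set. -/
def SobolevAtlas.surfaceNorm {d : ℕ} {S : Set (EuclideanSpace ℝ (Fin d))} (𝒜 : SobolevAtlas S)
    {W : Type*} [NormedAddCommGroup W] [NormedSpace ℂ W]
    (σ : ℝ) (u : EuclideanSpace ℝ (Fin d) → W) : ℝ≥0∞ :=
  (∑' i, sobolevNorm σ (𝒜.localPiece i u) ^ 2) ^ (1 / 2 : ℝ)

/-- The higher derivative restriction property: for every test function `φ` the inequality
`‖(φ ∇^k f̂)|_S‖_{H^{-s}(S)} ≤ C (‖f‖_{L_p} + ‖φ f̂‖_{H^ℓ(S)})` holds for all Schwartz functions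
`f`, with a constant `C` independent of `f`. The gradient `∇^k f̂` is the full tensor of derivatives
of order `k`. -/
def HDR {d : ℕ} {S : Set (EuclideanSpace ℝ (Fin d))} (𝒜 : SobolevAtlas S)
    (k : ℕ) (s ℓ p : ℝ) : Prop :=
  ∀ φ : EuclideanSpace ℝ (Fin d) → ℂ, ContDiff ℝ ∞ φ → HasCompactSupport φ →
    ∃ C : ℝ≥0, ∀ f : 𝓢(EuclideanSpace ℝ (Fin d), ℂ),
      𝒜.surfaceNorm (-s)
          (fun ξ => φ ξ • iteratedFDeriv ℝ k (𝓕 f : 𝓢(EuclideanSpace ℝ (Fin d), ℂ)) ξ) ≤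
        C * (eLpNorm f (ENNReal.ofReal p) volume +
          𝒜.surfaceNorm ℓ (fun ξ => φ ξ * (𝓕 f : 𝓢(EuclideanSpace ℝ (Fin d), ℂ)) ξ))

/-- `σ_p = d/p - (d+1)/2`. -/
def sigmaExp (d : ℕ) (p : ℝ) : ℝ := (d : ℝ) / p - ((d : ℝ) + 1) / 2

/-- `κ_p = (d+1)/p - (d+3)/2`. -/
def kappaExp (d : ℕ) (p : ℝ) : ℝ := ((d : ℝ) + 1) / p - ((d : ℝ) + 3) / 2

end

/-! The estimate is tested on Schwartz functions whose Fourier transform is a bump concentrated near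
one point of the surface. In linear coordinates with tangential part `T` and normal part `η`, the
surface is there the graph of a function `b` vanishing to second order at the origin. The bump
(`GraphFrame.graphBump`) has tangential size `1/N` and normal size `1/L` around the graph, is
modulated in the normal direction with frequency `M`, and its normal profile `q` equals `t ^ j` near
zero.

Three sizes matter. On the surface the modulation becomes the phase `M * b`, whose gradient on the
support is of order `M/N`. If `N ≤ F` and `M ≤ F * N`, the restriction therefore has frequency at
most of order `F` and `L²` norm of order `N ^ (-(d-1)/2)`. This bounds its norms of order `σ ≥ 0` by
`F ^ σ * N ^ (-(d-1)/2)` (`AdaptedFrame.surfaceNorm_le`), and duality gives the matching lower bound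
in order `-s` (`AdaptedFrame.le_surfaceNorm_neg`). The `k`-th normal derivative multiplies the
restriction by a factor of size at least `L ^ j * M ^ (k - j)`. The modulation only translates the
function in physical space, so the `L^p` norm for `p < 2` does not depend on `M` and is controlled
by rescaling, Hölder and weighted Plancherel (`GraphFrame.eLpNorm_fourierInv_graphBump_le`).

Knapp examples have `L = N²` and `M = F * N`. With `j = 0` they give `(F N)^k F^(-s) ≤ C (N^κ +
F^ℓ)`, where `κ = κ_p`. With `j = 1` the bump vanishes on the surface, the term with `ℓ` disappears,
and `N² (F N)^(k-1) F^(-s) ≤ C N^κ`. Putting `F = N^a` and letting `N` grow turns these into linear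
inequalities for every `a ≥ 1`. The first yields claims 1 and 4 (the latter with help from claim 5),
the second claims 2 and 5.

Claim 3 comes from slabs: `N = 1`, `M = 0`, `j = k`, with amplitude `L^(-k)`. They vanish on the
surface, their `k`-th normal derivative there is a fixed function, and their `L^p` norm is at most
of order `L^(σ_p - k)`. If `k > σ_p`, this tends to zero, a contradiction. If only `k ≥ σ_p` or `p ≥
2` is known, the slabs are bounded in `L^p` and tend to zero pointwise in physical space. A sum of
`J` of them at widely separated scales then has `L^p` norm of order at most `J^(1/p)`, while the
derivative on the surface is multiplied by `J`; this is impossible for `p > 1`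
(`AdaptedFrame.lt_sigmaExp_of_HDR`). -/

/-! ### Weighted Plancherel estimates for Sobolev and `L^p` norms. -/

/-- Plancherel's theorem for Schwartz functions, for lower Lebesgue integrals. -/
theorem SchwartzMap.lintegral_enorm_sq_fourier {n : ℕ} (f : 𝓢(EuclideanSpace ℝ (Fin n), ℂ)) :
    ∫⁻ z, ‖𝓕 f z‖ₑ ^ 2 = ∫⁻ x, ‖f x‖ₑ ^ 2 := by
  have key (g : 𝓢(EuclideanSpace ℝ (Fin n), ℂ)) :
      ∫⁻ z, ‖g z‖ₑ ^ 2 = ENNReal.ofReal (∫ z, ‖g z‖ ^ 2) := by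
    rw [ofReal_integral_eq_lintegral_ofReal ((g.memLp 2 volume).integrable_norm_pow two_ne_zero)
      (Filter.Eventually.of_forall fun _ => by positivity)]
    simp [ENNReal.ofReal_pow, ofReal_norm]
  rw [key, key, SchwartzMap.integral_norm_sq_fourier]

theorem SchwartzMap.norm_fourier_iteratedLineDerivOp {n : ℕ}
    (f : 𝓢(EuclideanSpace ℝ (Fin n), ℂ)) (m : ℕ) (v z : EuclideanSpace ℝ (Fin n)) :
    ‖𝓕 (LineDeriv.iteratedLineDerivOp (fun _ : Fin m => v) f) z‖ =
      (2 * Real.pi * |inner ℝ z v|) ^ m * ‖𝓕 f z‖ := by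
  induction m with
  | zero => simp [LineDeriv.iteratedLineDerivOp_fin_zero]
  | succ m ih =>
    have hv : (fun x : EuclideanSpace ℝ (Fin n) => inner ℝ x v).HasTemperateGrowth := by fun_prop
    have : Fin.tail (fun _ : Fin (m + 1) => v) = fun _ => v := rfl
    rw [LineDeriv.iteratedLineDerivOp_succ_left, this, SchwartzMap.fourier_lineDerivOp_eq,
      smul_apply, SchwartzMap.smulLeftCLM_apply_apply hv]
    rw [norm_smul, norm_smul, ih]
    simp only [Complex.norm_mul, Complex.norm_ofNat, Complex.norm_real, Complex.norm_I,
      Real.norm_eq_abs, abs_of_pos Real.pi_pos]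
    ring

theorem lintegral_enorm_pow_le_of_support {α W : Type*} [MeasurableSpace α] [NormedAddCommGroup W]
    {μ : Measure α} {g : α → W} {K : Set α} {B : ℝ} {a : ℕ}
    (ha : a ≠ 0) (hB : ∀ x, ‖g x‖ ≤ B)
    (hK : Function.support g ⊆ K) :
    ∫⁻ x, ‖g x‖ₑ ^ a ∂μ ≤ ENNReal.ofReal (B ^ a) * μ K := by
  -- `K` need not be measurable, so it is replaced by a measurable hull of the same measure.
  have hle : ∀ x, ‖g x‖ₑ ^ a ≤ (toMeasurable μ K).indicator (fun _ => ENNReal.ofReal (B ^ a)) x := by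
    intro x
    by_cases hx : x ∈ toMeasurable μ K
    · rw [Set.indicator_of_mem hx, ← ofReal_norm, ← ENNReal.ofReal_pow (norm_nonneg _)]
      exact ENNReal.ofReal_le_ofReal (pow_le_pow_left₀ (norm_nonneg _) (hB x) a)
    · have : g x = 0 := by
        by_contra h
        exact hx (subset_toMeasurable μ K (hK h))
      simp [this, ha]
  calc ∫⁻ x, ‖g x‖ₑ ^ a ∂μ
      ≤ ∫⁻ x, (toMeasurable μ K).indicator (fun _ => ENNReal.ofReal (B ^ a)) x ∂μ :=
        lintegral_mono hle
    _ = _ := by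
        rw [lintegral_indicator_const (measurableSet_toMeasurable μ K), measure_toMeasurable]

/-- The weight is dominated by `1` plus the squared symbols of the pure derivatives of order `m`
along the coordinate axes, so no mixed derivatives are needed in the weighted Plancherel estimate.
The scale `F` is carried along so that derivatives growing like `F ^ j` are normalized. -/
theorem one_add_norm_pow_le {n m : ℕ} (hm : 1 ≤ m) (z : EuclideanSpace ℝ (Fin n)) {F : ℝ}
    (hF : 0 < F) :
    (1 + ‖z‖ / F) ^ (2 * m) ≤
      4 ^ m * (1 + n ^ m * ∑ j, ((2 * Real.pi * |z j|) ^ m / F ^ m) ^ 2) := by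
  have h1 : (1 + ‖z‖ / F) ^ (2 * m) ≤ 4 ^ m * (1 + (‖z‖ / F) ^ (2 * m)) := by
    have ht : 0 ≤ ‖z‖ / F := by positivity
    have := add_pow_le zero_le_one ht (2 * m)
    have h2 : (2 : ℝ) ^ (2 * m - 1) ≤ 4 ^ m := by
      calc (2 : ℝ) ^ (2 * m - 1) ≤ 2 ^ (2 * m) := pow_le_pow_right₀ (by norm_num) (by omega)
        _ = 4 ^ m := by rw [pow_mul]; norm_num
    rw [one_pow] at this
    exact this.trans (by gcongr)
  refine h1.trans ?_
  gcongr
  -- The power mean inequality applied to the squared coordinates; its constant `n ^ (m - 1)` is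
  -- rounded up to `n ^ m`.
  have h3 : ‖z‖ ^ (2 * m) ≤ n ^ m * ∑ j, (|z j| ^ m) ^ 2 := by
    obtain ⟨r, rfl⟩ : ∃ r, m = r + 1 := ⟨m - 1, by omega⟩
    rw [pow_mul, EuclideanSpace.norm_sq_eq]
    rcases Nat.eq_zero_or_pos n with rfl | hn
    · simp
    have h := pow_sum_div_card_le_sum_pow (s := (Finset.univ : Finset (Fin n)))
      (f := fun j => ‖z j‖ ^ 2) (fun _ _ => by positivity) r
    rw [div_le_iff₀ (by simp; positivity), Finset.card_univ, Fintype.card_fin] at h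
    refine h.trans ?_
    rw [mul_comm]
    have hn1 : (1 : ℝ) ≤ n := by exact_mod_cast hn
    apply mul_le_mul (pow_le_pow_right₀ hn1 (by omega)) _ (by positivity) (by positivity)
    apply le_of_eq
    refine Finset.sum_congr rfl fun j _ => ?_
    rw [Real.norm_eq_abs]; ring
  rw [div_pow, div_le_iff₀ (by positivity)]
  refine h3.trans ?_
  rw [mul_assoc, Finset.sum_mul]
  gcongr with j
  rw [div_pow, mul_comm 2 m, pow_mul F, div_mul_cancel₀ _ (by positivity)]
  gcongr
  have := Real.pi_gt_three
  nlinarith [abs_nonneg (z j)]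

/-- A weighted form of Plancherel's theorem: bounds for the derivatives of order `0` and `m` of a
function control the `L²` norm of its Fourier transform with a weight of order `m`. -/
theorem SchwartzMap.lintegral_weight_fourier_le (n : ℕ) {m : ℕ} (hm : 1 ≤ m) :
    ∃ C : ℝ≥0, ∀ (g : 𝓢(EuclideanSpace ℝ (Fin n), ℂ)) (F B : ℝ) (K : Set _), 0 < F → 0 ≤ B →
      tsupport g ⊆ K → (∀ j ≤ m, ∀ x, ‖iteratedFDeriv ℝ j g x‖ ≤ B * F ^ j) →
      ∫⁻ z, ENNReal.ofReal ((1 + ‖z‖ / F) ^ (2 * m)) * ‖𝓕 g z‖ₑ ^ 2 ≤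
        C * (ENNReal.ofReal (B ^ 2) * volume K) := by
  refine ⟨4 ^ m * (1 + n ^ m * n), fun g F B K hF hB hK hg => ?_⟩
  let e (j : Fin n) : EuclideanSpace ℝ (Fin n) := EuclideanSpace.single j 1
  let D (j : Fin n) : 𝓢(EuclideanSpace ℝ (Fin n), ℂ) :=
    LineDeriv.iteratedLineDerivOp (fun _ : Fin m => e j) g
  have hD (j : Fin n) : ∫⁻ z, ‖𝓕 (D j) z‖ₑ ^ 2 ≤
      ENNReal.ofReal ((B * F ^ m) ^ 2) * volume K := by
    rw [SchwartzMap.lintegral_enorm_sq_fourier]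
    apply lintegral_enorm_pow_le_of_support two_ne_zero
    · intro x
      simp only [D]
      rw [SchwartzMap.iteratedLineDerivOp_eq_iteratedFDeriv]
      refine (ContinuousMultilinearMap.le_opNorm _ _).trans ?_
      simpa [e] using hg m le_rfl x
    · exact (subset_tsupport _).trans
        ((SchwartzMap.tsupport_iteratedLineDerivOp_subset _ _).trans hK)
  have h0 : ∫⁻ z, ‖𝓕 g z‖ₑ ^ 2 ≤ ENNReal.ofReal (B ^ 2) * volume K := by
    rw [SchwartzMap.lintegral_enorm_sq_fourier]
    apply lintegral_enorm_pow_le_of_support two_ne_zero _ ((subset_tsupport _).trans hK)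
    intro x
    simpa using hg 0 (Nat.zero_le _) x
  have hpt (z : EuclideanSpace ℝ (Fin n)) :
      ENNReal.ofReal ((1 + ‖z‖ / F) ^ (2 * m)) * ‖𝓕 g z‖ₑ ^ 2 ≤
      4 ^ m * (‖𝓕 g z‖ₑ ^ 2 + n ^ m * ∑ j, ENNReal.ofReal ((F ^ m)⁻¹ ^ 2) * ‖𝓕 (D j) z‖ₑ ^ 2) := by
    have hs (h : 𝓢(EuclideanSpace ℝ (Fin n), ℂ)) : ‖h z‖ₑ ^ 2 = ENNReal.ofReal (‖h z‖ ^ 2) := by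
      rw [← ofReal_norm, ENNReal.ofReal_pow (norm_nonneg _)]
    simp_rw [hs, ← ENNReal.ofReal_mul (show 0 ≤ (F ^ m)⁻¹ ^ 2 by positivity)]
    rw [← ENNReal.ofReal_sum_of_nonneg (fun _ _ => by positivity),
      ← ENNReal.ofReal_mul (by positivity)]
    have h4 : (4 : ℝ≥0∞) ^ m = ENNReal.ofReal (4 ^ m) := by
      rw [ENNReal.ofReal_pow (by norm_num)]; norm_num
    have hn : (n : ℝ≥0∞) ^ m = ENNReal.ofReal ((n : ℝ) ^ m) := by
      rw [ENNReal.ofReal_pow (by positivity)]; norm_num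
    rw [h4, hn, ← ENNReal.ofReal_mul (by positivity),
      ← ENNReal.ofReal_add (by positivity) (by positivity), ← ENNReal.ofReal_mul (by positivity)]
    apply ENNReal.ofReal_le_ofReal
    refine (mul_le_mul_of_nonneg_right (one_add_norm_pow_le hm z hF) (by positivity)).trans ?_
    apply le_of_eq
    rw [mul_assoc, add_mul, one_mul, mul_assoc, Finset.sum_mul]
    congr 3
    refine Finset.sum_congr rfl fun j _ => ?_
    simp only [D]
    rw [SchwartzMap.norm_fourier_iteratedLineDerivOp]
    simp only [e, EuclideanSpace.inner_single_right]
    simp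
    field_simp
  calc _ ≤ ∫⁻ z, 4 ^ m * (‖𝓕 g z‖ₑ ^ 2 +
        n ^ m * ∑ j, ENNReal.ofReal ((F ^ m)⁻¹ ^ 2) * ‖𝓕 (D j) z‖ₑ ^ 2) := lintegral_mono hpt
    _ = 4 ^ m * ((∫⁻ z, ‖𝓕 g z‖ₑ ^ 2) +
        n ^ m * ∑ j, ENNReal.ofReal ((F ^ m)⁻¹ ^ 2) * ∫⁻ z, ‖𝓕 (D j) z‖ₑ ^ 2) := by
      have hms (h : 𝓢(EuclideanSpace ℝ (Fin n), ℂ)) : Measurable fun z => ‖h z‖ₑ ^ 2 := by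
        have := h.continuous
        fun_prop
      rw [lintegral_const_mul' _ _ (by finiteness), lintegral_add_left (hms _),
        lintegral_const_mul' _ _ (by finiteness), lintegral_finsetSum _ (fun j _ => (hms _).const_mul _)]
      simp_rw [lintegral_const_mul' _ _ ENNReal.ofReal_ne_top]
    _ ≤ 4 ^ m * (ENNReal.ofReal (B ^ 2) * volume K +
        n ^ m * ∑ _j : Fin n, ENNReal.ofReal (B ^ 2) * volume K) := by
      refine mul_le_mul_right (add_le_add h0 (mul_le_mul_right ?_ _)) _
      refine Finset.sum_le_sum fun j _ => ?_
      refine (mul_le_mul_right (hD j) _).trans ?_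
      rw [← mul_assoc, ← ENNReal.ofReal_mul (by positivity)]
      apply le_of_eq
      congr 2
      field_simp
    _ = _ := by
      simp
      ring

/-- Bounds on the derivatives of a compactly supported smooth function by powers of a frequency
`F ≥ 1` control its Bessel potential norms of nonnegative order. -/
theorem sobolevNorm_le (n : ℕ) {σ : ℝ} (hσ : 0 ≤ σ) :
    ∃ (m : ℕ) (C : ℝ≥0), ∀ (g : EuclideanSpace ℝ (Fin n) → ℂ) (F B : ℝ) (K : Set _),
      ContDiff ℝ ∞ g → HasCompactSupport g → 1 ≤ F → 0 ≤ B → tsupport g ⊆ K →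
      (∀ j ≤ m, ∀ x, ‖iteratedFDeriv ℝ j g x‖ ≤ B * F ^ j) →
      sobolevNorm σ g ≤ C * ENNReal.ofReal (B * F ^ σ) * volume K ^ (1 / 2 : ℝ) := by
  obtain ⟨m, hσm⟩ := exists_nat_ge σ
  obtain ⟨C, hC⟩ := SchwartzMap.lintegral_weight_fourier_le n (m := m + 1) (by omega)
  refine ⟨m + 1, NNReal.sqrt C, fun g F B K hg hgc hF hB hK hb => ?_⟩
  have h := hC (hgc.toSchwartzMap hg) F B K (by linarith) hB hK hb
  have hF0 : 0 < F := by linarith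
  have hle : ∫⁻ z, ENNReal.ofReal ((1 + ‖z‖) ^ (2 * σ)) * ‖𝓕 g z‖ₑ ^ 2 ≤
      ENNReal.ofReal (F ^ (2 * σ)) * (C * (ENNReal.ofReal (B ^ 2) * volume K)) := by
    refine le_trans ?_ (mul_le_mul_right h _)
    rw [← lintegral_const_mul' _ _ ENNReal.ofReal_ne_top]
    refine lintegral_mono fun z => ?_
    rw [← mul_assoc, ← ENNReal.ofReal_mul (by positivity)]
    refine mul_le_mul' (ENNReal.ofReal_le_ofReal ?_) le_rfl
    have h1 : (1 : ℝ) ≤ 1 + ‖z‖ / F := by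
      have : 0 ≤ ‖z‖ / F := by positivity
      linarith
    -- Since `F ≥ 1`, the weight at unit scale costs only the factor `F ^ (2 * σ)` over the weight
    -- at scale `F`.
    calc (1 + ‖z‖) ^ (2 * σ) ≤ (F * (1 + ‖z‖ / F)) ^ (2 * σ) := by
          apply Real.rpow_le_rpow (by positivity) _ (by positivity)
          rw [mul_add, mul_div_cancel₀ _ hF0.ne']
          linarith
      _ = F ^ (2 * σ) * (1 + ‖z‖ / F) ^ (2 * σ) := Real.mul_rpow hF0.le (by positivity)
      _ ≤ _ := by
          gcongr
          rw [← Real.rpow_natCast]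
          apply Real.rpow_le_rpow_of_exponent_le h1
          push_cast
          linarith
  calc sobolevNorm σ g ≤ (ENNReal.ofReal (F ^ (2 * σ)) *
        (C * (ENNReal.ofReal (B ^ 2) * volume K))) ^ (1 / 2 : ℝ) :=
        ENNReal.rpow_le_rpow hle (by norm_num)
    _ = _ := by
      have hF2 : F ^ (2 * σ) = (F ^ σ) ^ 2 := by
        rw [← Real.rpow_natCast, ← Real.rpow_mul hF0.le]; push_cast; ring_nf
      have e1 : ENNReal.ofReal (F ^ (2 * σ)) * (C * (ENNReal.ofReal (B ^ 2) * volume K)) =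
          (NNReal.sqrt C * ENNReal.ofReal (B * F ^ σ)) ^ 2 * volume K := by
        rw [hF2, mul_pow, ← ENNReal.ofReal_pow (by positivity), mul_pow B,
          ENNReal.ofReal_mul (by positivity), ← ENNReal.coe_pow, NNReal.sq_sqrt]
        ring
      rw [e1, ENNReal.mul_rpow_of_nonneg _ _ (by norm_num), ← ENNReal.rpow_natCast,
        ← ENNReal.rpow_mul]
      norm_num

/-- The `L²` norm is controlled by the Bessel potential norms of orders `-s` and `s`. -/
theorem lintegral_enorm_sq_le_sobolevNorm_mul {n : ℕ} (s : ℝ) (g : 𝓢(EuclideanSpace ℝ (Fin n), ℂ)) :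
    -- Plancherel, then Cauchy–Schwarz after splitting the trivial weight into `(1 + ‖z‖) ^ (-s)`
    -- and `(1 + ‖z‖) ^ s`.
    ∫⁻ x, ‖g x‖ₑ ^ 2 ≤ sobolevNorm (-s) g * sobolevNorm s g := by
  rw [← SchwartzMap.lintegral_enorm_sq_fourier]
  let w (σ : ℝ) (z : EuclideanSpace ℝ (Fin n)) : ℝ≥0∞ :=
    ENNReal.ofReal ((1 + ‖z‖) ^ σ) * ‖𝓕 g z‖ₑ
  have hmeas (σ : ℝ) : Measurable (w σ) := by
    have h1 := (𝓕 g).continuous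
    have h2 : Continuous fun z : EuclideanSpace ℝ (Fin n) => (1 + ‖z‖) ^ σ :=
      (by fun_prop : Continuous fun z : EuclideanSpace ℝ (Fin n) => 1 + ‖z‖).rpow_const
        fun z => Or.inl (by positivity)
    exact h2.measurable.ennreal_ofReal.mul h1.enorm.measurable
  have hw (σ : ℝ) : sobolevNorm σ g = (∫⁻ z, w σ z ^ (2 : ℝ)) ^ (1 / 2 : ℝ) := by
    unfold sobolevNorm
    congr 1
    refine lintegral_congr fun z => ?_
    simp only [w]
    rw [ENNReal.mul_rpow_of_nonneg _ _ (by norm_num), ENNReal.ofReal_rpow_of_nonneg (by positivity)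
      (by norm_num), ← Real.rpow_mul (by positivity), mul_comm σ 2, SchwartzMap.fourier_coe]
    norm_num
  rw [hw, hw]
  refine le_trans (le_of_eq ?_)
    (ENNReal.lintegral_mul_le_Lp_mul_Lq volume Real.HolderConjugate.two_two
      (hmeas (-s)).aemeasurable (hmeas s).aemeasurable)
  refine lintegral_congr fun z => ?_
  simp only [w, Pi.mul_apply]
  rw [mul_mul_mul_comm, ← ENNReal.ofReal_mul (by positivity), ← Real.rpow_add (by positivity)]
  simp [sq]

theorem SchwartzMap.eLpNorm_fourierInv {n : ℕ} (g : 𝓢(EuclideanSpace ℝ (Fin n), ℂ)) (p : ℝ≥0∞) :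
    eLpNorm (𝓕⁻ g : 𝓢(EuclideanSpace ℝ (Fin n), ℂ)) p volume =
      eLpNorm (𝓕 g : 𝓢(EuclideanSpace ℝ (Fin n), ℂ)) p volume := by
  have : ((𝓕⁻ g : 𝓢(EuclideanSpace ℝ (Fin n), ℂ)) : EuclideanSpace ℝ (Fin n) → ℂ) =
      (𝓕 g : 𝓢(EuclideanSpace ℝ (Fin n), ℂ)) ∘ Neg.neg := by
    ext x
    rw [SchwartzMap.fourierInv_coe, SchwartzMap.fourier_coe, Function.comp_apply,
      Real.fourierInv_eq_fourier_neg]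
  rw [this]
  exact eLpNorm_comp_measurePreserving (𝓕 g : 𝓢(EuclideanSpace ℝ (Fin n), ℂ)).continuous.aestronglyMeasurable
    (Measure.measurePreserving_neg volume)

/-- The `L^p` norm, `1 ≤ p < 2`, of the inverse Fourier transform of a compactly supported smooth
function. -/
theorem SchwartzMap.eLpNorm_fourierInv_le (n : ℕ) {p : ℝ} (hp : 1 ≤ p) (hp2 : p < 2) :
    ∃ (m : ℕ) (C : ℝ≥0), ∀ (g : 𝓢(EuclideanSpace ℝ (Fin n), ℂ)) (B : ℝ) (K : Set _),
      0 ≤ B → tsupport g ⊆ K → (∀ j ≤ m, ∀ x, ‖iteratedFDeriv ℝ j g x‖ ≤ B) →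
      eLpNorm (𝓕⁻ g : 𝓢(EuclideanSpace ℝ (Fin n), ℂ)) (ENNReal.ofReal p) volume ≤
        C * ENNReal.ofReal B * volume K ^ (1 / 2 : ℝ) := by
  obtain ⟨C, hC⟩ := SchwartzMap.lintegral_weight_fourier_le n (m := n + 1) (by omega)
  -- The Hölder exponent with `1/r + 1/2 = 1/p`. As `r ≥ 2`, the weight `(1 + ‖z‖) ^ (-(n + 1))`
  -- lies in `L^r`, and its reciprocal is absorbed by the weighted `L²` bound.
  let r : ℝ := 2 * p / (2 - p)
  have hr2 : 2 ≤ r := by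
    rw [le_div_iff₀ (by linarith)]; linarith
  let w : EuclideanSpace ℝ (Fin n) → ℝ := fun z => ((1 + ‖z‖) ^ (n + 1))⁻¹
  have hwc : Continuous w := by
    refine Continuous.inv₀ (by fun_prop) fun z => by positivity
  have hw : eLpNorm w (ENNReal.ofReal r) volume ≠ ⊤ := by
    have hr : (n : ℝ) < (n + 1) * r := by nlinarith [(Nat.cast_nonneg n : (0:ℝ) ≤ n)]
    have hfin := finite_integral_one_add_norm (E := EuclideanSpace ℝ (Fin n)) (μ := volume)
      (r := (n + 1) * r) (by simpa using hr)
    have := eLpNorm_lt_top_iff_lintegral_rpow_enorm_lt_top (f := w) (μ := volume)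
      (p := ENNReal.ofReal r) (by simp; linarith) ENNReal.ofReal_ne_top
    refine (this.2 ?_).ne
    convert hfin using 3 with z
    rw [ENNReal.toReal_ofReal (by linarith), ← ofReal_norm,
      ENNReal.ofReal_rpow_of_nonneg (norm_nonneg _) (by linarith)]
    congr 1
    simp only [w]
    rw [Real.norm_of_nonneg (by positivity), ← Real.rpow_natCast, ← Real.rpow_neg (by positivity),
      ← Real.rpow_mul (by positivity)]
    push_cast
    ring_nf
  refine ⟨n + 1, (eLpNorm w (ENNReal.ofReal r) volume).toNNReal * NNReal.sqrt C,
    fun g B K hB hK hb => ?_⟩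
  rw [SchwartzMap.eLpNorm_fourierInv]
  have hH : ENNReal.HolderTriple (ENNReal.ofReal r) 2 (ENNReal.ofReal p) := by
    constructor
    rw [← ENNReal.ofReal_inv_of_pos (by linarith), ← ENNReal.ofReal_inv_of_pos (by linarith)]
    have : (2 : ℝ≥0∞)⁻¹ = ENNReal.ofReal (2⁻¹) := by
      rw [ENNReal.ofReal_inv_of_pos (by norm_num)]; norm_num
    rw [this, ← ENNReal.ofReal_add (by positivity) (by norm_num)]
    congr 1
    have : 2 - p ≠ 0 := by linarith
    simp only [r]
    field_simp
    ring
  let h : EuclideanSpace ℝ (Fin n) → ℂ := fun z => ((1 + ‖z‖) ^ (n + 1) : ℝ) • 𝓕 g z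
  have hhc : Continuous h := by
    have := (𝓕 g).continuous
    fun_prop
  have heq : ((𝓕 g : 𝓢(EuclideanSpace ℝ (Fin n), ℂ)) : EuclideanSpace ℝ (Fin n) → ℂ) = w • h := by
    ext z
    simp only [w, h, Pi.smul_apply', smul_smul]
    rw [inv_mul_cancel₀ (by positivity), one_smul]
  have hh : eLpNorm h 2 volume ≤ NNReal.sqrt C * ENNReal.ofReal B * volume K ^ (1 / 2 : ℝ) := by
    have h1 := hC g 1 B K one_pos hB hK (by simpa using hb)
    rw [eLpNorm_eq_lintegral_rpow_enorm_toReal (by norm_num) (by norm_num)]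
    have h2 : ∫⁻ z, ‖h z‖ₑ ^ (ENNReal.toReal 2) =
        ∫⁻ z, ENNReal.ofReal ((1 + ‖z‖ / 1) ^ (2 * (n + 1))) * ‖𝓕 g z‖ₑ ^ 2 := by
      refine lintegral_congr fun z => ?_
      simp only [h, enorm_smul]
      rw [ENNReal.toReal_ofNat, ENNReal.rpow_ofNat, mul_pow, Real.enorm_of_nonneg (by positivity),
        ← ENNReal.ofReal_pow (by positivity), div_one, ← pow_mul, mul_comm 2]
    rw [h2]
    refine (ENNReal.rpow_le_rpow h1 (by norm_num)).trans (le_of_eq ?_)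
    have e1 : (C : ℝ≥0∞) * (ENNReal.ofReal (B ^ 2) * volume K) =
        (NNReal.sqrt C * ENNReal.ofReal B) ^ 2 * volume K := by
      rw [mul_pow, ← ENNReal.ofReal_pow (by positivity), ← ENNReal.coe_pow, NNReal.sq_sqrt]
      ring
    rw [e1, ENNReal.mul_rpow_of_nonneg _ _ (by norm_num), ← ENNReal.rpow_natCast,
      ← ENNReal.rpow_mul]
    norm_num
  rw [heq]
  refine (eLpNorm_smul_le_mul_eLpNorm (p := ENNReal.ofReal r) (q := 2)
    hhc.aestronglyMeasurable hwc.aestronglyMeasurable).trans ?_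
  rw [ENNReal.coe_mul, ENNReal.coe_toNNReal hw, mul_assoc, mul_assoc]
  rw [mul_assoc] at hh
  exact mul_le_mul_right hh _

/-- For `p ≥ 2`, the `L^p` norm of a function bounded by one is controlled by its `L²` norm. -/
theorem eLpNorm_le_of_le_one {α W : Type*} [MeasurableSpace α] [NormedAddCommGroup W]
    {μ : Measure α} {f : α → W} {p : ℝ} (hp : 2 ≤ p) (hf : ∀ x, ‖f x‖ ≤ 1) :
    eLpNorm f (ENNReal.ofReal p) μ ≤ (∫⁻ x, ‖f x‖ₑ ^ 2 ∂μ) ^ (1 / p) := by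
  have hp0 : 0 < p := by linarith
  rw [eLpNorm_eq_lintegral_rpow_enorm_toReal (by simpa using hp0) ENNReal.ofReal_ne_top,
    ENNReal.toReal_ofReal hp0.le]
  gcongr with x
  rw [← ENNReal.rpow_ofNat]
  refine ENNReal.rpow_le_rpow_of_exponent_ge ?_ hp
  rw [← ofReal_norm]
  exact ENNReal.ofReal_le_one.2 (hf x)

/-! ### Affine changes of variables on the Fourier side. -/

theorem LinearMap.det_adjoint_real {E : Type*} [NormedAddCommGroup E] [InnerProductSpace ℝ E]
    [FiniteDimensional ℝ E] (f : E →ₗ[ℝ] E) : (LinearMap.adjoint f).det = f.det := by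
  let b := stdOrthonormalBasis ℝ E
  rw [← LinearMap.det_toMatrix b.toBasis, ← LinearMap.det_toMatrix b.toBasis f,
    LinearMap.toMatrix_adjoint, Matrix.det_conjTranspose]
  simp

theorem integral_eq_det_mul_integral_comp {E W : Type*} [NormedAddCommGroup E]
    [InnerProductSpace ℝ E] [FiniteDimensional ℝ E] [MeasurableSpace E] [BorelSpace E]
    [NormedAddCommGroup W] [NormedSpace ℝ W] (Φ : E ≃L[ℝ] E) (x₀ : E) (g : E → W) :
    ∫ x, g x = |LinearMap.det (Φ : E →ₗ[ℝ] E)| • ∫ y, g (x₀ + Φ y) := by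
  have hdet : LinearMap.det (Φ : E →ₗ[ℝ] E) ≠ 0 := (LinearEquiv.isUnit_det' Φ.toLinearEquiv).ne_zero
  have h1 := Measure.map_linearMap_addHaar_eq_smul_addHaar (volume : Measure E) hdet
  have h2 : ∫ y, g (x₀ + Φ y) = ∫ x, g (x₀ + x) ∂(Measure.map (Φ : E →ₗ[ℝ] E) volume) :=
    (Φ.toHomeomorph.measurableEmbedding.integral_map (fun x => g (x₀ + x))).symm
  rw [h2, h1, integral_smul_measure, integral_add_left_eq_self, smul_smul,
    ENNReal.toReal_ofReal (abs_nonneg _), ← abs_mul, mul_inv_cancel₀ hdet, abs_one, one_smul]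

/-- The `L^p` norm of the inverse Fourier transform under affine changes of variables and
modulations. -/
theorem SchwartzMap.eLpNorm_fourierInv_comp {n : ℕ} {F H : 𝓢(EuclideanSpace ℝ (Fin n), ℂ)}
    (Φ : EuclideanSpace ℝ (Fin n) ≃L[ℝ] EuclideanSpace ℝ (Fin n))
    (l : EuclideanSpace ℝ (Fin n) →L[ℝ] ℝ) (x₀ : EuclideanSpace ℝ (Fin n))
    (hFH : ∀ y, F (x₀ + Φ y) = (Real.fourierChar (l y) : ℂ) * H y) {p : ℝ} (hp : 0 < p) :
    eLpNorm (𝓕⁻ F : 𝓢(EuclideanSpace ℝ (Fin n), ℂ)) (ENNReal.ofReal p) volume =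
      ENNReal.ofReal (|LinearMap.det (Φ : EuclideanSpace ℝ (Fin n) →ₗ[ℝ] _)| ^ (1 - 1 / p)) *
        eLpNorm (𝓕⁻ H : 𝓢(EuclideanSpace ℝ (Fin n), ℂ)) (ENNReal.ofReal p) volume := by
  set δ : ℝ := LinearMap.det (Φ : EuclideanSpace ℝ (Fin n) →ₗ[ℝ] _) with hδ
  have hdet : δ ≠ 0 := (LinearEquiv.isUnit_det' Φ.toLinearEquiv).ne_zero
  set A := LinearMap.adjoint (Φ : EuclideanSpace ℝ (Fin n) →ₗ[ℝ] EuclideanSpace ℝ (Fin n)) with hA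
  have hdA : LinearMap.det A = δ := LinearMap.det_adjoint_real _
  set v := (InnerProductSpace.toDual ℝ _).symm l with hv
  have hl (y) : l y = inner ℝ y v := by
    rw [real_inner_comm, hv, InnerProductSpace.toDual_symm_apply]
  have hpt (x) : ‖(𝓕⁻ F : 𝓢(EuclideanSpace ℝ (Fin n), ℂ)) x‖ =
      ‖(|δ| • fun x => (𝓕⁻ H : 𝓢(EuclideanSpace ℝ (Fin n), ℂ)) (A x + v)) x‖ := by
    rw [SchwartzMap.fourierInv_coe, Real.fourierInv_eq, integral_eq_det_mul_integral_comp Φ x₀]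
    simp only [Pi.smul_apply]
    rw [SchwartzMap.fourierInv_coe, Real.fourierInv_eq, norm_smul, norm_smul]
    congr 1
    -- The translation by `x₀` contributes a unimodular factor. The linear phase `l` shifts the
    -- physical variable by `v`, and `Φ` turns into its adjoint `A`.
    have h3 (y) : Real.fourierChar (inner ℝ (x₀ + Φ y) x) • F (x₀ + Φ y) =
        (Real.fourierChar (inner ℝ x₀ x) : ℂ) •
          (Real.fourierChar (inner ℝ y (A x + v)) • H y) := by
      have : inner ℝ (Φ y) x = inner ℝ y (A x) := by
        rw [hA, LinearMap.adjoint_inner_right]; rfl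
      rw [hFH, inner_add_left, inner_add_right, hl, this]
      simp only [AddChar.map_add_eq_mul, Circle.smul_def, Circle.coe_mul, smul_eq_mul]
      ring
    refine (congrArg norm (integral_congr_ae (Filter.Eventually.of_forall h3))).trans ?_
    rw [integral_smul, norm_smul, Circle.norm_coe, one_mul]
  have hcont : Continuous (𝓕⁻ H : 𝓢(EuclideanSpace ℝ (Fin n), ℂ)) := SchwartzMap.continuous _
  have hAc : Continuous A := A.continuous_of_finiteDimensional
  have hmap : eLpNorm (fun x => (𝓕⁻ H : 𝓢(EuclideanSpace ℝ (Fin n), ℂ)) (A x + v))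
      (ENNReal.ofReal p) volume = ENNReal.ofReal (|δ| ^ (-(1 / p))) *
        eLpNorm (𝓕⁻ H : 𝓢(EuclideanSpace ℝ (Fin n), ℂ)) (ENNReal.ofReal p) volume := by
    have h4 := Measure.map_linearMap_addHaar_eq_smul_addHaar
      (volume : Measure (EuclideanSpace ℝ (Fin n))) (f := A) (by rwa [hdA])
    have h5 : eLpNorm (fun x => (𝓕⁻ H : 𝓢(EuclideanSpace ℝ (Fin n), ℂ)) (A x + v))
        (ENNReal.ofReal p) volume =
        eLpNorm (fun x => (𝓕⁻ H : 𝓢(EuclideanSpace ℝ (Fin n), ℂ)) (x + v))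
        (ENNReal.ofReal p) (Measure.map A volume) := by
      rw [eLpNorm_map_measure (by fun_prop) hAc.aemeasurable]
      rfl
    have h6 : eLpNorm (fun x => (𝓕⁻ H : 𝓢(EuclideanSpace ℝ (Fin n), ℂ)) (x + v))
        (ENNReal.ofReal p) volume =
        eLpNorm (𝓕⁻ H : 𝓢(EuclideanSpace ℝ (Fin n), ℂ)) (ENNReal.ofReal p) volume :=
      eLpNorm_comp_measurePreserving hcont.aestronglyMeasurable
        (measurePreserving_add_right volume v)
    rw [h5, h4, eLpNorm_smul_measure_of_ne_zero (by simpa [hdA] using hdet), h6, hdA, smul_eq_mul]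
    congr 1
    rw [ENNReal.ofReal_rpow_of_pos (by positivity)]
    congr 1
    rw [one_div, ENNReal.toReal_inv, ENNReal.toReal_ofReal hp.le, abs_inv,
      Real.inv_rpow (abs_nonneg _), Real.rpow_neg (abs_nonneg _), one_div]
  rw [eLpNorm_congr_norm_ae (Filter.Eventually.of_forall hpt), eLpNorm_const_smul, hmap,
    Real.enorm_of_nonneg (abs_nonneg _), ← mul_assoc, ← ENNReal.ofReal_mul (abs_nonneg _)]
  congr 2
  rw [sub_eq_add_neg, Real.rpow_add (by positivity), Real.rpow_one]

/-! ### Calculus of geometric derivative bounds. -/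

section DerivativeBounds

variable {E E' W : Type*} [NormedAddCommGroup E] [NormedSpace ℝ E] [NormedAddCommGroup E']
  [NormedSpace ℝ E'] [NormedAddCommGroup W] [NormedSpace ℝ W]

/-- The derivatives up to order `m` of `g` at `x` grow at most geometrically with ratio `F`. -/
def GeometricDerivBound (m : ℕ) (g : E → W) (x : E) (B F : ℝ) : Prop :=
  ∀ j ≤ m, ‖iteratedFDeriv ℝ j g x‖ ≤ B * F ^ j

theorem GeometricDerivBound.nonneg {m : ℕ} {g : E → W} {x : E} {B F : ℝ}
    (h : GeometricDerivBound m g x B F) : 0 ≤ B := by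
  simpa using (norm_nonneg _).trans (h 0 (Nat.zero_le _))

theorem GeometricDerivBound.of_eventuallyEq_zero {m : ℕ} {g : E → W} {x : E} {B F : ℝ}
    (h : g =ᶠ[nhds x] 0) (hB : 0 ≤ B) (hF : 0 ≤ F) : GeometricDerivBound m g x B F := by
  intro j _
  rw [(h.iteratedFDeriv ℝ j).eq_of_nhds]
  simp only [iteratedFDeriv_zero, Pi.zero_apply, norm_zero]
  positivity

/-- Rescaling of the frequency. -/
theorem GeometricDerivBound.rescale {m : ℕ} {g : E → W} {x : E} {B F C : ℝ}
    (h : GeometricDerivBound m g x B (C * F)) (hC : 1 ≤ C) (hF : 0 ≤ F) :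
    GeometricDerivBound m g x (B * C ^ m) F := by
  intro j hj
  refine (h j hj).trans ?_
  rw [mul_pow, ← mul_assoc]
  have := h.nonneg
  gcongr

theorem GeometricDerivBound.mul {m : ℕ} {f g : E → ℂ} {x : E} {B₁ B₂ F : ℝ}
    (hf : GeometricDerivBound m f x B₁ F) (hg : GeometricDerivBound m g x B₂ F)
    (hfc : ContDiff ℝ ∞ f) (hgc : ContDiff ℝ ∞ g) (hF : 0 ≤ F) :
    GeometricDerivBound m (fun y => f y * g y) x (2 ^ m * (B₁ * B₂)) F := by
  intro j hj
  have hB₁ := hf.nonneg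
  have hB₂ := hg.nonneg
  refine (norm_iteratedFDeriv_mul_le hfc hgc x (n := j) (mod_cast le_top)).trans ?_
  calc ∑ i ∈ Finset.range (j + 1), (j.choose i : ℝ) * ‖iteratedFDeriv ℝ i f x‖ *
        ‖iteratedFDeriv ℝ (j - i) g x‖
      ≤ ∑ i ∈ Finset.range (j + 1), (j.choose i : ℝ) * (B₁ * B₂ * F ^ j) := by
        refine Finset.sum_le_sum fun i hi => ?_
        have hij : i ≤ j := by simpa [Nat.lt_succ_iff] using hi
        rw [mul_assoc]
        refine mul_le_mul_of_nonneg_left ?_ (by positivity)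
        calc _ ≤ (B₁ * F ^ i) * (B₂ * F ^ (j - i)) :=
              mul_le_mul (hf i (hij.trans hj)) (hg _ ((Nat.sub_le _ _).trans hj))
                (norm_nonneg _) (by positivity)
          _ = B₁ * B₂ * F ^ j := by
              rw [mul_mul_mul_comm, ← pow_add, Nat.add_sub_cancel' hij]
    _ = 2 ^ j * (B₁ * B₂) * F ^ j := by
        rw [← Finset.sum_mul, ← Nat.cast_sum, Nat.sum_range_choose]; push_cast; ring
    _ ≤ _ := by
        gcongr
        norm_num

theorem norm_iteratedFDeriv_comp_continuousLinearMap_le {g : E' → W} (hg : ContDiff ℝ ∞ g)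
    (T : E →L[ℝ] E') (x : E) (j : ℕ) :
    ‖iteratedFDeriv ℝ j (fun y => g (T y)) x‖ ≤ ‖iteratedFDeriv ℝ j g (T x)‖ * ‖T‖ ^ j := by
  have := T.iteratedFDeriv_comp_right hg x (i := j) (mod_cast le_top)
  change ‖iteratedFDeriv ℝ j (g ∘ T) x‖ ≤ _
  rw [this]
  refine (ContinuousMultilinearMap.norm_compContinuousLinearMap_le _ _).trans (le_of_eq ?_)
  simp

/-- Writing the composite as `g (F⁻¹ • ·)` after `F • f` moves the frequency from the outer to the
inner function: the outer derivatives become bounded by `B`, those of the inner function by `(C * F)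
^ j` because `F ≤ F ^ j` for `j ≥ 1`. The Faà di Bruno bound then applies directly. -/
theorem GeometricDerivBound.comp {m : ℕ} {g : E' → W} {f : E → E'} {x : E} {B C F : ℝ}
    (hg : GeometricDerivBound m g (f x) B F) (hgc : ContDiff ℝ ∞ g) (hfc : ContDiff ℝ ∞ f)
    (hf : ∀ j, 1 ≤ j → j ≤ m → ‖iteratedFDeriv ℝ j f x‖ ≤ C ^ j) (hF : 1 ≤ F) :
    GeometricDerivBound m (fun y => g (f y)) x (m.factorial * B) (C * F) := by
  intro j hj
  have hF0 : 0 < F := by linarith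
  have hB := hg.nonneg
  let S : E' →L[ℝ] E' := F⁻¹ • ContinuousLinearMap.id ℝ E'
  have hS : ‖S‖ ≤ F⁻¹ := by
    refine (norm_smul_le F⁻¹ (ContinuousLinearMap.id ℝ E')).trans ?_
    rw [Real.norm_of_nonneg (by positivity)]
    exact mul_le_of_le_one_right (by positivity) ContinuousLinearMap.norm_id_le
  have hcomp : (fun y => g (f y)) = (fun z => g (S z)) ∘ (F • f) := by
    ext y
    simp [S, smul_smul, inv_mul_cancel₀ hF0.ne']
  have hSf : S ((F • f) x) = f x := by simp [S, smul_smul, mul_inv_cancel₀ hF0.ne']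
  rw [hcomp]
  have hfc' : ContDiff ℝ ∞ (F • f) := hfc.const_smul F
  refine (norm_iteratedFDeriv_comp_le (n := j) (C := B) (D := C * F)
    (hgc.comp S.contDiff) hfc' (mod_cast le_top) x ?_ ?_).trans ?_
  · intro i hi
    refine (norm_iteratedFDeriv_comp_continuousLinearMap_le hgc S _ i).trans ?_
    rw [hSf]
    calc _ ≤ (B * F ^ i) * F⁻¹ ^ i :=
          mul_le_mul (hg i (hi.trans hj)) (pow_le_pow_left₀ (norm_nonneg _) hS i) (by positivity)
            (by positivity)
      _ = B := by rw [mul_assoc, ← mul_pow, mul_inv_cancel₀ hF0.ne', one_pow, mul_one]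
  · intro i hi1 hi
    rw [iteratedFDeriv_const_smul_apply (hfc.of_le (mod_cast le_top)).contDiffAt, norm_smul,
      Real.norm_of_nonneg hF0.le, mul_pow, mul_comm]
    exact mul_le_mul (hf i hi1 (hi.trans hj)) (le_self_pow₀ hF (by omega)) hF0.le
      ((norm_nonneg _).trans (hf i hi1 (hi.trans hj)))
  · rcases Nat.eq_zero_or_pos j with rfl | hj0
    · simp only [Nat.factorial_zero, Nat.cast_one, one_mul, pow_zero, mul_one]
      exact le_mul_of_one_le_left hB (by exact_mod_cast Nat.factorial_pos m)
    · have hC : 0 ≤ C := by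
        simpa using (norm_nonneg _).trans (hf 1 le_rfl (by omega))
      gcongr

theorem exists_bound_iteratedFDeriv {g : E → W} (hg : ContDiff ℝ ∞ g)
    (hgc : HasCompactSupport g) (m : ℕ) :
    ∃ C : ℝ, 1 ≤ C ∧ ∀ j ≤ m, ∀ x, ‖iteratedFDeriv ℝ j g x‖ ≤ C := by
  have h (j : ℕ) : ∃ C, ∀ x, ‖iteratedFDeriv ℝ j g x‖ ≤ C :=
    (HasCompactSupport.iteratedFDeriv (𝕜 := ℝ) hgc j).exists_bound_of_continuous
      (hg.continuous_iteratedFDeriv (m := j) (mod_cast le_top))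
  choose C hC using h
  have hC0 (j) : 0 ≤ C j := (norm_nonneg _).trans (hC j 0)
  refine ⟨1 + ∑ j ∈ Finset.range (m + 1), C j, ?_, fun j hj x => ?_⟩
  · linarith [Finset.sum_nonneg fun j (_ : j ∈ Finset.range (m + 1)) => hC0 j]
  · have := Finset.single_le_sum (fun j _ => hC0 j) (Finset.mem_range.2 (Nat.lt_succ_of_le hj))
    linarith [hC j x]

theorem contDiff_coe_fourierChar : ContDiff ℝ ∞ fun t : ℝ => (Real.fourierChar t : ℂ) := by
  simp_rw [Real.fourierChar_apply]
  have : ContDiff ℝ ∞ fun t : ℝ => ((2 * Real.pi * t : ℝ) : ℂ) :=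
    Complex.ofRealCLM.contDiff.comp (contDiff_const.mul contDiff_id)
  exact (this.mul contDiff_const).cexp

theorem iteratedDeriv_coe_fourierChar (j : ℕ) (c t : ℝ) :
    iteratedDeriv j (fun t : ℝ => (Real.fourierChar (c * t) : ℂ)) t =
      (2 * Real.pi * c * Complex.I) ^ j * Real.fourierChar (c * t) := by
  induction j generalizing t with
  | zero => simp
  | succ j ih =>
    rw [iteratedDeriv_succ, funext ih]
    simp_rw [Real.fourierChar_apply]
    have h1 : HasDerivAt (fun t : ℝ => Complex.exp ((2 * Real.pi * c * Complex.I) * (t : ℂ)))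
        (Complex.exp ((2 * Real.pi * c * Complex.I) * (t : ℂ)) *
          ((2 * Real.pi * c * Complex.I) * 1)) t :=
      ((hasDerivAt_id (t : ℂ)).const_mul _).cexp.comp_ofReal
    have h2 := (h1.const_mul ((2 * Real.pi * c * Complex.I) ^ j)).deriv
    have h3 (t : ℝ) : ((2 * Real.pi * (c * t) : ℝ) : ℂ) * Complex.I =
        (2 * Real.pi * c * Complex.I) * (t : ℂ) := by push_cast; ring
    simp_rw [h3]
    rw [h2]
    ring

theorem norm_iteratedFDeriv_coe_fourierChar_le {m j : ℕ} (hj : j ≤ m) (t : ℝ) :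
    ‖iteratedFDeriv ℝ j (fun t : ℝ => (Real.fourierChar t : ℂ)) t‖ ≤ (2 * Real.pi) ^ m := by
  have := iteratedDeriv_coe_fourierChar j 1 t
  simp only [one_mul] at this
  rw [norm_iteratedFDeriv_eq_norm_iteratedDeriv, this]
  simp only [Complex.ofReal_one, mul_one, norm_mul, norm_pow, Circle.norm_coe, Complex.norm_I,
    Complex.norm_ofNat, Complex.norm_real, Real.norm_of_nonneg Real.pi_pos.le]
  exact pow_le_pow_right₀ (by linarith [Real.pi_gt_three]) hj

/-- A function vanishing to second order at the origin has small first derivative there. -/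
theorem norm_fderiv_le_of_fderiv_zero {b : E → ℝ} (hb : ContDiff ℝ ∞ b)
    (hbc : HasCompactSupport b) (h0 : fderiv ℝ b 0 = 0) :
    ∃ C : ℝ, 1 ≤ C ∧ ∀ x, ‖fderiv ℝ b x‖ ≤ C * ‖x‖ := by
  obtain ⟨C, hC1, hC⟩ := exists_bound_iteratedFDeriv hb hbc 2
  refine ⟨C, hC1, fun x => ?_⟩
  have hd : ContDiff ℝ 1 (fderiv ℝ b) := hb.fderiv_right (m := 1) (by norm_cast)
  have := Convex.norm_image_sub_le_of_norm_fderiv_le (𝕜 := ℝ) (f := fderiv ℝ b) (C := C)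
    (s := Set.univ) (x := 0) (y := x)
    (fun y _ => (hd.differentiable (by simp)) y) (fun y _ => ?_) convex_univ trivial trivial
  · simpa [h0] using this
  · have h2 := hC 2 le_rfl y
    rwa [← norm_iteratedFDeriv_fderiv, norm_iteratedFDeriv_one] at h2
end DerivativeBounds

theorem eventuallyEq_zero_of_tsupport_subset_closedBall {E' : Type*}
    [NormedAddCommGroup E'] {ψ : E' → ℂ} {r : ℝ}
    (hψr : tsupport ψ ⊆ Metric.closedBall 0 r) {z : E'} (hz : r < ‖z‖) : ψ =ᶠ[nhds z] 0 := by
  rw [← notMem_tsupport_iff_eventuallyEq]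
  intro h
  have := hψr h
  rw [mem_closedBall_zero_iff] at this
  linarith

/-! ### Model bumps and their derivatives. -/

section TestFunctions

variable {E E' : Type*} [NormedAddCommGroup E] [NormedSpace ℝ E] [NormedAddCommGroup E']
  [NormedSpace ℝ E']

/-- The restriction to the graph of `b` of a bump at scale `N⁻¹` modulated in the normal direction
with frequency `M`. -/
noncomputable def modulatedBump (ψ : E' → ℂ) (b : E' → ℝ) (N M : ℝ) (ζ : E') : ℂ :=
  (Real.fourierChar (M * b ζ) : ℂ) * ψ (N • ζ)

/-- A bump of the size `P / N` times a profile concentrated near the graph of the rescaled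
function `L * b (P⁻¹ • ·)`. -/
noncomputable def rescaledBump (T : E →L[ℝ] E') (η : E →L[ℝ] ℝ) (ψ : E' → ℂ) (q : ℝ → ℂ) (b : E' → ℝ)
    (N P L : ℝ) (y : E) : ℂ :=
  ψ ((N / P) • T y) * q (η y - L * b (P⁻¹ • T y))

variable {ψ : E' → ℂ} {q : ℝ → ℂ} {b : E' → ℝ} {r : ℝ}

theorem contDiff_modulatedBump (hψ : ContDiff ℝ ∞ ψ) (hb : ContDiff ℝ ∞ b) (N M : ℝ) :
    ContDiff ℝ ∞ (modulatedBump ψ b N M) :=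
  (contDiff_coe_fourierChar.comp (contDiff_const.mul hb)).mul (hψ.comp (contDiff_const_smul N))

theorem contDiff_rescaledBump (T : E →L[ℝ] E') (η : E →L[ℝ] ℝ) (hψ : ContDiff ℝ ∞ ψ)
    (hq : ContDiff ℝ ∞ q) (hb : ContDiff ℝ ∞ b) (N P L : ℝ) :
    ContDiff ℝ ∞ (rescaledBump T η ψ q b N P L) :=
  (hψ.comp (contDiff_const.smul T.contDiff)).mul
    (hq.comp (η.contDiff.sub (contDiff_const.mul (hb.comp (contDiff_const.smul T.contDiff)))))

/-- On the support `‖ζ‖ ≤ |r| / N`, so the vanishing of `fderiv ℝ b 0` makes the first derivative of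
the phase `M * b` at most of order `F * N / N = F`. From the second order on, the crude bound `|M| ≤
F * N ≤ F ^ 2 ≤ F ^ j` suffices. The cutoff has frequency `N ≤ F`. -/
theorem modulatedBump_bound (hψ : ContDiff ℝ ∞ ψ) (hψr : tsupport ψ ⊆ Metric.closedBall 0 r)
    (hψc : HasCompactSupport ψ)
    (hb : ContDiff ℝ ∞ b) (hbc : HasCompactSupport b) (hdb : fderiv ℝ b 0 = 0) (m : ℕ) :
    ∃ B : ℝ, 0 ≤ B ∧ ∀ N F M : ℝ, 1 ≤ N → N ≤ F → |M| ≤ F * N → ∀ ζ,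
      GeometricDerivBound m (modulatedBump ψ b N M) ζ B F := by
  obtain ⟨C, hC1, hC⟩ := exists_bound_iteratedFDeriv hb hbc m
  obtain ⟨C₂, hC₂1, hC₂⟩ := norm_fderiv_le_of_fderiv_zero hb hbc hdb
  obtain ⟨C₃, hC₃1, hC₃⟩ := exists_bound_iteratedFDeriv hψ hψc m
  set D : ℝ := C + C₂ * |r| with hD
  have hD1 : 1 ≤ D := by
    have : 0 ≤ C₂ * |r| := by positivity
    linarith
  refine ⟨2 ^ m * ((m.factorial * (2 * Real.pi) ^ m) * D ^ m * C₃), by positivity,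
    fun N F M hN hNF hM ζ => ?_⟩
  have hF : 1 ≤ F := hN.trans hNF
  have hN0 : 0 < N := by linarith
  by_cases hζ : r < ‖N • ζ‖
  · refine GeometricDerivBound.of_eventuallyEq_zero ?_ (by positivity) (by linarith)
    have h1 := (continuous_const_smul N).tendsto ζ
      (eventuallyEq_zero_of_tsupport_subset_closedBall hψr hζ)
    filter_upwards [h1] with z hz
    have hz : ψ (N • z) = 0 := hz
    simp [modulatedBump, hz]
  · have hζ' : ‖ζ‖ ≤ |r| / N := by
      rw [not_lt, norm_smul, Real.norm_of_nonneg hN0.le] at hζ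
      rw [le_div_iff₀ hN0]
      linarith [le_abs_self r]
    have h1 : GeometricDerivBound m (fun ζ => (Real.fourierChar (M * b ζ) : ℂ)) ζ
        (m.factorial * (2 * Real.pi) ^ m) (D * F) := by
      have h0 : GeometricDerivBound m (fun t : ℝ => (Real.fourierChar t : ℂ)) (M * b ζ)
          ((2 * Real.pi) ^ m) 1 := fun j hj => by
        simpa using norm_iteratedFDeriv_coe_fourierChar_le hj _
      have := h0.comp (f := fun ζ => M * b ζ) (C := D * F) contDiff_coe_fourierChar
        (contDiff_const.mul hb) (fun j hj1 hj => ?_) le_rfl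
      · simpa using this
      · change ‖iteratedFDeriv ℝ j (M • b) ζ‖ ≤ _
        rw [iteratedFDeriv_const_smul_apply (hb.of_le (mod_cast le_top)).contDiffAt, norm_smul,
          Real.norm_eq_abs]
        rcases hj1.eq_or_lt with rfl | hj2
        · rw [norm_iteratedFDeriv_one, pow_one]
          calc |M| * ‖fderiv ℝ b ζ‖ ≤ (F * N) * (C₂ * (|r| / N)) := by
                gcongr
                exact (hC₂ ζ).trans (by gcongr)
            _ = (C₂ * |r|) * F := by field_simp
            _ ≤ D * F := by
                gcongr
                linarith
        · calc |M| * ‖iteratedFDeriv ℝ j b ζ‖ ≤ (F * F) * C := by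
                gcongr
                · exact hM.trans (by gcongr)
                · exact hC j hj ζ
            _ ≤ (F * F) * D := by
                gcongr
                have : 0 ≤ C₂ * |r| := by positivity
                linarith
            _ ≤ F ^ j * D ^ j := by
                gcongr
                · rw [← sq]; exact pow_le_pow_right₀ hF hj2
                · exact le_self_pow₀ hD1 (by omega)
            _ = (D * F) ^ j := by rw [mul_pow, mul_comm]
    have h2 : GeometricDerivBound m (fun ζ => ψ (N • ζ)) ζ C₃ F := by
      intro j hj
      let S : E' →L[ℝ] E' := N • ContinuousLinearMap.id ℝ E'
      have hS : ‖S‖ ≤ N := by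
        refine (norm_smul_le N (ContinuousLinearMap.id ℝ E')).trans ?_
        rw [Real.norm_of_nonneg (by positivity)]
        exact mul_le_of_le_one_right (by positivity) ContinuousLinearMap.norm_id_le
      refine (norm_iteratedFDeriv_comp_continuousLinearMap_le hψ S ζ j).trans ?_
      exact mul_le_mul (hC₃ j hj _) (pow_le_pow_left₀ (norm_nonneg _) (hS.trans hNF) _)
        (by positivity) (by positivity)
    exact (h1.rescale hD1 (by linarith)).mul h2
      (contDiff_coe_fourierChar.comp (contDiff_const.mul hb)) (hψ.comp (contDiff_const_smul N))
      (by linarith)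

/-- The defining function of the rescaled graph has bounded derivatives. The first one is at most of
order `L * P⁻¹ * N⁻¹ ≤ 1`, because `b` is flat to first order at the origin and `‖P⁻¹ • T y‖ ≤ |r| /
N` on the support. Those of order `j ≥ 2` are at most of order `L * P ^ (-j) ≤ P ^ (2 - j) ≤ 1`. The
cutoff varies at the rate `N / P ≤ 1`. -/
theorem rescaledBump_bound (T : E →L[ℝ] E') (η : E →L[ℝ] ℝ) (hψ : ContDiff ℝ ∞ ψ)
    (hψr : tsupport ψ ⊆ Metric.closedBall 0 r) (hψc : HasCompactSupport ψ)
    (hq : ContDiff ℝ ∞ q) (hqc : HasCompactSupport q)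
    (hb : ContDiff ℝ ∞ b) (hbc : HasCompactSupport b) (hdb : fderiv ℝ b 0 = 0) (m : ℕ) :
    ∃ B : ℝ, 0 ≤ B ∧ ∀ N P L : ℝ, 1 ≤ N → N ≤ P → 0 < L → L ≤ P * N → ∀ y,
      GeometricDerivBound m (rescaledBump T η ψ q b N P L) y B 1 := by
  obtain ⟨C, hC1, hC⟩ := exists_bound_iteratedFDeriv hb hbc m
  obtain ⟨C₂, hC₂1, hC₂⟩ := norm_fderiv_le_of_fderiv_zero hb hbc hdb
  obtain ⟨C₃, hC₃1, hC₃⟩ := exists_bound_iteratedFDeriv hψ hψc m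
  obtain ⟨C₄, hC₄1, hC₄⟩ := exists_bound_iteratedFDeriv hq hqc m
  set t := 1 + ‖T‖ with ht
  have ht1 : 1 ≤ t := by linarith [norm_nonneg T]
  have htT : ‖T‖ ≤ t := by linarith
  set D : ℝ := ‖η‖ + C₂ * |r| * t + C * t with hD
  have h0 : 0 ≤ C₂ * |r| * t := by positivity
  have hCt : C * t ≤ D := by linarith [norm_nonneg η]
  have hD1 : 1 ≤ D := by nlinarith
  have hηD : ‖η‖ + C₂ * |r| * t ≤ D := by nlinarith
  refine ⟨2 ^ m * ((C₃ * t ^ m) * ((m.factorial * C₄) * D ^ m)), by positivity,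
    fun N P L hN hNP hL hLP y => ?_⟩
  have hP : 1 ≤ P := hN.trans hNP
  have hN0 : 0 < N := by linarith
  have hP0 : 0 < P := by linarith
  by_cases hy : r < ‖(N / P) • T y‖
  · refine GeometricDerivBound.of_eventuallyEq_zero ?_ (by positivity) (by linarith)
    have hcont : Continuous fun y => (N / P) • T y := by fun_prop
    have h1 := hcont.tendsto y (eventuallyEq_zero_of_tsupport_subset_closedBall hψr hy)
    filter_upwards [h1] with z hz
    have hz : ψ ((N / P) • T z) = 0 := hz
    simp [rescaledBump, hz]
  · have hy' : ‖P⁻¹ • T y‖ ≤ |r| / N := by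
      rw [not_lt, norm_smul, Real.norm_of_nonneg (by positivity)] at hy
      rw [norm_smul, Real.norm_of_nonneg (by positivity), le_div_iff₀ hN0]
      calc _ = N / P * ‖T y‖ := by field_simp
        _ ≤ _ := hy.trans (le_abs_self r)
    let S : E →L[ℝ] E' := P⁻¹ • T
    have hS : ‖S‖ ≤ P⁻¹ * t := by
      refine (norm_smul_le P⁻¹ T).trans ?_
      rw [Real.norm_of_nonneg (by positivity)]
      gcongr
    have hSb : ContDiff ℝ ∞ fun y => b (S y) := hb.comp S.contDiff
    have hLb : ContDiff ℝ ∞ fun y => L * b (S y) := contDiff_const.mul hSb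
    have h1 : GeometricDerivBound m (fun y => q (η y - L * b (S y))) y
        ((m.factorial * C₄) * D ^ m) 1 := by
      have hq0 : GeometricDerivBound m q (η y - L * b (S y)) C₄ 1 := fun j hj => by
        simpa using hC₄ j hj _
      have := hq0.comp (f := fun y => η y - L * b (S y)) (C := D) hq
        (η.contDiff.sub hLb) (fun j hj1 hj => ?_) le_rfl
      · exact this.rescale hD1 zero_le_one
      · have hηj : ‖iteratedFDeriv ℝ j (fun y => η y) y‖ ≤ if j = 1 then ‖η‖ else 0 := by
          rcases hj1.eq_or_lt with rfl | hj2
          · simp [norm_iteratedFDeriv_one]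
          · rw [if_neg (by omega)]
            have := η.iteratedFDeriv_comp_right (f := fun t : ℝ => t) (n := ∞) contDiff_id y
              (i := j) (mod_cast le_top)
            change ‖iteratedFDeriv ℝ j ((fun t : ℝ => t) ∘ η) y‖ ≤ 0
            rw [this]
            refine (ContinuousMultilinearMap.norm_compContinuousLinearMap_le _ _).trans ?_
            rw [norm_iteratedFDeriv_eq_norm_iteratedDeriv, iteratedDeriv_fun_id]
            rw [if_neg (by omega), if_neg (by omega)]
            simp
        have hbj : ‖iteratedFDeriv ℝ j (fun y => L * b (S y)) y‖ ≤
            L * (‖iteratedFDeriv ℝ j b (S y)‖ * (P⁻¹ * t) ^ j) := by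
          change ‖iteratedFDeriv ℝ j (L • fun y => b (S y)) y‖ ≤ _
          rw [iteratedFDeriv_const_smul_apply (hSb.of_le (mod_cast le_top)).contDiffAt, norm_smul,
            Real.norm_of_nonneg hL.le]
          gcongr
          refine (norm_iteratedFDeriv_comp_continuousLinearMap_le hb S y j).trans ?_
          gcongr
        have hsub : iteratedFDeriv ℝ j (fun y => η y - L * b (S y)) y =
            iteratedFDeriv ℝ j (fun y => η y) y - iteratedFDeriv ℝ j (fun y => L * b (S y)) y :=
          iteratedFDeriv_sub_apply (η.contDiff.contDiffAt) (hLb.of_le (mod_cast le_top)).contDiffAt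
        rw [hsub]
        refine (norm_sub_le _ _).trans ((add_le_add hηj hbj).trans ?_)
        rcases hj1.eq_or_lt with rfl | hj2
        · rw [norm_iteratedFDeriv_one, pow_one, pow_one, if_pos rfl]
          refine le_trans (add_le_add le_rfl ?_) hηD
          calc L * (‖fderiv ℝ b (S y)‖ * (P⁻¹ * t)) ≤ (P * N) * ((C₂ * (|r| / N)) * (P⁻¹ * t)) := by
                gcongr
                exact (hC₂ _).trans (mul_le_mul_of_nonneg_left hy' (by positivity))
            _ = _ := by field_simp
        · rw [if_neg (by omega), zero_add]
          calc L * (‖iteratedFDeriv ℝ j b (S y)‖ * (P⁻¹ * t) ^ j)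
              ≤ P ^ j * (C ^ j * (P⁻¹ * t) ^ j) := by
                gcongr
                · calc L ≤ P * P := hLP.trans (by gcongr)
                    _ ≤ P ^ j := by rw [← sq]; exact pow_le_pow_right₀ hP hj2
                · exact (hC j hj _).trans (le_self_pow₀ hC1 (by omega))
            _ = (C * t) ^ j := by
                rw [← mul_pow, ← mul_pow]; congr 1; field_simp
            _ ≤ D ^ j := by gcongr
    have h2 : GeometricDerivBound m (fun y => ψ ((N / P) • T y)) y (C₃ * t ^ m) 1 := by
      intro j hj
      let R : E →L[ℝ] E' := (N / P) • T
      have hR : ‖R‖ ≤ t := by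
        refine (norm_smul_le (N / P) T).trans ?_
        rw [Real.norm_of_nonneg (by positivity)]
        calc N / P * ‖T‖ ≤ 1 * ‖T‖ := by
              gcongr
              exact (div_le_one hP0).2 hNP
          _ ≤ t := by linarith
      refine (norm_iteratedFDeriv_comp_continuousLinearMap_le hψ R y j).trans ?_
      rw [one_pow, mul_one]
      exact mul_le_mul (hC₃ j hj _) ((pow_le_pow_left₀ (norm_nonneg _) hR _).trans
        (pow_le_pow_right₀ ht1 hj)) (by positivity) (by positivity)
    exact h2.mul h1 (hψ.comp (contDiff_const.smul T.contDiff)) (hq.comp (η.contDiff.sub hLb))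
      zero_le_one

end TestFunctions

/-! ### Bumps adapted to a graph: support, rescaling and `L^p` norms. -/

/-- Linear coordinates `Y` around a point `x₀`, in which a hypersurface is to be the graph of `b`,
with tangent plane `ℝ^{d-1} × {0}`, together with a cutoff function of the tangential variable. -/
structure GraphFrame (d : ℕ) where
  Y : EuclideanSpace ℝ (Fin d) ≃L[ℝ] EuclideanSpace ℝ (Fin (d - 1)) × ℝ
  x₀ : EuclideanSpace ℝ (Fin d)
  b : EuclideanSpace ℝ (Fin (d - 1)) → ℝ
  contDiff_b : ContDiff ℝ ∞ b
  hasCompactSupport_b : HasCompactSupport b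
  b_zero : b 0 = 0
  fderiv_b_zero : fderiv ℝ b 0 = 0
  r : ℝ
  r_pos : 0 < r
  ψ : EuclideanSpace ℝ (Fin (d - 1)) → ℂ
  contDiff_ψ : ContDiff ℝ ∞ ψ
  tsupport_ψ : tsupport ψ ⊆ Metric.closedBall 0 r

namespace GraphFrame

variable {d : ℕ} (D : GraphFrame d)

/-- The tangential coordinates. -/
def T : EuclideanSpace ℝ (Fin d) →L[ℝ] EuclideanSpace ℝ (Fin (d - 1)) :=
  (ContinuousLinearMap.fst ℝ _ ℝ).comp (D.Y : _ →L[ℝ] EuclideanSpace ℝ (Fin (d - 1)) × ℝ)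

/-- The normal coordinate. -/
def η : EuclideanSpace ℝ (Fin d) →L[ℝ] ℝ :=
  (ContinuousLinearMap.snd ℝ (EuclideanSpace ℝ (Fin (d - 1))) ℝ).comp
    (D.Y : _ →L[ℝ] EuclideanSpace ℝ (Fin (d - 1)) × ℝ)

theorem Y_apply (y : EuclideanSpace ℝ (Fin d)) : D.Y y = (D.T y, D.η y) := rfl

theorem hasCompactSupport_ψ : HasCompactSupport D.ψ :=
  HasCompactSupport.of_support_subset_isCompact (isCompact_closedBall 0 D.r)
    ((subset_tsupport _).trans D.tsupport_ψ)

/-- A bump adapted to the graph of `b`, of tangential size `N⁻¹` and normal size `L⁻¹`, modulated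
in the normal direction with frequency `M`. -/
noncomputable def graphBump (q : ℝ → ℂ) (N M L : ℝ) (ξ : EuclideanSpace ℝ (Fin d)) : ℂ :=
  (Real.fourierChar (M * D.η (ξ - D.x₀)) : ℂ) *
    (D.ψ (N • D.T (ξ - D.x₀)) * q (L * (D.η (ξ - D.x₀) - D.b (D.T (ξ - D.x₀)))))

theorem contDiff_graphBump {q : ℝ → ℂ} (hq : ContDiff ℝ ∞ q) (N M L : ℝ) :
    ContDiff ℝ ∞ (D.graphBump q N M L) := by
  have h : ContDiff ℝ ∞ fun ξ : EuclideanSpace ℝ (Fin d) => ξ - D.x₀ :=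
    contDiff_id.sub contDiff_const
  have hη : ContDiff ℝ ∞ fun ξ => D.η (ξ - D.x₀) := D.η.contDiff.comp h
  have hT : ContDiff ℝ ∞ fun ξ => D.T (ξ - D.x₀) := D.T.contDiff.comp h
  have hNT : ContDiff ℝ ∞ fun ξ => N • D.T (ξ - D.x₀) := hT.const_smul N
  exact (contDiff_coe_fourierChar.comp (contDiff_const.mul hη)).mul
    ((D.contDiff_ψ.comp hNT).mul (hq.comp (contDiff_const.mul (hη.sub (D.contDiff_b.comp hT)))))

theorem exists_abs_b_le : ∃ C : ℝ, 1 ≤ C ∧ ∀ ζ, |D.b ζ| ≤ C * ‖ζ‖ := by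
  obtain ⟨C, hC1, hC⟩ := exists_bound_iteratedFDeriv D.contDiff_b D.hasCompactSupport_b 1
  refine ⟨C, hC1, fun ζ => ?_⟩
  have := Convex.norm_image_sub_le_of_norm_fderiv_le (𝕜 := ℝ) (f := D.b) (C := C)
    (s := Set.univ) (x := 0) (y := ζ)
    (fun y _ => (D.contDiff_b.differentiable (by simp)) y)
    (fun y _ => by simpa [norm_iteratedFDeriv_one] using hC 1 le_rfl y) convex_univ trivial trivial
  simpa [D.b_zero] using this

/-- Near the graph the normal coordinate is controlled by the tangential one because `b` is
Lipschitz with `b 0 = 0`. With `t = 0` it bounds the distance from the centre along the graph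
itself. -/
theorem norm_le_of_graph : ∃ C : ℝ, 1 ≤ C ∧ ∀ ξ, ∀ t : ℝ, |D.η ξ - D.b (D.T ξ)| ≤ t →
    ‖ξ‖ ≤ C * (‖D.T ξ‖ + t) := by
  obtain ⟨C, hC1, hC⟩ := D.exists_abs_b_le
  set A := ‖(D.Y.symm : EuclideanSpace ℝ (Fin (d - 1)) × ℝ →L[ℝ] EuclideanSpace ℝ (Fin d))‖
  refine ⟨(A + 1) * (C + 1), ?_, fun ξ t ht => ?_⟩
  · have : 0 ≤ A := norm_nonneg _
    nlinarith
  have hA : 0 ≤ A := norm_nonneg _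
  have h1 : ‖ξ‖ ≤ A * ‖D.Y ξ‖ := by
    have := (D.Y.symm : EuclideanSpace ℝ (Fin (d - 1)) × ℝ →L[ℝ] EuclideanSpace ℝ (Fin d)).le_opNorm (D.Y ξ)
    simpa using this
  have h2 : ‖D.Y ξ‖ ≤ ‖D.T ξ‖ + |D.η ξ| := by
    rw [Y_apply, Prod.norm_def]
    exact max_le (by simp) (by simp)
  have h3 : |D.η ξ| ≤ t + C * ‖D.T ξ‖ := by
    have := abs_sub_abs_le_abs_sub (D.η ξ) (D.b (D.T ξ))
    linarith [hC (D.T ξ)]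
  have ht0 : 0 ≤ t := (abs_nonneg _).trans ht
  calc ‖ξ‖ ≤ A * (‖D.T ξ‖ + (t + C * ‖D.T ξ‖)) :=
        h1.trans (mul_le_mul_of_nonneg_left (by linarith) hA)
    _ ≤ (A + 1) * ((C + 1) * (‖D.T ξ‖ + t)) := by
        have := norm_nonneg (D.T ξ)
        apply mul_le_mul (by linarith) (by nlinarith) (by positivity) (by linarith)
    _ = _ := by ring

theorem support_graphBump_subset {C : ℝ} (hC1 : 1 ≤ C)
    (hC : ∀ ξ, ∀ t : ℝ, |D.η ξ - D.b (D.T ξ)| ≤ t → ‖ξ‖ ≤ C * (‖D.T ξ‖ + t)) {q : ℝ → ℂ}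
    (hqr : tsupport q ⊆ Metric.closedBall 0 D.r) {N M L : ℝ} (hN : 1 ≤ N) (hL : 1 ≤ L) :
    Function.support (D.graphBump q N M L) ⊆ Metric.closedBall D.x₀ (C * (2 * D.r)) := by
  intro ξ hξ
  rw [Function.mem_support, graphBump] at hξ
  have h1 : D.ψ (N • D.T (ξ - D.x₀)) ≠ 0 := fun h => hξ (by rw [h]; ring)
  have h2 : q (L * (D.η (ξ - D.x₀) - D.b (D.T (ξ - D.x₀)))) ≠ 0 := fun h => hξ (by rw [h]; ring)
  have h1 := mem_closedBall_zero_iff.1 (D.tsupport_ψ (subset_tsupport _ h1))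
  have h2 := mem_closedBall_zero_iff.1 (hqr (subset_tsupport _ h2))
  rw [norm_smul, Real.norm_of_nonneg (by linarith)] at h1
  rw [norm_mul, Real.norm_of_nonneg (by linarith), Real.norm_eq_abs] at h2
  rw [Metric.mem_closedBall, dist_eq_norm]
  have h3 := hC (ξ - D.x₀) D.r (by nlinarith [abs_nonneg (D.η (ξ - D.x₀) - D.b (D.T (ξ - D.x₀)))])
  have : ‖D.T (ξ - D.x₀)‖ ≤ D.r := by nlinarith [norm_nonneg (D.T (ξ - D.x₀))]
  exact h3.trans (mul_le_mul_of_nonneg_left (by linarith) (by linarith))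

theorem hasCompactSupport_graphBump {q : ℝ → ℂ}
    (hqr : tsupport q ⊆ Metric.closedBall 0 D.r) {N M L : ℝ} (hN : 1 ≤ N) (hL : 1 ≤ L) :
    HasCompactSupport (D.graphBump q N M L) := by
  obtain ⟨C, hC1, hC⟩ := D.norm_le_of_graph
  exact HasCompactSupport.of_support_subset_isCompact (isCompact_closedBall _ _)
    (D.support_graphBump_subset hC1 hC hqr hN hL)

/-- The anisotropic dilation by `P⁻¹` in the tangential and by `L⁻¹` in the normal variable. -/
noncomputable def dilation {P L : ℝ} (hP : P ≠ 0) (hL : L ≠ 0) :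
    EuclideanSpace ℝ (Fin d) ≃L[ℝ] EuclideanSpace ℝ (Fin d) :=
  (D.Y.trans ((ContinuousLinearEquiv.smulLeft (Units.mk0 P⁻¹ (inv_ne_zero hP))).prodCongr
    (ContinuousLinearEquiv.smulLeft (Units.mk0 L⁻¹ (inv_ne_zero hL))))).trans D.Y.symm

theorem Y_dilation {P L : ℝ} (hP : P ≠ 0) (hL : L ≠ 0) (y : EuclideanSpace ℝ (Fin d)) :
    D.Y (D.dilation hP hL y) = (P⁻¹ • D.T y, L⁻¹ * D.η y) := by
  simp only [dilation, ContinuousLinearEquiv.trans_apply, ContinuousLinearEquiv.apply_symm_apply]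
  rfl

theorem det_dilation {P L : ℝ} (hP : P ≠ 0) (hL : L ≠ 0) :
    LinearMap.det (D.dilation hP hL : EuclideanSpace ℝ (Fin d) →ₗ[ℝ] _) =
      P⁻¹ ^ (d - 1) * L⁻¹ := by
  have h : (D.dilation hP hL : EuclideanSpace ℝ (Fin d) →ₗ[ℝ] EuclideanSpace ℝ (Fin d)) =
      (D.Y.symm.toLinearEquiv : _ →ₗ[ℝ] EuclideanSpace ℝ (Fin d)) ∘ₗ
        ((P⁻¹ • LinearMap.id).prodMap (L⁻¹ • LinearMap.id)) ∘ₗ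
        (D.Y.symm.toLinearEquiv.symm : _ →ₗ[ℝ] EuclideanSpace ℝ (Fin (d - 1)) × ℝ) := rfl
  rw [h, LinearMap.det_conj, LinearMap.det_prodMap, LinearMap.det_smul, LinearMap.det_smul]
  simp

/-- The dilation brings the normal width to unit size, and the modulation becomes the linear phase
of slope `M / L`, invisible to `L^p` norms in physical space. The scale `P` is free: `P = N` suits
Knapp examples and `P = L` suits slabs. -/
theorem graphBump_dilation (q : ℝ → ℂ) {P L : ℝ} (hP : P ≠ 0) (hL : L ≠ 0) (N M : ℝ)
    (y : EuclideanSpace ℝ (Fin d)) :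
    D.graphBump q N M L (D.x₀ + D.dilation hP hL y) =
      (Real.fourierChar (((M / L) • D.η) y) : ℂ) * rescaledBump D.T D.η D.ψ q D.b N P L y := by
  have h := D.Y_dilation hP hL y
  rw [Y_apply, Prod.mk.injEq] at h
  rw [graphBump, rescaledBump, add_sub_cancel_left, h.1, h.2, smul_smul, mul_sub,
    ← mul_assoc L, mul_inv_cancel₀ hL, one_mul, smul_apply, smul_eq_mul]
  congr 3
  field_simp

/-- The part of the tube of radius `r` around a graph that lies over a ball. -/
theorem volume_tube_le : ∃ C : ℝ≥0, ∀ (g : EuclideanSpace ℝ (Fin (d - 1)) → ℝ) (R ρ : ℝ),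
    Continuous g → 0 ≤ R → 0 ≤ ρ →
    volume {y : EuclideanSpace ℝ (Fin d) | ‖D.T y‖ ≤ R ∧ |D.η y - g (D.T y)| ≤ ρ} ≤
      C * ENNReal.ofReal (R ^ (d - 1) * ρ) := by
  have hHaar : (Measure.map D.Y (volume : Measure (EuclideanSpace ℝ (Fin d)))).IsAddHaarMeasure :=
    D.Y.isAddHaarMeasure_map volume
  have hprod : (volume : Measure (EuclideanSpace ℝ (Fin (d - 1)) × ℝ)).IsAddHaarMeasure :=
    Measure.prod.instIsAddHaarMeasure _ _
  -- The coordinates `Y` need not preserve volume. Uniqueness of Haar measure reduces the claim, up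
  -- to a constant, to Fubini on the product.
  set c := Measure.addHaarScalarFactor (Measure.map D.Y (volume : Measure (EuclideanSpace ℝ (Fin d))))
    (volume : Measure (EuclideanSpace ℝ (Fin (d - 1)) × ℝ))
  have hmap : Measure.map D.Y (volume : Measure (EuclideanSpace ℝ (Fin d))) =
      c • (volume : Measure (EuclideanSpace ℝ (Fin (d - 1)) × ℝ)) :=
    Measure.isAddLeftInvariant_eq_smul _ _
  refine ⟨c * (volume (Metric.closedBall (0 : EuclideanSpace ℝ (Fin (d - 1))) 1)).toNNReal * 2,
    fun g R ρ hg hR hρ => ?_⟩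
  let K : Set (EuclideanSpace ℝ (Fin (d - 1)) × ℝ) := {z | ‖z.1‖ ≤ R ∧ |z.2 - g z.1| ≤ ρ}
  have hK : IsClosed K :=
    IsClosed.inter (s₁ := {z : EuclideanSpace ℝ (Fin (d - 1)) × ℝ | ‖z.1‖ ≤ R})
      (s₂ := {z | |z.2 - g z.1| ≤ ρ}) (isClosed_le (by fun_prop) continuous_const)
      (isClosed_le (by fun_prop) continuous_const)
  have h1 : volume {y : EuclideanSpace ℝ (Fin d) | ‖D.T y‖ ≤ R ∧ |D.η y - g (D.T y)| ≤ ρ} =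
      Measure.map D.Y (volume : Measure (EuclideanSpace ℝ (Fin d))) K := by
    rw [Measure.map_apply D.Y.continuous.measurable hK.measurableSet]
    rfl
  have h2 : volume K ≤ volume (Metric.closedBall (0 : EuclideanSpace ℝ (Fin (d - 1))) R) *
      ENNReal.ofReal (2 * ρ) := by
    rw [Measure.volume_eq_prod, Measure.prod_apply hK.measurableSet]
    calc _ ≤ ∫⁻ ζ, (Metric.closedBall (0 : EuclideanSpace ℝ (Fin (d - 1))) R).indicator
          (fun _ => ENNReal.ofReal (2 * ρ)) ζ := by
          refine lintegral_mono fun ζ => ?_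
          by_cases hζ : ‖ζ‖ ≤ R
          · rw [Set.indicator_of_mem (mem_closedBall_zero_iff.2 hζ), ← Real.volume_closedBall (g ζ)]
            refine measure_mono fun t ht => ?_
            exact ht.2
          · have : Prod.mk ζ ⁻¹' K = ∅ := by
              ext t
              simp only [Set.mem_preimage, Set.mem_empty_iff_false, iff_false]
              exact fun h => hζ h.1
            simp [this]
      _ = _ := by
          rw [lintegral_indicator_const Metric.isClosed_closedBall.measurableSet, mul_comm]
  rw [h1, hmap]
  rw [Measure.smul_apply, ENNReal.smul_def, smul_eq_mul]
  refine (mul_le_mul_right h2 _).trans (le_of_eq ?_)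
  rw [Measure.addHaar_closedBall' _ _ hR, ENNReal.coe_mul, ENNReal.coe_mul,
    ENNReal.coe_toNNReal measure_closedBall_lt_top.ne, ENNReal.ofReal_mul zero_le_two,
    ENNReal.ofReal_mul (by positivity)]
  simp only [finrank_euclideanSpace, Fintype.card_fin, ENNReal.ofReal_ofNat, ENNReal.coe_ofNat]
  ring

end GraphFrame

namespace GraphFrame

variable {d : ℕ} (D : GraphFrame d)

theorem support_rescaledBump_subset {q : ℝ → ℂ} (hqr : tsupport q ⊆ Metric.closedBall 0 D.r)
    {N P L : ℝ} (hN : 0 < N) (hP : 0 < P) :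
    Function.support (rescaledBump D.T D.η D.ψ q D.b N P L) ⊆
      {y | ‖D.T y‖ ≤ D.r * (P / N) ∧ |D.η y - L * D.b (P⁻¹ • D.T y)| ≤ D.r} := by
  intro y hy
  rw [Function.mem_support, rescaledBump] at hy
  have h1 : D.ψ ((N / P) • D.T y) ≠ 0 := fun h => hy (by rw [h]; ring)
  have h2 : q (D.η y - L * D.b (P⁻¹ • D.T y)) ≠ 0 := fun h => hy (by rw [h]; ring)
  have h1 := mem_closedBall_zero_iff.1 (D.tsupport_ψ (subset_tsupport _ h1))
  have h2 := mem_closedBall_zero_iff.1 (hqr (subset_tsupport _ h2))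
  refine ⟨?_, h2⟩
  rw [norm_smul, Real.norm_of_nonneg (by positivity)] at h1
  have : ‖D.T y‖ = N / P * ‖D.T y‖ * (P / N) := by field_simp
  rw [this]
  gcongr

theorem hasCompactSupport_rescaledBump {q : ℝ → ℂ}
    (hqr : tsupport q ⊆ Metric.closedBall 0 D.r) {N P L : ℝ} (hN : 1 ≤ N) (hP : 0 < P)
    (hL : 1 ≤ L) : HasCompactSupport (rescaledBump D.T D.η D.ψ q D.b N P L) := by
  have hL0 : L ≠ 0 := by linarith
  -- For `M = 0` the phase is trivial, so the rescaled bump is a graph bump pulled back by a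
  -- homeomorphism.
  have h := (D.hasCompactSupport_graphBump hqr hN hL (M := 0)).comp_homeomorph
    ((D.dilation hP.ne' hL0).toHomeomorph.trans (Homeomorph.addLeft D.x₀))
  convert h using 1
  ext y
  change _ = D.graphBump q N 0 L (D.x₀ + D.dilation hP.ne' hL0 y)
  simp [graphBump_dilation]

/-- After the anisotropic dilation the profile has uniformly bounded derivatives and lives on a tube
of volume at most of order `(P / N) ^ (d - 1)`. The first factor on the right is the Jacobian to the
power `1 - 1 / p`, the second the square root of that volume from the `L²` bound. -/
theorem eLpNorm_fourierInv_graphBump_le {q : ℝ → ℂ} (hq : ContDiff ℝ ∞ q)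
    (hqr : tsupport q ⊆ Metric.closedBall 0 D.r) {p : ℝ} (hp : 1 ≤ p) (hp2 : p < 2) :
    ∃ C : ℝ≥0, ∀ N P L M : ℝ, 1 ≤ N → N ≤ P → 1 ≤ L → L ≤ P * N →
      ∀ F : 𝓢(EuclideanSpace ℝ (Fin d), ℂ), (∀ ξ, F ξ = D.graphBump q N M L ξ) →
      eLpNorm (𝓕⁻ F : 𝓢(EuclideanSpace ℝ (Fin d), ℂ)) (ENNReal.ofReal p) volume ≤
        C * ENNReal.ofReal ((P⁻¹ ^ (d - 1) * L⁻¹) ^ (1 - 1 / p) *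
          ((P / N) ^ (d - 1)) ^ (1 / 2 : ℝ)) := by
  obtain ⟨m, C₁, hC₁⟩ := SchwartzMap.eLpNorm_fourierInv_le d hp hp2
  have hqc : HasCompactSupport q := HasCompactSupport.of_support_subset_isCompact
    (isCompact_closedBall 0 D.r) ((subset_tsupport _).trans hqr)
  obtain ⟨B, hB, hbound⟩ := rescaledBump_bound D.T D.η D.contDiff_ψ D.tsupport_ψ
    D.hasCompactSupport_ψ hq hqc D.contDiff_b D.hasCompactSupport_b D.fderiv_b_zero m
  obtain ⟨C₂, hC₂⟩ := D.volume_tube_le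
  have hr := D.r_pos
  refine ⟨C₁ * B.toNNReal * C₂ ^ (1 / 2 : ℝ) * ((D.r ^ (d - 1) * D.r) ^ (1 / 2 : ℝ)).toNNReal,
    fun N P L M hN hNP hL hLP F hF => ?_⟩
  have hN0 : 0 < N := by linarith
  have hP0 : 0 < P := by linarith
  have hL0 : 0 < L := by linarith
  let H : 𝓢(EuclideanSpace ℝ (Fin d), ℂ) :=
    (D.hasCompactSupport_rescaledBump hqr hN hP0 hL).toSchwartzMap
      (contDiff_rescaledBump D.T D.η D.contDiff_ψ hq D.contDiff_b N P L)
  let K : Set (EuclideanSpace ℝ (Fin d)) :=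
    {y | ‖D.T y‖ ≤ D.r * (P / N) ∧ |D.η y - L * D.b (P⁻¹ • D.T y)| ≤ D.r}
  have hbc := D.contDiff_b.continuous
  have hg : Continuous fun ζ => L * D.b (P⁻¹ • ζ) := by fun_prop
  have hK : IsClosed K :=
    IsClosed.inter (s₁ := {y : EuclideanSpace ℝ (Fin d) | ‖D.T y‖ ≤ D.r * (P / N)})
      (s₂ := {y | |D.η y - L * D.b (P⁻¹ • D.T y)| ≤ D.r}) (isClosed_le (by fun_prop) continuous_const)
      (isClosed_le (by fun_prop) continuous_const)
  have hHK : tsupport H ⊆ K := closure_minimal (D.support_rescaledBump_subset hqr hN0 hP0) hK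
  have h1 := hC₁ H B K hB hHK fun j hj x => by
    have := hbound N P L hN hNP hL0 hLP x j hj
    rw [one_pow, mul_one] at this
    exact this
  have h2 := hC₂ (fun ζ => L * D.b (P⁻¹ • ζ)) (D.r * (P / N)) D.r hg (by positivity) hr.le
  rw [SchwartzMap.eLpNorm_fourierInv_comp (H := H) (D.dilation hP0.ne' hL0.ne')
    ((M / L) • D.η) D.x₀ (fun y => by rw [hF]; exact D.graphBump_dilation q hP0.ne' hL0.ne' N M y)
    (by linarith), det_dilation, abs_of_pos (by positivity)]
  have h3 : volume K ^ (1 / 2 : ℝ) ≤ C₂ ^ (1 / 2 : ℝ) *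
      (ENNReal.ofReal ((D.r ^ (d - 1) * D.r) ^ (1 / 2 : ℝ)) *
        ENNReal.ofReal (((P / N) ^ (d - 1)) ^ (1 / 2 : ℝ))) := by
    refine (ENNReal.rpow_le_rpow h2 (by norm_num)).trans (le_of_eq ?_)
    rw [show (D.r * (P / N)) ^ (d - 1) * D.r = D.r ^ (d - 1) * D.r * (P / N) ^ (d - 1) by ring,
      ENNReal.mul_rpow_of_nonneg _ _ (by norm_num), ENNReal.ofReal_rpow_of_nonneg (by positivity)
      (by norm_num), ← ENNReal.ofReal_mul (by positivity), ← Real.mul_rpow (by positivity)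
      (by positivity)]
  calc _ ≤ ENNReal.ofReal ((P⁻¹ ^ (d - 1) * L⁻¹) ^ (1 - 1 / p)) *
        (C₁ * ENNReal.ofReal B * (C₂ ^ (1 / 2 : ℝ) *
      (ENNReal.ofReal ((D.r ^ (d - 1) * D.r) ^ (1 / 2 : ℝ)) *
        ENNReal.ofReal (((P / N) ^ (d - 1)) ^ (1 / 2 : ℝ))))) :=
        mul_le_mul_right (h1.trans (mul_le_mul_right h3 _)) _
    _ = _ := by
      rw [ENNReal.ofReal_mul (by positivity)]
      push_cast
      rw [ENNReal.coe_rpow_of_nonneg _ (by norm_num)]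
      simp only [ENNReal.ofReal]
      ring

/-- Bumps of unit size concentrated in a slab of width `L⁻¹`: bounds for their integrals. -/
theorem lintegral_enorm_pow_graphBump_le {q : ℝ → ℂ} (hq : ContDiff ℝ ∞ q)
    (hqr : tsupport q ⊆ Metric.closedBall 0 D.r) {a : ℕ} (ha : a ≠ 0) :
    ∃ C : ℝ≥0, ∀ L M : ℝ, 1 ≤ L →
      ∫⁻ ξ, ‖D.graphBump q 1 M L ξ‖ₑ ^ a ≤ C * ENNReal.ofReal L⁻¹ := by
  have hqc : HasCompactSupport q := HasCompactSupport.of_support_subset_isCompact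
    (isCompact_closedBall 0 D.r) ((subset_tsupport _).trans hqr)
  obtain ⟨B₁, hB₁⟩ := hqc.exists_bound_of_continuous hq.continuous
  obtain ⟨B₂, hB₂⟩ := D.hasCompactSupport_ψ.exists_bound_of_continuous D.contDiff_ψ.continuous
  obtain ⟨C, hC⟩ := D.volume_tube_le
  have hr := D.r_pos
  refine ⟨((B₂ * B₁) ^ a).toNNReal * C * (D.r ^ (d - 1) * D.r).toNNReal, fun L M hL => ?_⟩
  have hL0 : 0 < L := by linarith
  let K : Set (EuclideanSpace ℝ (Fin d)) := {y | ‖D.T y‖ ≤ D.r ∧ |D.η y - D.b (D.T y)| ≤ D.r / L}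
  have hK := hC D.b D.r (D.r / L) D.contDiff_b.continuous hr.le (by positivity)
  rw [← lintegral_add_left_eq_self _ D.x₀]
  refine (lintegral_enorm_pow_le_of_support (K := K) ha (B := B₂ * B₁) (fun y => ?_)
    (fun y hy => ?_)).trans ((mul_le_mul_right hK _).trans (le_of_eq ?_))
  · rw [graphBump, norm_mul, Circle.norm_coe, one_mul, norm_mul]
    exact mul_le_mul (hB₂ _) (hB₁ _) (norm_nonneg _) ((norm_nonneg _).trans (hB₂ 0))
  · rw [Function.mem_support, graphBump, add_sub_cancel_left, one_smul] at hy
    have h1 : D.ψ (D.T y) ≠ 0 := fun h => hy (by rw [h]; ring)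
    have h2 : q (L * (D.η y - D.b (D.T y))) ≠ 0 := fun h => hy (by rw [h]; ring)
    have h1 := mem_closedBall_zero_iff.1 (D.tsupport_ψ (subset_tsupport _ h1))
    have h2 := mem_closedBall_zero_iff.1 (hqr (subset_tsupport _ h2))
    rw [norm_mul, Real.norm_of_nonneg hL0.le, Real.norm_eq_abs] at h2
    refine ⟨h1, ?_⟩
    rw [le_div_iff₀ hL0]
    linarith
  · rw [show D.r ^ (d - 1) * (D.r / L) = D.r ^ (d - 1) * D.r * L⁻¹ by ring,
      ENNReal.ofReal_mul (by positivity)]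
    simp only [ENNReal.ofReal]
    push_cast
    ring

end GraphFrame

/-! ### Local charts and adapted frames. -/

/-- A function that is smooth near a closed ball agrees on a smaller ball with a compactly supported
smooth function. -/
theorem exists_contDiff_extension {E W : Type*} [NormedAddCommGroup E] [InnerProductSpace ℝ E]
    [FiniteDimensional ℝ E] [NormedAddCommGroup W] [NormedSpace ℝ W] {U : Set E} (hU : IsOpen U)
    {g : E → W} (hg : ContDiffOn ℝ ∞ g U) {z : E} {R : ℝ} (hR : 0 < R)
    (hball : Metric.closedBall z (2 * R) ⊆ U) :
    ∃ G : E → W, ContDiff ℝ ∞ G ∧ HasCompactSupport G ∧ (∀ ζ ∈ Metric.closedBall z R, G ζ = g ζ) ∧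
      ∀ ζ, ζ ∉ Metric.ball z (2 * R) → G ζ = 0 := by
  let χ : ContDiffBump z := ⟨R, 2 * R, hR, by linarith⟩
  refine ⟨fun ζ => χ ζ • g ζ, ?_, ?_, fun ζ hζ => ?_, fun ζ hζ => ?_⟩
  · refine contDiff_iff_contDiffAt.2 fun x => ?_
    by_cases hx : x ∈ tsupport χ
    · rw [χ.tsupport_eq] at hx
      exact (χ.contDiff.contDiffAt).smul (hg.contDiffAt (hU.mem_nhds (hball hx)))
    · refine ContDiffAt.congr_of_eventuallyEq (contDiffAt_const (c := 0)) ?_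
      filter_upwards [notMem_tsupport_iff_eventuallyEq.1 hx] with y hy
      simp [hy]
  · exact χ.hasCompactSupport.smul_right
  · simp only [χ.one_of_mem_closedBall hζ, one_smul]
  · have : χ ζ = 0 := by
      rw [← Function.notMem_support, χ.support_eq]
      exact hζ
    simp [this]

namespace GraphChart

variable {d : ℕ} {S : Set (EuclideanSpace ℝ (Fin d))} (c : GraphChart S)

theorem param_mem {ζ : EuclideanSpace ℝ (Fin (d - 1))} (hζ : ζ ∈ c.U) : c.param ζ ∈ S ∩ c.V := by
  rw [c.inter_eq]
  exact ⟨ζ, hζ, rfl⟩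

theorem exists_param_eq {x : EuclideanSpace ℝ (Fin d)} (hx : x ∈ S) (hxV : x ∈ c.V) :
    ∃ ζ ∈ c.U, c.param ζ = x := by
  have : x ∈ S ∩ c.V := ⟨hx, hxV⟩
  rwa [c.inter_eq] at this

theorem coords_symm_param_sub (ζ ζ' : EuclideanSpace ℝ (Fin (d - 1))) :
    c.coords.symm (c.param ζ - c.param ζ') = WithLp.toLp 2 (ζ - ζ', c.h ζ - c.h ζ') := by
  rw [map_sub, param, param, LinearIsometryEquiv.symm_apply_apply,
    LinearIsometryEquiv.symm_apply_apply]
  rfl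

theorem norm_sub_le_norm_param_sub (ζ ζ' : EuclideanSpace ℝ (Fin (d - 1))) :
    ‖ζ - ζ'‖ ≤ ‖c.param ζ - c.param ζ'‖ := by
  rw [← c.coords.symm.norm_map, coords_symm_param_sub]
  exact WithLp.norm_fst_le _ (WithLp.toLp 2 (ζ - ζ', c.h ζ - c.h ζ'))

theorem contDiffOn_param : ContDiffOn ℝ ∞ c.param c.U := by
  have h1 : ContDiffOn ℝ ∞ (fun ζ => ((ζ, c.h ζ) : EuclideanSpace ℝ (Fin (d - 1)) × ℝ)) c.U :=
    contDiffOn_id.prodMk c.contDiffOn_h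
  have h2 : ContDiff ℝ ∞ fun w : EuclideanSpace ℝ (Fin (d - 1)) × ℝ => c.coords (WithLp.toLp 2 w) :=
    c.coords.toContinuousLinearEquiv.contDiff.comp
      (WithLp.prodContinuousLinearEquiv 2 ℝ (EuclideanSpace ℝ (Fin (d - 1))) ℝ).symm.contDiff
  exact h2.comp_contDiffOn h1

/-- Linear coordinates adapted to the tangent plane at the point with parameter `ζ₀`. -/
noncomputable def tangentCoords (ζ₀ : EuclideanSpace ℝ (Fin (d - 1))) :
    EuclideanSpace ℝ (Fin d) ≃L[ℝ] EuclideanSpace ℝ (Fin (d - 1)) × ℝ :=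
  (c.coords.symm.toContinuousLinearEquiv.trans
    (WithLp.prodContinuousLinearEquiv 2 ℝ (EuclideanSpace ℝ (Fin (d - 1))) ℝ)).trans
    (ContinuousLinearEquiv.skewProd (ContinuousLinearEquiv.refl ℝ _)
      (ContinuousLinearEquiv.refl ℝ ℝ) (-fderiv ℝ c.h ζ₀))

theorem tangentCoords_param_sub (ζ₀ ζ : EuclideanSpace ℝ (Fin (d - 1))) :
    c.tangentCoords ζ₀ (c.param ζ - c.param ζ₀) =
      (ζ - ζ₀, c.h ζ - c.h ζ₀ - fderiv ℝ c.h ζ₀ (ζ - ζ₀)) := by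
  have h := c.coords_symm_param_sub ζ ζ₀
  simp only [tangentCoords, ContinuousLinearEquiv.trans_apply]
  change ContinuousLinearEquiv.skewProd _ _ _ (WithLp.prodContinuousLinearEquiv 2 ℝ _ ℝ
    (c.coords.symm (c.param ζ - c.param ζ₀))) = _
  rw [h]
  change (ζ - ζ₀, c.h ζ - c.h ζ₀ + -(fderiv ℝ c.h ζ₀ (ζ - ζ₀))) = _
  rw [sub_eq_add_neg (c.h ζ - c.h ζ₀)]

end GraphChart

/-- A graph frame at a point of `S` together with the transition functions from the nearby charts
of an atlas. -/
structure AdaptedFrame {d : ℕ} {S : Set (EuclideanSpace ℝ (Fin d))} (𝒜 : SobolevAtlas S)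
    extends GraphFrame d where
  I : Finset 𝒜.ι
  i₀ : 𝒜.ι
  i₀_mem : i₀ ∈ I
  z : 𝒜.ι → EuclideanSpace ℝ (Fin (d - 1))
  a : 𝒜.ι → EuclideanSpace ℝ (Fin (d - 1)) → ℂ
  κ : 𝒜.ι → EuclideanSpace ℝ (Fin (d - 1)) → EuclideanSpace ℝ (Fin (d - 1))
  contDiff_a : ∀ i ∈ I, ContDiff ℝ ∞ (a i)
  hasCompactSupport_a : ∀ i ∈ I, HasCompactSupport (a i)
  contDiff_κ : ∀ i ∈ I, ContDiff ℝ ∞ (κ i)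
  hasCompactSupport_κ : ∀ i ∈ I, HasCompactSupport (κ i)
  r₀ : ℝ
  ε : ℝ
  ε_pos : 0 < ε
  graph : ∀ ξ ∈ S, ‖ξ - x₀‖ < r₀ →
    toGraphFrame.η (ξ - x₀) = b (toGraphFrame.T (ξ - x₀))
  localPiece_eq : ∀ (u : EuclideanSpace ℝ (Fin d) → ℂ) (Ψ : EuclideanSpace ℝ (Fin (d - 1)) → ℂ),
    Function.support u ⊆ Metric.closedBall x₀ ε →
    (∀ ξ ∈ S, ‖ξ - x₀‖ < r₀ → u ξ = Ψ (toGraphFrame.T (ξ - x₀))) →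
    ∀ i ∈ I, 𝒜.localPiece i u = fun ζ => a i ζ * Ψ (κ i ζ)
  localPiece_eq_zero : ∀ u : EuclideanSpace ℝ (Fin d) → ℂ,
    Function.support u ⊆ Metric.closedBall x₀ ε → ∀ i ∉ I, 𝒜.localPiece i u = 0
  exists_of_localPiece_ne_zero : ∀ u : EuclideanSpace ℝ (Fin d) → ℂ,
    Function.support u ⊆ Metric.closedBall x₀ ε → ∀ i ∈ I, ∀ ζ, 𝒜.localPiece i u ζ ≠ 0 →
    ∃ ξ ∈ S, u ξ ≠ 0 ∧ ‖ξ - x₀‖ < r₀ ∧ ‖ζ - z i‖ ≤ ‖ξ - x₀‖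
  c : ℝ
  c_pos : 0 < c
  main_chart : ∀ ζ, ‖ζ‖ ≤ r → c ≤ ‖a i₀ (z i₀ + ζ)‖ ∧ κ i₀ (z i₀ + ζ) = ζ
  ψ_eq_one : ∀ ζ, ‖ζ‖ ≤ r / 2 → ψ ζ = 1
  support_graphBump : ∀ (q : ℝ → ℂ) (N M L : ℝ), tsupport q ⊆ Metric.closedBall 0 r →
    1 ≤ N → 1 ≤ L → Function.support (toGraphFrame.graphBump q N M L) ⊆ Metric.closedBall x₀ ε

/-- Only the finitely many members of the partition whose support contains `x₀` are active near
`x₀`. In their charts, `κ i` is the change to the tangential coordinates of the frame and `a i` is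
the partition function, both extended to smooth functions of compact support on the whole space. The
graph parametrization does not decrease distances, so a function supported within `ε` of `x₀` is
seen only near `z i`, where both extensions are genuine. -/
theorem SobolevAtlas.nonempty_adaptedFrame {d : ℕ} {S : Set (EuclideanSpace ℝ (Fin d))}
    (𝒜 : SobolevAtlas S) (hne : S.Nonempty) : Nonempty (AdaptedFrame 𝒜) := by
  classical
  obtain ⟨x₀, hx₀⟩ := hne
  obtain ⟨i₀, hi₀⟩ := 𝒜.partition.exists_pos_of_mem hx₀
  set I := 𝒜.partition.fintsupport x₀ with hI
  have hi₀I : i₀ ∈ I := by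
    rw [hI, SmoothPartitionOfUnity.mem_fintsupport_iff]
    exact subset_tsupport _ hi₀.ne'
  have hV (i) (hi : i ∈ I) : x₀ ∈ (𝒜.chart i).V := by
    rw [hI, SmoothPartitionOfUnity.mem_fintsupport_iff] at hi
    exact 𝒜.isSubordinate i hi
  have hz (i) : ∃ ζ, i ∈ I → ζ ∈ (𝒜.chart i).U ∧ (𝒜.chart i).param ζ = x₀ := by
    by_cases hi : i ∈ I
    · obtain ⟨ζ, h1, h2⟩ := (𝒜.chart i).exists_param_eq hx₀ (hV i hi)
      exact ⟨ζ, fun _ => ⟨h1, h2⟩⟩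
    · exact ⟨0, fun h => absurd h hi⟩
  choose z hz using hz
  set c₀ := 𝒜.chart i₀ with hc₀
  obtain ⟨hz₀U, hz₀⟩ := hz i₀ hi₀I
  -- the graph function
  have hb₀ : ContDiffOn ℝ ∞ (fun ζ => c₀.h (z i₀ + ζ) - c₀.h (z i₀) - fderiv ℝ c₀.h (z i₀) ζ)
      ((fun ζ => z i₀ + ζ) ⁻¹' c₀.U) := by
    refine ContDiffOn.sub (ContDiffOn.sub ?_ contDiffOn_const) (ContinuousLinearMap.contDiff _).contDiffOn
    exact c₀.contDiffOn_h.comp (contDiff_const.add contDiff_id).contDiffOn fun ζ hζ => hζ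
  have hU₀ : IsOpen ((fun ζ => z i₀ + ζ) ⁻¹' c₀.U) := c₀.isOpen_U.preimage (by fun_prop)
  obtain ⟨Rb, hRb, hRbU⟩ : ∃ R, 0 < R ∧
      Metric.closedBall 0 (2 * R) ⊆ (fun ζ => z i₀ + ζ) ⁻¹' c₀.U := by
    obtain ⟨R, hR, h⟩ := Metric.nhds_basis_closedBall.mem_iff.1
      (hU₀.mem_nhds (show (0 : EuclideanSpace ℝ (Fin (d - 1))) ∈ _ by simpa using hz₀U))
    exact ⟨R / 2, by linarith, by rwa [mul_div_cancel₀ _ two_ne_zero]⟩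
  obtain ⟨b, hb, hbc, hbeq, -⟩ := exists_contDiff_extension hU₀ hb₀ hRb hRbU
  have hb0 : b 0 = 0 := by
    rw [hbeq 0 (by simp [hRb.le])]
    simp
  have hdb : fderiv ℝ b 0 = 0 := by
    have h1 : b =ᶠ[nhds 0] fun ζ => c₀.h (z i₀ + ζ) - c₀.h (z i₀) - fderiv ℝ c₀.h (z i₀) ζ := by
      filter_upwards [Metric.closedBall_mem_nhds 0 hRb] with ζ hζ using hbeq ζ hζ
    have h2 : HasFDerivAt c₀.h (fderiv ℝ c₀.h (z i₀)) (z i₀ + 0) := by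
      rw [add_zero]
      exact ((c₀.contDiffOn_h.contDiffAt (c₀.isOpen_U.mem_nhds hz₀U)).differentiableAt
        (by simp)).hasFDerivAt
    have h3 : HasFDerivAt (fun ζ => c₀.h (z i₀ + ζ)) (fderiv ℝ c₀.h (z i₀)) 0 := by
      exact h2.comp (0 : EuclideanSpace ℝ (Fin (d - 1))) ((hasFDerivAt_id _).const_add (z i₀))
    rw [h1.fderiv_eq]
    have h4 := (h3.sub_const (c₀.h (z i₀))).sub (fderiv ℝ c₀.h (z i₀)).hasFDerivAt
    rw [sub_self] at h4
    exact h4.fderiv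
  -- a frame with a trivial cutoff
  let D₀ : GraphFrame d := ⟨c₀.tangentCoords (z i₀), x₀, b, hb, hbc, hb0, hdb, 1, one_pos, 0,
    contDiff_const, by simp [tsupport]⟩
  -- This constant depends only on the coordinates and on `b`, so it is available before the radius
  -- `r` and the cutoff `ψ` are chosen.
  obtain ⟨C, hC1, hC⟩ := D₀.norm_le_of_graph
  have hTparam (ζ) : D₀.T (c₀.param ζ - x₀) = ζ - z i₀ := by
    have := c₀.tangentCoords_param_sub (z i₀) ζ
    rw [hz₀] at this
    exact congrArg Prod.fst this
  have hηparam (ζ) : D₀.η (c₀.param ζ - x₀) =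
      c₀.h ζ - c₀.h (z i₀) - fderiv ℝ c₀.h (z i₀) (ζ - z i₀) := by
    have := c₀.tangentCoords_param_sub (z i₀) ζ
    rw [hz₀] at this
    exact congrArg Prod.snd this
  -- the neighbourhood of `x₀`
  obtain ⟨r₀, hr₀, hr₀V, hr₀I, hr₀R⟩ : ∃ r₀ > 0, Metric.ball x₀ r₀ ⊆ c₀.V ∧
      (∀ ξ ∈ Metric.ball x₀ r₀, 𝒜.partition.fintsupport ξ ⊆ I) ∧ r₀ ≤ Rb := by
    have h1 : ∀ᶠ ξ in nhds x₀, ξ ∈ c₀.V ∧ 𝒜.partition.fintsupport ξ ⊆ I :=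
      Filter.Eventually.and (c₀.isOpen_V.mem_nhds (hV i₀ hi₀I)) (𝒜.partition.eventually_fintsupport_subset x₀)
    obtain ⟨t, ht, h⟩ := Metric.eventually_nhds_iff_ball.1 h1
    refine ⟨min t Rb, lt_min ht hRb, fun ξ hξ => (h ξ ?_).1, fun ξ hξ => (h ξ ?_).2, min_le_right _ _⟩
    all_goals exact Metric.ball_subset_ball (min_le_left _ _) hξ
  have hgraph : ∀ ξ ∈ S, ‖ξ - x₀‖ < r₀ → D₀.η (ξ - x₀) = b (D₀.T (ξ - x₀)) := by
    intro ξ hξ hξr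
    obtain ⟨ζ, hζ, rfl⟩ := c₀.exists_param_eq hξ (hr₀V (by rwa [mem_ball_iff_norm]))
    have : ‖ζ - z i₀‖ ≤ Rb := by
      have := c₀.norm_sub_le_norm_param_sub ζ (z i₀)
      rw [hz₀] at this
      linarith
    rw [hTparam, hηparam, hbeq _ (by simpa using this), add_sub_cancel]
  -- radii in the charts
  have hR (i) : ∃ R, 0 < R ∧ (i ∈ I → Metric.closedBall (z i) (2 * R) ⊆
      (𝒜.chart i).U ∩ (𝒜.chart i).param ⁻¹' Metric.ball x₀ r₀) := by
    by_cases hi : i ∈ I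
    · obtain ⟨hzU, hzx⟩ := hz i hi
      have hU : (𝒜.chart i).U ∈ nhds (z i) := (𝒜.chart i).isOpen_U.mem_nhds hzU
      have hcont : ContinuousAt (𝒜.chart i).param (z i) :=
        (𝒜.chart i).contDiffOn_param.continuousOn.continuousAt hU
      have hpre : (𝒜.chart i).param ⁻¹' Metric.ball x₀ r₀ ∈ nhds (z i) :=
        hcont (by rw [hzx]; exact Metric.ball_mem_nhds _ hr₀)
      obtain ⟨R, hR, h⟩ := Metric.nhds_basis_closedBall.mem_iff.1 (Filter.inter_mem hU hpre)
      exact ⟨R / 2, by linarith, fun _ => by rwa [mul_div_cancel₀ _ two_ne_zero]⟩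
    · exact ⟨1, one_pos, fun h => absurd h hi⟩
  choose R hR hRsub using hR
  have hκ (i) : ∃ κ : EuclideanSpace ℝ (Fin (d - 1)) → EuclideanSpace ℝ (Fin (d - 1)), i ∈ I →
      ContDiff ℝ ∞ κ ∧ HasCompactSupport κ ∧
      ∀ ζ ∈ Metric.closedBall (z i) (R i), κ ζ = D₀.T ((𝒜.chart i).param ζ - x₀) := by
    by_cases hi : i ∈ I
    · obtain ⟨κ, h1, h2, h3, -⟩ := exists_contDiff_extension (𝒜.chart i).isOpen_U
        (g := fun ζ => D₀.T ((𝒜.chart i).param ζ - x₀))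
        (D₀.T.contDiff.comp_contDiffOn ((𝒜.chart i).contDiffOn_param.sub contDiffOn_const)) (hR i)
        ((hRsub i hi).trans Set.inter_subset_left)
      exact ⟨κ, fun _ => ⟨h1, h2, h3⟩⟩
    · exact ⟨0, fun h => absurd h hi⟩
  choose κ hκ using hκ
  -- The radius is half of that used for `κ i`: wherever `a i` is non-zero, `κ i` is still the true
  -- transition map. In the annulus between the two radii the product vanishes because `u` does.
  have ha (i) : ∃ a : EuclideanSpace ℝ (Fin (d - 1)) → ℂ, i ∈ I →
      ContDiff ℝ ∞ a ∧ HasCompactSupport a ∧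
      (∀ ζ ∈ Metric.closedBall (z i) (R i / 2),
        a ζ = ((𝒜.partition i ((𝒜.chart i).param ζ) : ℝ) : ℂ)) ∧
      ∀ ζ ∉ Metric.ball (z i) (R i), a ζ = 0 := by
    by_cases hi : i ∈ I
    · have hρ : ContDiff ℝ ∞ (𝒜.partition i) := (𝒜.partition i).contMDiff.contDiff
      obtain ⟨a, h1, h2, h3, h4⟩ := exists_contDiff_extension (𝒜.chart i).isOpen_U
        (g := fun ζ => ((𝒜.partition i ((𝒜.chart i).param ζ) : ℝ) : ℂ)) (R := R i / 2) (z := z i)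
        (Complex.ofRealCLM.contDiff.comp_contDiffOn
          (hρ.comp_contDiffOn (𝒜.chart i).contDiffOn_param)) (by linarith [hR i])
        ((Metric.closedBall_subset_closedBall (by linarith [hR i])).trans
          ((hRsub i hi).trans Set.inter_subset_left))
      rw [mul_div_cancel₀ _ two_ne_zero] at h4
      exact ⟨a, fun _ => ⟨h1, h2, h3, h4⟩⟩
    · exact ⟨0, fun h => absurd h hi⟩
  choose a ha using ha
  obtain ⟨ε, hε, hεI, hεr⟩ : ∃ ε > 0, (∀ i ∈ I, ε < R i / 2) ∧ ε < r₀ := by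
    have h1 : ∀ᶠ ε in nhdsWithin (0 : ℝ) (Set.Ioi 0), ∀ i ∈ I, ε < R i / 2 := by
      rw [Filter.eventually_all_finset]
      intro i _
      exact nhdsWithin_le_nhds (gt_mem_nhds (by linarith [hR i]))
    have h2 : ∀ᶠ ε in nhdsWithin (0 : ℝ) (Set.Ioi 0), ε < r₀ := nhdsWithin_le_nhds (gt_mem_nhds hr₀)
    obtain ⟨ε, h⟩ := (h1.and (h2.and self_mem_nhdsWithin)).exists
    exact ⟨ε, h.2.2, h.1, h.2.1⟩
  have hfar (i) (hi : i ∈ I) {ζ} (u : EuclideanSpace ℝ (Fin d) → ℂ)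
      (hu : Function.support u ⊆ Metric.closedBall x₀ ε) (hne : u ((𝒜.chart i).param ζ) ≠ 0) :
      ‖(𝒜.chart i).param ζ - x₀‖ ≤ ε ∧ ‖ζ - z i‖ ≤ ‖(𝒜.chart i).param ζ - x₀‖ := by
    have h1 := hu hne
    rw [mem_closedBall_iff_norm] at h1
    have h2 := (𝒜.chart i).norm_sub_le_norm_param_sub ζ (z i)
    rw [(hz i hi).2] at h2
    exact ⟨h1, h2⟩
  -- the size of the cutoff
  have hρcont : ContinuousAt (fun ζ => 𝒜.partition i₀ (c₀.param (z i₀ + ζ)))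
      (0 : EuclideanSpace ℝ (Fin (d - 1))) := by
    have hU : c₀.U ∈ nhds (z i₀ + 0) := by
      rw [add_zero]
      exact c₀.isOpen_U.mem_nhds hz₀U
    have h1 : ContinuousAt c₀.param (z i₀ + 0) := c₀.contDiffOn_param.continuousOn.continuousAt hU
    have h2 : ContinuousAt (fun ζ => z i₀ + ζ) (0 : EuclideanSpace ℝ (Fin (d - 1))) := by fun_prop
    exact (𝒜.partition i₀).contMDiff.continuous.continuousAt.comp (ContinuousAt.comp (f := fun ζ => z i₀ + ζ) h1 h2)
  obtain ⟨δ, hδ, hδρ⟩ : ∃ δ > 0, ∀ ζ : EuclideanSpace ℝ (Fin (d - 1)), ‖ζ‖ < δ →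
      𝒜.partition i₀ x₀ / 2 < 𝒜.partition i₀ (c₀.param (z i₀ + ζ)) := by
    have h1 := hρcont.eventually (lt_mem_nhds (a := 𝒜.partition i₀ x₀ / 2) (by
      simp only [add_zero, hc₀, hz₀]
      linarith))
    obtain ⟨δ, hδ, h⟩ := Metric.eventually_nhds_iff_ball.1 h1
    exact ⟨δ, hδ, fun ζ hζ => h ζ (by simpa using hζ)⟩
  -- Three requirements on `r`: the partition function stays above half its value at `x₀`, the
  -- formulas for `a i₀` and `κ i₀` hold, and every graph bump stays within `ε` of `x₀`.
  obtain ⟨r, hr, hrδ, hrR, hrC⟩ : ∃ r > 0, r < δ ∧ r ≤ R i₀ / 2 ∧ C * (2 * r) ≤ ε := by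
    refine ⟨min (δ / 2) (min (R i₀ / 2) (ε / (2 * C))), by have := hR i₀; positivity, ?_, ?_, ?_⟩
    · exact (min_le_left _ _).trans_lt (by linarith)
    · exact (min_le_right _ _).trans (min_le_left _ _)
    · have h1 : min (δ / 2) (min (R i₀ / 2) (ε / (2 * C))) ≤ ε / (2 * C) :=
        (min_le_right _ _).trans (min_le_right _ _)
      rw [le_div_iff₀ (by linarith)] at h1
      linarith
  let χ : ContDiffBump (0 : EuclideanSpace ℝ (Fin (d - 1))) := ⟨r / 2, r, by linarith, by linarith⟩
  let D : GraphFrame d := { D₀ with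
    r := r
    r_pos := hr
    ψ := fun ζ => ((χ ζ : ℝ) : ℂ)
    contDiff_ψ := Complex.ofRealCLM.contDiff.comp χ.contDiff
    tsupport_ψ := by
      refine closure_minimal (fun ζ hζ => ?_) Metric.isClosed_closedBall
      have : ζ ∈ Function.support χ := fun h => hζ (by simp [h])
      rw [χ.support_eq] at this
      exact Metric.ball_subset_closedBall this }
  refine ⟨{ D with
    I := I, i₀ := i₀, i₀_mem := hi₀I, z := z, a := a, κ := κ
    contDiff_a := fun i hi => (ha i hi).1
    hasCompactSupport_a := fun i hi => (ha i hi).2.1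
    contDiff_κ := fun i hi => (hκ i hi).1
    hasCompactSupport_κ := fun i hi => (hκ i hi).2.1
    r₀ := r₀, ε := ε, ε_pos := hε
    graph := hgraph
    localPiece_eq := ?_
    localPiece_eq_zero := ?_
    exists_of_localPiece_ne_zero := ?_
    c := 𝒜.partition i₀ x₀ / 2
    c_pos := by linarith
    main_chart := ?_
    ψ_eq_one := ?_
    support_graphBump := ?_ }⟩
  · intro u Ψ hu huΨ i hi
    ext ζ
    have hform (hζ : ζ ∈ Metric.closedBall (z i) (R i)) : ζ ∈ (𝒜.chart i).U ∧
        u ((𝒜.chart i).param ζ) = Ψ (κ i ζ) := by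
      have h1 := hRsub i hi (Metric.closedBall_subset_closedBall (by linarith [hR i]) hζ)
      refine ⟨h1.1, ?_⟩
      rw [(hκ i hi).2.2 ζ hζ]
      exact huΨ _ ((𝒜.chart i).param_mem h1.1).1 (mem_ball_iff_norm.1 h1.2)
    by_cases hζ : ζ ∈ Metric.closedBall (z i) (R i / 2)
    · obtain ⟨hζU, hζu⟩ := hform (Metric.closedBall_subset_closedBall (by linarith [hR i]) hζ)
      rw [SobolevAtlas.localPiece, Set.indicator_of_mem hζU, hζu, (ha i hi).2.2.1 ζ hζ, smul_eq_mul]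
    · have hu0 : u ((𝒜.chart i).param ζ) = 0 := by
        by_contra h
        obtain ⟨h1, h2⟩ := hfar i hi u hu h
        rw [mem_closedBall_iff_norm] at hζ
        linarith [hεI i hi]
      have hl : 𝒜.localPiece i u ζ = 0 := by
        rw [SobolevAtlas.localPiece, Set.indicator_apply]
        simp [hu0]
      rw [hl]
      by_cases hζ' : ζ ∈ Metric.closedBall (z i) (R i)
      · rw [← (hform hζ').2, hu0, mul_zero]
      · rw [(ha i hi).2.2.2 ζ (fun h => hζ' (Metric.ball_subset_closedBall h)), zero_mul]
  · intro u hu i hi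
    ext ζ
    rw [SobolevAtlas.localPiece, Set.indicator_apply, Pi.zero_apply]
    split_ifs with hζ
    · by_cases hu0 : u ((𝒜.chart i).param ζ) = 0
      · rw [hu0, smul_zero]
      · have h1 := hu hu0
        have h2 := hr₀I _ (Metric.closedBall_subset_ball hεr h1)
        have h3 : i ∉ 𝒜.partition.fintsupport ((𝒜.chart i).param ζ) := fun h => hi (h2 h)
        rw [SmoothPartitionOfUnity.mem_fintsupport_iff] at h3
        rw [image_eq_zero_of_notMem_tsupport h3]
        simp
    · rfl
  · intro u hu i hi ζ hζ
    rw [SobolevAtlas.localPiece, Set.indicator_apply] at hζ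
    split_ifs at hζ with hζU
    · have hu0 : u ((𝒜.chart i).param ζ) ≠ 0 := fun h => hζ (by rw [h, smul_zero])
      obtain ⟨h1, h2⟩ := hfar i hi u hu hu0
      exact ⟨_, ((𝒜.chart i).param_mem hζU).1, hu0, h1.trans_lt hεr, h2⟩
    · exact absurd rfl hζ
  · intro ζ hζ
    have hζ : ‖ζ‖ ≤ r := hζ
    have hmem : z i₀ + ζ ∈ Metric.closedBall (z i₀) (R i₀ / 2) := by
      rw [mem_closedBall_iff_norm, add_sub_cancel_left]
      linarith
    constructor
    · rw [(ha i₀ hi₀I).2.2.1 _ hmem, Complex.norm_real]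
      exact (hδρ ζ (by linarith)).le.trans (le_abs_self _)
    · rw [(hκ i₀ hi₀I).2.2 _ (Metric.closedBall_subset_closedBall (by linarith [hR i₀]) hmem),
        ← hc₀, hTparam, add_sub_cancel_left]
  · intro ζ hζ
    have : χ ζ = 1 := χ.one_of_mem_closedBall (by simpa using hζ)
    change ((χ ζ : ℝ) : ℂ) = 1
    rw [this, Complex.ofReal_one]
  · intro q N M L hq hN hL
    exact (D.support_graphBump_subset hC1 hC hq hN hL).trans (Metric.closedBall_subset_closedBall hrC)

/-! ### Two-sided Sobolev bounds for modulated bumps on the surface. -/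

theorem sobolevNorm_comp_continuousLinearMap_le {n : ℕ} {W : Type*} [NormedAddCommGroup W]
    [NormedSpace ℂ W] [CompleteSpace W] (σ : ℝ) (Λ : W →L[ℂ] ℂ) {g : EuclideanSpace ℝ (Fin n) → W}
    (hg : Integrable g) :
    sobolevNorm σ (fun x => Λ (g x)) ≤ ‖Λ‖ₑ * sobolevNorm σ g := by
  have h1 (w) : 𝓕 (fun x => Λ (g x)) w = Λ (𝓕 g w) := by
    rw [Real.fourier_eq, Real.fourier_eq, ← Λ.integral_comp_comm
      ((Real.fourierIntegral_convergent_iff w).2 hg)]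
    refine integral_congr_ae (Filter.Eventually.of_forall fun v => ?_)
    simp [Circle.smul_def]
  have h2 : ∫⁻ w, ENNReal.ofReal ((1 + ‖w‖) ^ (2 * σ)) * ‖𝓕 (fun x => Λ (g x)) w‖ₑ ^ 2 ≤
      ‖Λ‖ₑ ^ 2 * ∫⁻ w, ENNReal.ofReal ((1 + ‖w‖) ^ (2 * σ)) * ‖𝓕 g w‖ₑ ^ 2 := by
    rw [← lintegral_const_mul' _ _ (by finiteness)]
    refine lintegral_mono fun w => ?_
    rw [h1, mul_left_comm, ← mul_pow]
    gcongr
    exact Λ.le_opENorm _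
  refine (ENNReal.rpow_le_rpow h2 (by norm_num)).trans (le_of_eq ?_)
  rw [ENNReal.mul_rpow_of_nonneg _ _ (by norm_num), ← ENNReal.rpow_natCast, ← ENNReal.rpow_mul]
  norm_num
  rfl

theorem SobolevAtlas.sobolevNorm_localPiece_le {d : ℕ} {S : Set (EuclideanSpace ℝ (Fin d))}
    (𝒜 : SobolevAtlas S) {W : Type*} [NormedAddCommGroup W] [NormedSpace ℂ W] (σ : ℝ)
    (u : EuclideanSpace ℝ (Fin d) → W) (i : 𝒜.ι) :
    sobolevNorm σ (𝒜.localPiece i u) ≤ 𝒜.surfaceNorm σ u := by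
  have h := ENNReal.le_tsum (f := fun i => sobolevNorm σ (𝒜.localPiece i u) ^ 2) i
  refine le_trans (le_of_eq ?_) (ENNReal.rpow_le_rpow h (by norm_num : (0 : ℝ) ≤ 1 / 2))
  rw [← ENNReal.rpow_natCast, ← ENNReal.rpow_mul]
  norm_num

theorem SobolevAtlas.surfaceNorm_le_sum {d : ℕ} {S : Set (EuclideanSpace ℝ (Fin d))}
    (𝒜 : SobolevAtlas S) (σ : ℝ) (u : EuclideanSpace ℝ (Fin d) → ℂ) (I : Finset 𝒜.ι)
    (hI : ∀ i ∉ I, 𝒜.localPiece i u = 0) :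
    𝒜.surfaceNorm σ u ≤ ∑ i ∈ I, sobolevNorm σ (𝒜.localPiece i u) := by
  rw [SobolevAtlas.surfaceNorm, tsum_eq_sum (s := I)]
  · have h : ∑ i ∈ I, sobolevNorm σ (𝒜.localPiece i u) ^ 2 ≤
        (∑ i ∈ I, sobolevNorm σ (𝒜.localPiece i u)) ^ 2 := by
      rw [sq (∑ i ∈ I, _), Finset.sum_mul]
      refine Finset.sum_le_sum fun i hi => ?_
      rw [sq]
      exact mul_le_mul_right (Finset.single_le_sum (f := fun i => sobolevNorm σ (𝒜.localPiece i u))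
        (fun _ _ => zero_le) hi) _
    refine (ENNReal.rpow_le_rpow h (by norm_num : (0 : ℝ) ≤ 1 / 2)).trans (le_of_eq ?_)
    rw [← ENNReal.rpow_natCast, ← ENNReal.rpow_mul]
    norm_num
  · intro i hi
    have h0 (w) : 𝓕 (0 : EuclideanSpace ℝ (Fin (d - 1)) → ℂ) w = 0 := by
      simp [Real.fourier_eq]
    simp [hI i hi, sobolevNorm, h0]

namespace AdaptedFrame

variable {d : ℕ} {S : Set (EuclideanSpace ℝ (Fin d))} {𝒜 : SobolevAtlas S} (A : AdaptedFrame 𝒜)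

/-- The modulated bump which a `graphBump` induces on the surface. -/
noncomputable def trace (N M : ℝ) (ζ : EuclideanSpace ℝ (Fin (d - 1))) : ℂ :=
  modulatedBump A.ψ A.b N M ζ

theorem norm_le_of_trace_ne_zero {N M : ℝ} (hN : 0 < N) {ζ : EuclideanSpace ℝ (Fin (d - 1))}
    (h : A.trace N M ζ ≠ 0) : ‖ζ‖ ≤ A.r / N := by
  have h1 : A.ψ (N • ζ) ≠ 0 := fun h' => h (by rw [trace, modulatedBump, h', mul_zero])
  have h2 := mem_closedBall_zero_iff.1 (A.tsupport_ψ (subset_tsupport _ h1))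
  rw [norm_smul, Real.norm_of_nonneg hN.le] at h2
  rw [le_div_iff₀ hN]
  linarith

/-- Upper bounds in each chart for functions whose restriction to the surface is a modulated
bump. -/
theorem sobolevNorm_localPiece_le {σ : ℝ} (hσ : 0 ≤ σ) {i : 𝒜.ι} (hi : i ∈ A.I) :
    ∃ C : ℝ≥0, ∀ N F M : ℝ, 1 ≤ N → N ≤ F → |M| ≤ F * N →
      ∀ u : EuclideanSpace ℝ (Fin d) → ℂ, Function.support u ⊆ Metric.closedBall A.x₀ A.ε →
      (∀ ξ ∈ S, ‖ξ - A.x₀‖ < A.r₀ → u ξ = A.trace N M (A.T (ξ - A.x₀))) →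
      ContDiff ℝ ∞ (𝒜.localPiece i u) ∧ HasCompactSupport (𝒜.localPiece i u) ∧
      sobolevNorm σ (𝒜.localPiece i u) ≤
        C * ENNReal.ofReal (F ^ σ * (N⁻¹ ^ (d - 1)) ^ (1 / 2 : ℝ)) := by
  obtain ⟨m, C₁, hC₁⟩ := sobolevNorm_le (d - 1) hσ
  obtain ⟨B, hB, hbound⟩ := modulatedBump_bound A.contDiff_ψ A.tsupport_ψ A.hasCompactSupport_ψ
    A.contDiff_b A.hasCompactSupport_b A.fderiv_b_zero m
  obtain ⟨C₂, hC₂1, hC₂⟩ := exists_bound_iteratedFDeriv (A.contDiff_κ i hi)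
    (A.hasCompactSupport_κ i hi) m
  obtain ⟨C₃, hC₃1, hC₃⟩ := exists_bound_iteratedFDeriv (A.contDiff_a i hi)
    (A.hasCompactSupport_a i hi) m
  obtain ⟨C₄, hC₄1, hC₄⟩ := A.norm_le_of_graph
  set B' : ℝ := 2 ^ m * (C₃ * (m.factorial * B * C₂ ^ m)) with hB'
  have hB'0 : 0 ≤ B' := by positivity
  have hr := A.r_pos
  set v := volume (Metric.closedBall (0 : EuclideanSpace ℝ (Fin (d - 1))) 1) with hv
  have hvtop : v ≠ ⊤ := measure_closedBall_lt_top.ne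
  refine ⟨C₁ * B'.toNNReal * ((C₄ * A.r) ^ (d - 1)).toNNReal ^ (1 / 2 : ℝ) * v.toNNReal ^ (1 / 2 : ℝ),
    fun N F M hN hNF hM u hu htr => ?_⟩
  have hN0 : 0 < N := by linarith
  have hF : 1 ≤ F := by linarith
  have heq := A.localPiece_eq u (A.trace N M) hu htr i hi
  have htrc : ContDiff ℝ ∞ (A.trace N M) := contDiff_modulatedBump A.contDiff_ψ A.contDiff_b N M
  have hsm : ContDiff ℝ ∞ (𝒜.localPiece i u) := by
    rw [heq]
    exact (A.contDiff_a i hi).mul (htrc.comp (A.contDiff_κ i hi))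
  have hcs : HasCompactSupport (𝒜.localPiece i u) := by
    rw [heq]
    exact (A.hasCompactSupport_a i hi).mul_right
  refine ⟨hsm, hcs, ?_⟩
  -- The trace vanishes unless the tangential coordinate is at most `r / N`; a point of the graph is
  -- then within `C₄ * r / N` of `x₀`, and its chart parameter is no further from `z i`. The volume
  -- of this ball yields the power of `N`.
  have hsupp : tsupport (𝒜.localPiece i u) ⊆ Metric.closedBall (A.z i) (C₄ * A.r / N) := by
    refine closure_minimal (fun ζ hζ => ?_) Metric.isClosed_closedBall
    obtain ⟨ξ, hξ, h1, h2, h3⟩ := A.exists_of_localPiece_ne_zero u hu i hi ζ hζ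
    rw [htr ξ hξ h2] at h1
    rw [mem_closedBall_iff_norm]
    refine h3.trans ((hC₄ _ 0 (by rw [A.graph ξ hξ h2]; simp)).trans ?_)
    rw [add_zero, mul_div_assoc]
    have := A.norm_le_of_trace_ne_zero hN0 h1
    gcongr
  have hder : ∀ j ≤ m, ∀ ζ, ‖iteratedFDeriv ℝ j (𝒜.localPiece i u) ζ‖ ≤ B' * F ^ j := by
    intro j hj ζ
    rw [heq]
    have h1 : GeometricDerivBound m (fun ζ => A.trace N M (A.κ i ζ)) ζ
        (m.factorial * B * C₂ ^ m) F :=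
      ((hbound N F M hN hNF hM (A.κ i ζ)).comp htrc (A.contDiff_κ i hi)
        (fun j hj1 hj => (hC₂ j hj ζ).trans (le_self_pow₀ hC₂1 (by omega))) hF).rescale hC₂1
        (by linarith)
    have h2 : GeometricDerivBound m (A.a i) ζ C₃ F := fun j hj =>
      (hC₃ j hj ζ).trans (le_mul_of_one_le_right (by linarith) (one_le_pow₀ hF))
    exact h2.mul h1 (A.contDiff_a i hi) (htrc.comp (A.contDiff_κ i hi)) (by linarith) j hj
  refine (hC₁ _ F B' _ hsm hcs hF hB'0 hsupp hder).trans (le_of_eq ?_)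
  rw [Measure.addHaar_closedBall' _ _ (by positivity), ← hv, finrank_euclideanSpace,
    Fintype.card_fin, div_eq_mul_inv, mul_pow, ENNReal.mul_rpow_of_nonneg _ _ (by norm_num),
    ENNReal.ofReal_mul hB'0, ENNReal.ofReal_mul (by positivity : 0 ≤ F ^ σ),
    ENNReal.ofReal_mul (by positivity : 0 ≤ (C₄ * A.r) ^ (d - 1)),
    ENNReal.mul_rpow_of_nonneg _ _ (by norm_num),
    ENNReal.ofReal_rpow_of_nonneg (by positivity : 0 ≤ N⁻¹ ^ (d - 1)) (by norm_num)]
  push_cast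
  rw [ENNReal.coe_rpow_of_nonneg _ (by norm_num), ENNReal.coe_rpow_of_nonneg _ (by norm_num),
    ENNReal.coe_toNNReal hvtop]
  simp only [ENNReal.ofReal]
  ring

theorem surfaceNorm_le {σ : ℝ} (hσ : 0 ≤ σ) :
    ∃ C : ℝ≥0, ∀ N F M : ℝ, 1 ≤ N → N ≤ F → |M| ≤ F * N →
      ∀ u : EuclideanSpace ℝ (Fin d) → ℂ, Function.support u ⊆ Metric.closedBall A.x₀ A.ε →
      (∀ ξ ∈ S, ‖ξ - A.x₀‖ < A.r₀ → u ξ = A.trace N M (A.T (ξ - A.x₀))) →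
      𝒜.surfaceNorm σ u ≤ C * ENNReal.ofReal (F ^ σ * (N⁻¹ ^ (d - 1)) ^ (1 / 2 : ℝ)) := by
  have h (i : 𝒜.ι) := fun hi : i ∈ A.I => A.sobolevNorm_localPiece_le hσ hi
  choose! C hC using h
  refine ⟨∑ i ∈ A.I, C i, fun N F M hN hNF hM u hu htr => ?_⟩
  refine (𝒜.surfaceNorm_le_sum σ u A.I (A.localPiece_eq_zero u hu)).trans ?_
  push_cast
  rw [Finset.sum_mul]
  exact Finset.sum_le_sum fun i hi => (hC i hi N F M hN hNF hM u hu htr).2.2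

/-- In the main chart the transition map is a translation and the partition function is at least
`c`. On the ball of radius `r / (2 * N)` the cutoff equals `1`, so the trace is unimodular whatever
the modulation. -/
theorem lintegral_localPiece_ge : ∃ c : ℝ, 0 < c ∧ ∀ N M : ℝ, 1 ≤ N →
      ∀ u : EuclideanSpace ℝ (Fin d) → ℂ, Function.support u ⊆ Metric.closedBall A.x₀ A.ε →
      (∀ ξ ∈ S, ‖ξ - A.x₀‖ < A.r₀ → u ξ = A.trace N M (A.T (ξ - A.x₀))) →
      ENNReal.ofReal (c * N⁻¹ ^ (d - 1)) ≤ ∫⁻ ζ, ‖𝒜.localPiece A.i₀ u ζ‖ₑ ^ 2 := by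
  have hr := A.r_pos
  have hc := A.c_pos
  set v := volume (Metric.closedBall (0 : EuclideanSpace ℝ (Fin (d - 1))) 1) with hv
  have hvtop : v ≠ ⊤ := measure_closedBall_lt_top.ne
  have hv0 : v ≠ 0 := (Metric.measure_closedBall_pos volume _ one_pos).ne'
  have hvpos : 0 < v.toReal := ENNReal.toReal_pos hv0 hvtop
  refine ⟨A.c ^ 2 * (A.r / 2) ^ (d - 1) * v.toReal, by positivity, fun N M hN u hu htr => ?_⟩
  have hN0 : 0 < N := by linarith
  rw [A.localPiece_eq u _ hu htr A.i₀ A.i₀_mem]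
  set K := Metric.closedBall (A.z A.i₀) (A.r / 2 / N)
  calc _ = ENNReal.ofReal (A.c ^ 2) * volume K := by
        rw [Measure.addHaar_closedBall' _ _ (by positivity), ← hv, finrank_euclideanSpace,
          Fintype.card_fin, ← ENNReal.ofReal_toReal hvtop, ← ENNReal.ofReal_mul (by positivity),
          ← ENNReal.ofReal_mul (by positivity), ENNReal.toReal_ofReal hvpos.le,
          div_eq_mul_inv (A.r / 2) N]
        congr 1
        ring
    _ = ∫⁻ ζ in K, ENNReal.ofReal (A.c ^ 2) := by rw [setLIntegral_const]
    _ ≤ ∫⁻ ζ in K, ‖A.a A.i₀ ζ * A.trace N M (A.κ A.i₀ ζ)‖ₑ ^ 2 := by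
        refine setLIntegral_mono' Metric.isClosed_closedBall.measurableSet fun ζ hζ => ?_
        rw [mem_closedBall_iff_norm, le_div_iff₀ hN0] at hζ
        have hζr : ‖ζ - A.z A.i₀‖ ≤ A.r := by nlinarith [norm_nonneg (ζ - A.z A.i₀)]
        obtain ⟨h1, h2⟩ := A.main_chart _ hζr
        rw [add_sub_cancel] at h1 h2
        rw [← ofReal_norm, ← ENNReal.ofReal_pow (norm_nonneg _), h2]
        apply ENNReal.ofReal_le_ofReal
        have h3 : ‖A.trace N M (ζ - A.z A.i₀)‖ = 1 := by
          rw [trace, modulatedBump, A.ψ_eq_one]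
          · rw [mul_one, Circle.norm_coe]
          · rw [norm_smul, Real.norm_of_nonneg hN0.le]
            linarith
        rw [norm_mul, h3, mul_one]
        gcongr
    _ ≤ _ := setLIntegral_le_lintegral _ _

theorem integrable_localPiece {W : Type*} [NormedAddCommGroup W] [NormedSpace ℂ W]
    {u : EuclideanSpace ℝ (Fin d) → W} (hu : Function.support u ⊆ Metric.closedBall A.x₀ A.ε)
    (huc : Continuous u) : Integrable (𝒜.localPiece A.i₀ u) := by
  classical
  obtain ⟨B, hB⟩ := (HasCompactSupport.of_support_subset_isCompact
    (isCompact_closedBall A.x₀ A.ε) hu).exists_bound_of_continuous huc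
  have hB0 : 0 ≤ B := (norm_nonneg _).trans (hB 0)
  have hpc := (𝒜.chart A.i₀).contDiffOn_param.continuousOn
  have hρ : Continuous (𝒜.partition A.i₀) := (𝒜.partition A.i₀).contMDiff.continuous
  refine Integrable.mono' (g := (Metric.closedBall (A.z A.i₀) A.ε).indicator fun _ => B) ?_ ?_ ?_
  · exact (integrable_indicator_iff Metric.isClosed_closedBall.measurableSet).2
      (integrableOn_const measure_closedBall_lt_top.ne)
  · rw [SobolevAtlas.localPiece,
      aestronglyMeasurable_indicator_iff (𝒜.chart A.i₀).isOpen_U.measurableSet]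
    exact ContinuousOn.aestronglyMeasurable
      ((Complex.continuous_ofReal.comp_continuousOn (hρ.comp_continuousOn hpc)).smul
        (huc.comp_continuousOn hpc)) (𝒜.chart A.i₀).isOpen_U.measurableSet
  · refine Filter.Eventually.of_forall fun ζ => ?_
    by_cases hζ : 𝒜.localPiece A.i₀ u ζ = 0
    · rw [hζ, norm_zero]
      exact Set.indicator_nonneg (fun _ _ => hB0) _
    · have h1 : 𝒜.localPiece A.i₀ (fun ξ => ((‖u ξ‖ : ℝ) : ℂ)) ζ ≠ 0 := by
        rw [SobolevAtlas.localPiece, Set.indicator_apply] at hζ ⊢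
        split_ifs at hζ ⊢ with hU
        · rw [← ne_eq, smul_ne_zero_iff] at hζ
          rw [smul_ne_zero_iff]
          exact ⟨hζ.1, by simpa using hζ.2⟩
        · exact absurd rfl hζ
      have h2 : Function.support (fun ξ => ((‖u ξ‖ : ℝ) : ℂ)) ⊆ Metric.closedBall A.x₀ A.ε :=
        fun ξ hξ => hu (by simpa using hξ)
      obtain ⟨ξ, -, h3, -, h4⟩ := A.exists_of_localPiece_ne_zero _ h2 A.i₀ A.i₀_mem ζ h1
      have h5 := h2 h3
      rw [mem_closedBall_iff_norm] at h5
      rw [Set.indicator_of_mem (mem_closedBall_iff_norm.2 (h4.trans h5)), SobolevAtlas.localPiece,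
        Set.indicator_apply]
      split_ifs
      · rw [norm_smul, Complex.norm_real, Real.norm_of_nonneg (𝒜.partition.nonneg _ _)]
        exact (mul_le_of_le_one_left (norm_nonneg _) (𝒜.partition.le_one _ _)).trans (hB _)
      · simpa using hB0

/-- Lower bounds in spaces of negative order. -/
theorem le_surfaceNorm_neg {s : ℝ} (hs : 0 ≤ s) (W : Type*) [NormedAddCommGroup W]
    [NormedSpace ℂ W] [CompleteSpace W] :
    ∃ c : ℝ, 0 < c ∧ ∀ N F M : ℝ, 1 ≤ N → N ≤ F → |M| ≤ F * N →
      ∀ (u : EuclideanSpace ℝ (Fin d) → W) (Λ : W →L[ℂ] ℂ),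
      Function.support u ⊆ Metric.closedBall A.x₀ A.ε → Continuous u →
      (∀ ξ ∈ S, ‖ξ - A.x₀‖ < A.r₀ → Λ (u ξ) = A.trace N M (A.T (ξ - A.x₀))) →
      ENNReal.ofReal (c * (F ^ (-s) * (N⁻¹ ^ (d - 1)) ^ (1 / 2 : ℝ))) ≤
        ‖Λ‖ₑ * 𝒜.surfaceNorm (-s) u := by
  obtain ⟨C, hC⟩ := A.sobolevNorm_localPiece_le hs A.i₀_mem
  obtain ⟨c, hc, hlow⟩ := A.lintegral_localPiece_ge
  -- Duality: the squared `L²` norm is at least `c * N ^ (-(d - 1))` and at most the product of the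
  -- norms of orders `-s` and `s`; the latter is divided out by its upper bound. Enlarging `C` to `C
  -- + 1` keeps the divisor positive.
  refine ⟨c / (C + 1), by positivity, fun N F M hN hNF hM u Λ hu huc htr => ?_⟩
  have hN0 : 0 < N := by linarith
  have hF : 0 < F := by linarith
  have hΛu : Function.support (fun ξ => Λ (u ξ)) ⊆ Metric.closedBall A.x₀ A.ε :=
    fun ξ hξ => hu fun h => hξ (by simp [h])
  have hloc : 𝒜.localPiece A.i₀ (fun ξ => Λ (u ξ)) = fun ζ => Λ (𝒜.localPiece A.i₀ u ζ) := by
    classical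
    ext ζ
    rw [SobolevAtlas.localPiece, SobolevAtlas.localPiece, Set.indicator_apply, Set.indicator_apply]
    split_ifs <;> simp
  obtain ⟨hsm, hcs, hup⟩ := hC N F M hN hNF hM _ hΛu htr
  have hdual := lintegral_enorm_sq_le_sobolevNorm_mul s (hcs.toSchwartzMap hsm)
  have h1 := (hlow N M hN _ hΛu htr).trans hdual
  set X := 𝒜.localPiece A.i₀ (fun ξ => Λ (u ξ)) with hX
  have h2 : sobolevNorm (-s) X ≤ ‖Λ‖ₑ * 𝒜.surfaceNorm (-s) u := by
    rw [hloc]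
    exact (sobolevNorm_comp_continuousLinearMap_le (-s) Λ (A.integrable_localPiece hu huc)).trans
      (mul_le_mul_right (𝒜.sobolevNorm_localPiece_le _ _ _) _)
  refine le_trans ?_ h2
  set t := (N⁻¹ ^ (d - 1)) ^ (1 / 2 : ℝ) with ht
  have ht0 : 0 < t := by positivity
  have htt : N⁻¹ ^ (d - 1) = t * t := by
    rw [ht, ← Real.rpow_add (by positivity)]
    norm_num
  have hFs : 0 < F ^ s := by positivity
  have h3 : ENNReal.ofReal (c * N⁻¹ ^ (d - 1)) ≤
      sobolevNorm (-s) X * ENNReal.ofReal ((C + 1) * (F ^ s * t)) := by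
    refine h1.trans (mul_le_mul_right (hup.trans ?_) _)
    rw [ENNReal.ofReal_mul (by positivity : (0 : ℝ) ≤ C + 1), ENNReal.ofReal_add (by positivity) zero_le_one,
      ENNReal.ofReal_coe_nnreal]
    gcongr
    simp
  have h4 : c * N⁻¹ ^ (d - 1) = c / (C + 1) * (F ^ (-s) * t) * ((C + 1) * (F ^ s * t)) := by
    rw [htt, Real.rpow_neg hF.le]
    field_simp
  rw [h4, ENNReal.ofReal_mul (by positivity)] at h3
  exact (ENNReal.mul_le_mul_iff_left (by simp; positivity) ENNReal.ofReal_ne_top).1 h3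

end AdaptedFrame

/-! ### Normal derivatives of graph bumps on the surface. -/

/-- A compactly supported smooth function that agrees with `t ^ j` near zero. -/
theorem exists_contDiff_eventuallyEq_pow {r : ℝ} (hr : 0 < r) (j : ℕ) :
    ∃ q : ℝ → ℂ, ContDiff ℝ ∞ q ∧ tsupport q ⊆ Metric.closedBall 0 r ∧
      q =ᶠ[nhds 0] fun t => (t : ℂ) ^ j := by
  let χ : ContDiffBump (0 : ℝ) := ⟨r / 2, r, by linarith, by linarith⟩
  refine ⟨fun t => (t : ℂ) ^ j * (χ t : ℂ), ?_, ?_, ?_⟩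
  · exact (Complex.ofRealCLM.contDiff.pow j).mul (Complex.ofRealCLM.contDiff.comp χ.contDiff)
  · refine closure_minimal (fun t ht => ?_) Metric.isClosed_closedBall
    have : t ∈ Function.support χ := fun h => ht (by simp [h])
    rw [χ.support_eq] at this
    exact Metric.ball_subset_closedBall this
  · filter_upwards [χ.eventuallyEq_one] with t ht
    simp [ht]

theorem iteratedFDeriv_apply_const_eq_iteratedDeriv {E W : Type*} [NormedAddCommGroup E]
    [NormedSpace ℝ E] [NormedAddCommGroup W] [NormedSpace ℝ W] {f : E → W} (hf : ContDiff ℝ ∞ f)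
    (k : ℕ) (x e : E) :
    iteratedFDeriv ℝ k f x (fun _ => e) = iteratedDeriv k (fun t : ℝ => f (x + t • e)) 0 := by
  have h : (fun t : ℝ => f (x + t • e)) =
      (fun y => f (x + y)) ∘ (ContinuousLinearMap.toSpanSingleton ℝ e) := by
    ext t
    simp
  rw [iteratedDeriv_eq_iteratedFDeriv, h, ContinuousLinearMap.iteratedFDeriv_comp_right
    (n := ∞) _ (by fun_prop) _ (by exact_mod_cast le_top), iteratedFDeriv_comp_add_left]
  simp

theorem iteratedDeriv_ofReal_mul_pow (i j : ℕ) (L : ℝ) :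
    iteratedDeriv i (fun t : ℝ => ((L * t : ℝ) : ℂ) ^ j) 0 =
      if i = j then (L : ℂ) ^ j * j.factorial else 0 := by
  have h (t : ℝ) : iteratedDeriv i (fun t : ℝ => ((L * t : ℝ) : ℂ) ^ j) t =
      (L : ℂ) ^ j * j.descFactorial i * (t : ℂ) ^ (j - i) := by
    induction i generalizing t with
    | zero => simp [mul_pow]
    | succ i ih =>
      rw [iteratedDeriv_succ, funext ih]
      have := (((hasDerivAt_id (t : ℂ)).pow (j - i)).comp_ofReal.const_mul
        ((L : ℂ) ^ j * j.descFactorial i)).deriv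
      simp only [id, Pi.pow_apply] at this
      rw [this, Nat.descFactorial_succ, show j - (i + 1) = j - i - 1 by omega]
      push_cast
      ring
  rw [h]
  split_ifs with hij
  · simp [hij, Nat.descFactorial_self]
  · rcases lt_or_gt_of_ne hij with hlt | hgt
    · simp [Nat.sub_ne_zero_of_lt hlt]
    · simp [Nat.descFactorial_of_lt hgt]

/-- In the Leibniz formula only the term with exactly `j` derivatives on `(L * t) ^ j` survives at
`t = 0`. -/
theorem iteratedDeriv_fourierChar_mul {k j : ℕ} (hj : j ≤ k) {q : ℝ → ℂ}
    (hq : q =ᶠ[nhds 0] fun t => (t : ℂ) ^ j) (M : ℝ) (L : ℝ) :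
    iteratedDeriv k (fun t : ℝ => (Real.fourierChar (M * t) : ℂ) * q (L * t)) 0 =
      (k.choose j * j.factorial) * ((2 * Real.pi * M * Complex.I) ^ (k - j) * (L : ℂ) ^ j) := by
  have h0 : Filter.Tendsto (fun t : ℝ => L * t) (nhds 0) (nhds 0) := by
    have : Continuous fun t : ℝ => L * t := by fun_prop
    simpa using this.tendsto 0
  have h : (fun t : ℝ => (Real.fourierChar (M * t) : ℂ) * q (L * t)) =ᶠ[nhds 0]
      (fun t : ℝ => ((L * t : ℝ) : ℂ) ^ j) * (fun t : ℝ => (Real.fourierChar (M * t) : ℂ)) := by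
    filter_upwards [h0.eventually hq] with t ht
    rw [ht, Pi.mul_apply, mul_comm]
  have hL : ContDiff ℝ ∞ fun t : ℝ => ((L * t : ℝ) : ℂ) ^ j :=
    (Complex.ofRealCLM.contDiff.comp (contDiff_const.mul contDiff_id)).pow j
  have hM : ContDiff ℝ ∞ fun t : ℝ => (Real.fourierChar (M * t) : ℂ) :=
    contDiff_coe_fourierChar.comp (contDiff_const.mul contDiff_id)
  rw [h.iteratedDeriv_eq, iteratedDeriv_mul (hL.of_le (by exact_mod_cast le_top)).contDiffAt
    (hM.of_le (by exact_mod_cast le_top)).contDiffAt, Finset.sum_eq_single j]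
  · rw [iteratedDeriv_ofReal_mul_pow, if_pos rfl, iteratedDeriv_coe_fourierChar]
    simp
    ring
  · intro i _ hij
    rw [iteratedDeriv_ofReal_mul_pow, if_neg hij]
    simp
  · intro hjk
    simp at hjk
    omega

namespace GraphFrame

variable {d : ℕ} (D : GraphFrame d)

/-- The normal direction. -/
noncomputable def normalVector : EuclideanSpace ℝ (Fin d) := D.Y.symm (0, 1)

theorem T_normalVector : D.T D.normalVector = 0 := by
  have := D.Y_apply D.normalVector
  rw [normalVector, D.Y.apply_symm_apply, Prod.mk.injEq] at this
  exact this.1.symm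

theorem η_normalVector : D.η D.normalVector = 1 := by
  have := D.Y_apply D.normalVector
  rw [normalVector, D.Y.apply_symm_apply, Prod.mk.injEq] at this
  exact this.2.symm

/-- Along the normal line through a point of the graph the tangential coordinate is constant, so the
bump splits into its trace and a function of one variable. Normal derivatives on the surface are
thus scalar multiples of the trace. -/
theorem graphBump_add_smul_normalVector (q : ℝ → ℂ) (N M L : ℝ) {ξ : EuclideanSpace ℝ (Fin d)}
    (hξ : D.η (ξ - D.x₀) = D.b (D.T (ξ - D.x₀))) (t : ℝ) :
    D.graphBump q N M L (ξ + t • D.normalVector) =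
      modulatedBump D.ψ D.b N M (D.T (ξ - D.x₀)) *
        ((Real.fourierChar (M * t) : ℂ) * q (L * t)) := by
  rw [graphBump, modulatedBump, add_sub_right_comm, map_add, map_add, map_smul, map_smul,
    T_normalVector, η_normalVector, hξ, mul_add, AddChar.map_add_eq_mul]
  simp
  ring

theorem iteratedFDeriv_graphBump_normalVector {k j : ℕ} (hj : j ≤ k) {q : ℝ → ℂ}
    (hqc : ContDiff ℝ ∞ q) (hq : q =ᶠ[nhds 0] fun t => (t : ℂ) ^ j) (N M L : ℝ)
    {ξ : EuclideanSpace ℝ (Fin d)} (hξ : D.η (ξ - D.x₀) = D.b (D.T (ξ - D.x₀))) :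
    iteratedFDeriv ℝ k (D.graphBump q N M L) ξ (fun _ => D.normalVector) =
      (k.choose j * j.factorial) * ((2 * Real.pi * M * Complex.I) ^ (k - j) * (L : ℂ) ^ j) *
        modulatedBump D.ψ D.b N M (D.T (ξ - D.x₀)) := by
  rw [iteratedFDeriv_apply_const_eq_iteratedDeriv (D.contDiff_graphBump hqc N M L)]
  simp_rw [D.graphBump_add_smul_normalVector q N M L hξ]
  rw [iteratedDeriv_const_mul_field, iteratedDeriv_fourierChar_mul hj hq]
  ring

theorem graphBump_of_graph (q : ℝ → ℂ) (N M L : ℝ) {ξ : EuclideanSpace ℝ (Fin d)}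
    (hξ : D.η (ξ - D.x₀) = D.b (D.T (ξ - D.x₀))) :
    D.graphBump q N M L ξ = modulatedBump D.ψ D.b N M (D.T (ξ - D.x₀)) * q 0 := by
  simpa using D.graphBump_add_smul_normalVector q N M L hξ 0

end GraphFrame

/-! ### Testing the restriction estimate: Knapp examples. -/

/-- Evaluation of a real multilinear map with complex values at a fixed vector. -/
noncomputable def ContinuousMultilinearMap.diagEval {E : Type*} [NormedAddCommGroup E]
    [NormedSpace ℝ E] (k : ℕ) (e : E) :
    ContinuousMultilinearMap ℝ (fun _ : Fin k => E) ℂ →L[ℂ] ℂ :=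
  LinearMap.mkContinuous
    { toFun := fun m => m fun _ => e
      map_add' := fun _ _ => rfl
      map_smul' := fun _ _ => rfl } (‖e‖ ^ k) fun m => by
    simpa [mul_comm] using m.le_opNorm fun _ => e

theorem ContinuousMultilinearMap.norm_diagEval_le {E : Type*} [NormedAddCommGroup E]
    [NormedSpace ℝ E] (k : ℕ) (e : E) : ‖ContinuousMultilinearMap.diagEval k e‖ ≤ ‖e‖ ^ k :=
  LinearMap.mkContinuous_norm_le _ (by positivity) _

namespace AdaptedFrame

variable {d : ℕ} {S : Set (EuclideanSpace ℝ (Fin d))} {𝒜 : SobolevAtlas S} (A : AdaptedFrame 𝒜)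

/-- The restriction estimate, tested on functions with Fourier transform supported near the centre
of an adapted frame. -/
theorem le_of_HDR {k : ℕ} {s ℓ p : ℝ} (hs : 0 ≤ s) (h : HDR 𝒜 k s ℓ p) :
    ∃ C : ℝ≥0, ∀ N F M : ℝ, 1 ≤ N → N ≤ F → |M| ≤ F * N →
      ∀ G : 𝓢(EuclideanSpace ℝ (Fin d), ℂ), Function.support G ⊆ Metric.closedBall A.x₀ A.ε →
      ∀ β : ℂ, (∀ ξ ∈ S, ‖ξ - A.x₀‖ < A.r₀ →
        iteratedFDeriv ℝ k G ξ (fun _ => A.normalVector) = β * A.trace N M (A.T (ξ - A.x₀))) →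
      ENNReal.ofReal (‖β‖ * (F ^ (-s) * (N⁻¹ ^ (d - 1)) ^ (1 / 2 : ℝ))) ≤
        C * (eLpNorm (𝓕⁻ G : 𝓢(EuclideanSpace ℝ (Fin d), ℂ)) (ENNReal.ofReal p) volume +
          𝒜.surfaceNorm ℓ G) := by
  -- One cutoff equal to `1` on the ball of radius `ε` serves all admissible `G`, so the constant
  -- does not depend on the scales. Multiplication by it changes neither `G` nor its derivatives.
  let χ : ContDiffBump A.x₀ := ⟨A.ε, 2 * A.ε, A.ε_pos, by linarith [A.ε_pos]⟩
  obtain ⟨C, hC⟩ := h (fun ξ => (χ ξ : ℂ)) (Complex.ofRealCLM.contDiff.comp χ.contDiff)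
    (χ.hasCompactSupport.comp_left (g := fun t : ℝ => (t : ℂ)) (by simp))
  obtain ⟨c, hc, hlow⟩ := A.le_surfaceNorm_neg hs
    (ContinuousMultilinearMap ℝ (fun _ : Fin k => EuclideanSpace ℝ (Fin d)) ℂ)
  refine ⟨(‖A.normalVector‖ ^ k / c).toNNReal * C, fun N F M hN hNF hM G hG β htr => ?_⟩
  have hF0 : 0 < F := by linarith
  have hN0 : 0 < N := by linarith
  by_cases hβ : β = 0
  · simp [hβ]
  have hGt : tsupport G ⊆ Metric.closedBall A.x₀ A.ε :=
    closure_minimal hG Metric.isClosed_closedBall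
  have hχ {ξ : EuclideanSpace ℝ (Fin d)} (hξ : ξ ∈ Metric.closedBall A.x₀ A.ε) : χ ξ = 1 :=
    χ.one_of_mem_closedBall hξ
  have hsupp : Function.support (iteratedFDeriv ℝ k G) ⊆ Metric.closedBall A.x₀ A.ε :=
    (support_iteratedFDeriv_subset k).trans hGt
  have h1 := hC (𝓕⁻ G)
  have e1 : (fun ξ => (χ ξ : ℂ) • iteratedFDeriv ℝ k G ξ) = iteratedFDeriv ℝ k G := by
    ext1 ξ
    by_cases hξ : ξ ∈ Metric.closedBall A.x₀ A.ε
    · simp [hχ hξ]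
    · rw [Function.notMem_support.1 fun h => hξ (hsupp h), smul_zero]
  have e2 : (fun ξ => (χ ξ : ℂ) * G ξ) = G := by
    ext1 ξ
    by_cases hξ : ξ ∈ Metric.closedBall A.x₀ A.ε
    · simp [hχ hξ]
    · rw [Function.notMem_support.1 fun h => hξ (hG h), mul_zero]
  rw [FourierTransform.fourier_fourierInv_eq, e1, e2] at h1
  have h2 := hlow N F M hN hNF hM (iteratedFDeriv ℝ k G)
    (β⁻¹ • ContinuousMultilinearMap.diagEval k A.normalVector) hsupp
    ((G.smooth ⊤).continuous_iteratedFDeriv (by exact_mod_cast le_top))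
    (fun ξ hξ hξr => by
      change β⁻¹ * iteratedFDeriv ℝ k G ξ (fun _ => A.normalVector) = _
      rw [htr ξ hξ hξr, inv_mul_cancel_left₀ hβ])
  have hβ0 : 0 < ‖β‖ := norm_pos_iff.2 hβ
  have h3 : ‖β⁻¹ • ContinuousMultilinearMap.diagEval k A.normalVector‖ₑ ≤
      ENNReal.ofReal (‖β‖⁻¹ * ‖A.normalVector‖ ^ k) := by
    rw [← ofReal_norm]
    refine ENNReal.ofReal_le_ofReal ?_
    refine (ContinuousLinearMap.opNorm_smul_le _ _).trans ?_
    rw [norm_inv]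
    exact mul_le_mul_of_nonneg_left (ContinuousMultilinearMap.norm_diagEval_le _ _) (by positivity)
  have h4 := h2.trans (mul_le_mul' h3 h1)
  rw [show ‖β‖ * (F ^ (-s) * (N⁻¹ ^ (d - 1)) ^ (1 / 2 : ℝ)) =
    (‖β‖ / c) * (c * (F ^ (-s) * (N⁻¹ ^ (d - 1)) ^ (1 / 2 : ℝ))) by field_simp,
    ENNReal.ofReal_mul (by positivity)]
  refine (mul_le_mul_right h4 _).trans (le_of_eq ?_)
  rw [← mul_assoc, ← ENNReal.ofReal_mul (by positivity), ENNReal.coe_mul, ← mul_assoc]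
  congr 2
  change _ = ENNReal.ofReal _
  congr 1
  field_simp

end AdaptedFrame

theorem knapp_exponent {d : ℕ} (hd : 1 ≤ d) {p N : ℝ} (hN : 0 < N) :
    (N⁻¹ ^ (d - 1) * (N ^ 2)⁻¹) ^ (1 - 1 / p) * ((N / N) ^ (d - 1)) ^ (1 / 2 : ℝ) =
      N ^ kappaExp d p * (N⁻¹ ^ (d - 1)) ^ (1 / 2 : ℝ) := by
  have h1 : N⁻¹ ^ (d - 1) = N ^ (-((d : ℝ) - 1)) := by
    rw [Real.rpow_neg hN.le, inv_pow, ← Real.rpow_natCast, Nat.cast_sub hd, Nat.cast_one]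
  have h2 : (N ^ 2)⁻¹ = N ^ (-2 : ℝ) := by
    rw [Real.rpow_neg hN.le, Real.rpow_ofNat]
  rw [h1, h2, ← Real.rpow_add hN, div_self hN.ne', one_pow, Real.one_rpow, mul_one,
    ← Real.rpow_mul hN.le, ← Real.rpow_mul hN.le, ← Real.rpow_add hN, kappaExp]
  congr 1
  ring

namespace AdaptedFrame

variable {d : ℕ} {S : Set (EuclideanSpace ℝ (Fin d))} {𝒜 : SobolevAtlas S} (A : AdaptedFrame 𝒜)

theorem surfaceNorm_eq_zero (σ : ℝ) {u : EuclideanSpace ℝ (Fin d) → ℂ}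
    (hu : Function.support u ⊆ Metric.closedBall A.x₀ A.ε)
    (hu0 : ∀ ξ ∈ S, ‖ξ - A.x₀‖ < A.r₀ → u ξ = 0) : 𝒜.surfaceNorm σ u = 0 := by
  have h (i : 𝒜.ι) : 𝒜.localPiece i u = 0 := by
    by_cases hi : i ∈ A.I
    · rw [A.localPiece_eq u (fun _ => 0) hu hu0 i hi]
      ext
      simp
    · exact A.localPiece_eq_zero u hu i hi
  have h0 : sobolevNorm σ (0 : EuclideanSpace ℝ (Fin (d - 1)) → ℂ) = 0 := by
    have (z : EuclideanSpace ℝ (Fin (d - 1))) :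
        𝓕 (0 : EuclideanSpace ℝ (Fin (d - 1)) → ℂ) z = 0 := by
      simp [Real.fourier_eq]
    simp [sobolevNorm, this]
  simp [SobolevAtlas.surfaceNorm, h, h0]

theorem surfaceNorm_graphBump_eq_zero (σ : ℝ) {q : ℝ → ℂ}
    (hqr : tsupport q ⊆ Metric.closedBall 0 A.r) (hq0 : q 0 = 0) {N M L : ℝ} (hN : 1 ≤ N)
    (hL : 1 ≤ L) : 𝒜.surfaceNorm σ (A.graphBump q N M L) = 0 :=
  A.surfaceNorm_eq_zero σ (A.support_graphBump q N M L hqr hN hL) fun ξ hξ hξr => by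
    rw [A.graphBump_of_graph q N M L (A.graph ξ hξ hξr), hq0, mul_zero]

/-- The normal derivative brings out `L ^ j * M ^ (k - j)` times numerical factors of modulus at
least one, which are dropped. -/
theorem graphBump_le_of_HDR {k j : ℕ} (hj : j ≤ k) {s ℓ p : ℝ} (hs : 0 ≤ s) (h : HDR 𝒜 k s ℓ p)
    {q : ℝ → ℂ} (hqc : ContDiff ℝ ∞ q) (hqr : tsupport q ⊆ Metric.closedBall 0 A.r)
    (hq : q =ᶠ[nhds 0] fun t => (t : ℂ) ^ j) :
    ∃ C : ℝ≥0, ∀ N F M L : ℝ, 1 ≤ N → N ≤ F → 0 ≤ M → M ≤ F * N → 1 ≤ L →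
      ∀ G : 𝓢(EuclideanSpace ℝ (Fin d), ℂ), (∀ ξ, G ξ = A.graphBump q N M L ξ) →
      ENNReal.ofReal (L ^ j * M ^ (k - j) * (F ^ (-s) * (N⁻¹ ^ (d - 1)) ^ (1 / 2 : ℝ))) ≤
        C * (eLpNorm (𝓕⁻ G : 𝓢(EuclideanSpace ℝ (Fin d), ℂ)) (ENNReal.ofReal p) volume +
          𝒜.surfaceNorm ℓ (A.graphBump q N M L)) := by
  obtain ⟨C, hC⟩ := A.le_of_HDR hs h
  refine ⟨C, fun N F M L hN hNF hM0 hM hL G hG => ?_⟩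
  have hN0 : 0 < N := by linarith
  have hF0 : 0 < F := by linarith
  have hG' : (G : EuclideanSpace ℝ (Fin d) → ℂ) = A.graphBump q N M L := funext hG
  have h1 := hC N F M hN hNF (by rwa [abs_of_nonneg hM0]) G
    (by rw [hG']; exact A.support_graphBump q N M L hqr hN hL)
    ((k.choose j * j.factorial) * ((2 * Real.pi * M * Complex.I) ^ (k - j) * (L : ℂ) ^ j))
    (fun ξ hξ hξr => by
      rw [hG', A.iteratedFDeriv_graphBump_normalVector hj hqc hq N M L (A.graph ξ hξ hξr)]
      rfl)
  rw [hG'] at h1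
  refine le_trans (ENNReal.ofReal_le_ofReal (mul_le_mul_of_nonneg_right ?_ (by positivity))) h1
  have h2 : (1 : ℝ) ≤ k.choose j * j.factorial := by
    exact_mod_cast Nat.one_le_iff_ne_zero.2
      (mul_ne_zero (Nat.choose_pos hj).ne' j.factorial_ne_zero)
  have h3 : M ≤ 2 * Real.pi * M := by nlinarith [Real.pi_gt_three]
  simp only [norm_mul, norm_pow, Complex.norm_natCast, Complex.norm_I, mul_one, Complex.norm_real,
    Complex.norm_ofNat, Real.norm_eq_abs, abs_of_pos Real.pi_pos, abs_of_nonneg hM0,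
    abs_of_nonneg (zero_le_one.trans hL)]
  calc L ^ j * M ^ (k - j) ≤ L ^ j * (2 * Real.pi * M) ^ (k - j) := by gcongr
    _ = 1 * ((2 * Real.pi * M) ^ (k - j) * L ^ j) := by ring
    _ ≤ _ := mul_le_mul_of_nonneg_right h2 (by positivity)

/-- The restriction estimate tested on Knapp examples. -/
theorem knapp_le_of_HDR (A : AdaptedFrame 𝒜) (hd : 1 ≤ d) {k : ℕ} {s ℓ p : ℝ} (hs : 0 ≤ s) (hℓ : 0 ≤ ℓ) (hp : 1 ≤ p)
    (hp2 : p < 2) (h : HDR 𝒜 k s ℓ p) :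
    ∃ C : ℝ, 0 < C ∧ ∀ N F : ℝ, 1 ≤ N → N ≤ F →
      (F * N) ^ k * F ^ (-s) ≤ C * (N ^ kappaExp d p + F ^ ℓ) := by
  obtain ⟨q, hqc, hqr, hq⟩ := exists_contDiff_eventuallyEq_pow A.r_pos 0
  obtain ⟨C, hC⟩ := A.graphBump_le_of_HDR (Nat.zero_le k) hs h hqc hqr hq
  obtain ⟨C₁, hC₁⟩ := A.eLpNorm_fourierInv_graphBump_le hqc hqr hp hp2
  obtain ⟨C₂, hC₂⟩ := A.surfaceNorm_le hℓ
  refine ⟨C * (C₁ + C₂) + 1, by positivity, fun N F hN hNF => ?_⟩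
  have hN0 : 0 < N := by linarith
  have hF0 : 0 < F := by linarith
  have hL : 1 ≤ N ^ 2 := one_le_pow₀ hN
  let G : 𝓢(EuclideanSpace ℝ (Fin d), ℂ) :=
    (A.hasCompactSupport_graphBump hqr hN hL).toSchwartzMap (A.contDiff_graphBump hqc N (F * N) (N ^ 2))
  have h1 := hC N F (F * N) (N ^ 2) hN hNF (by positivity) le_rfl hL G fun _ => rfl
  -- Here `P = N` and `L = N ^ 2`, the largest `L` allowed by `L ≤ P * N`: the bump fills a cap on
  -- which the surface is flat at its own thickness.
  have h2 := hC₁ N N (N ^ 2) (F * N) hN le_rfl hL (by rw [sq]) G fun _ => rfl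
  have h3 := hC₂ N F (F * N) hN hNF (by rw [abs_of_nonneg (by positivity)])
    (A.graphBump q N (F * N) (N ^ 2)) (A.support_graphBump q _ _ _ hqr hN hL) fun ξ hξ hξr => by
      rw [A.graphBump_of_graph _ _ _ _ (A.graph ξ hξ hξr), hq.self_of_nhds]
      simp [trace]
  rw [knapp_exponent hd hN0] at h2
  set t := (N⁻¹ ^ (d - 1)) ^ (1 / 2 : ℝ)
  have ht : 0 < t := by positivity
  have h4 : ENNReal.ofReal ((N ^ 2) ^ 0 * (F * N) ^ (k - 0) * (F ^ (-s) * t)) ≤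
      ENNReal.ofReal (C * (C₁ * (N ^ kappaExp d p * t) + C₂ * (F ^ ℓ * t))) := by
    refine h1.trans ((mul_le_mul_right (add_le_add h2 h3) _).trans (le_of_eq ?_))
    rw [ENNReal.ofReal_mul (p := C) (by positivity), ENNReal.ofReal_add (by positivity) (by positivity),
      ENNReal.ofReal_mul (p := C₁) (by positivity), ENNReal.ofReal_mul (p := C₂) (by positivity)]
    simp only [ENNReal.ofReal_coe_nnreal]
  have h5 := (ENNReal.ofReal_le_ofReal_iff (by positivity)).1 h4
  rw [pow_zero, one_mul, Nat.sub_zero] at h5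
  refine le_of_mul_le_mul_right ?_ ht
  have e1 : 0 ≤ N ^ kappaExp d p := by positivity
  have e2 : 0 ≤ F ^ ℓ := by positivity
  have e3 : (C : ℝ) * (C₁ * N ^ kappaExp d p + C₂ * F ^ ℓ) ≤
      (C * (C₁ + C₂) + 1) * (N ^ kappaExp d p + F ^ ℓ) := by
    have : 0 ≤ (C : ℝ) * (C₁ * F ^ ℓ + C₂ * N ^ kappaExp d p) := by positivity
    nlinarith
  calc (F * N) ^ k * F ^ (-s) * t = (F * N) ^ k * (F ^ (-s) * t) := by ring
    _ ≤ _ := h5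
    _ = (C * (C₁ * N ^ kappaExp d p + C₂ * F ^ ℓ)) * t := by ring
    _ ≤ _ := mul_le_mul_of_nonneg_right e3 ht.le

/-- The restriction estimate tested on Knapp examples that vanish on the hypersurface. -/
theorem vanishing_knapp_le_of_HDR (A : AdaptedFrame 𝒜) (hd : 1 ≤ d) {k : ℕ} (hk : 1 ≤ k) {s ℓ p : ℝ} (hs : 0 ≤ s)
    (hp : 1 ≤ p) (hp2 : p < 2) (h : HDR 𝒜 k s ℓ p) :
    ∃ C : ℝ, 0 < C ∧ ∀ N F : ℝ, 1 ≤ N → N ≤ F →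
      N ^ 2 * (F * N) ^ (k - 1) * F ^ (-s) ≤ C * N ^ kappaExp d p := by
  obtain ⟨q, hqc, hqr, hq⟩ := exists_contDiff_eventuallyEq_pow A.r_pos 1
  obtain ⟨C, hC⟩ := A.graphBump_le_of_HDR hk hs h hqc hqr hq
  obtain ⟨C₁, hC₁⟩ := A.eLpNorm_fourierInv_graphBump_le hqc hqr hp hp2
  have hq0 : q 0 = 0 := by simpa using hq.self_of_nhds
  refine ⟨C * C₁ + 1, by positivity, fun N F hN hNF => ?_⟩
  have hN0 : 0 < N := by linarith
  have hF0 : 0 < F := by linarith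
  have hL : 1 ≤ N ^ 2 := one_le_pow₀ hN
  let G : 𝓢(EuclideanSpace ℝ (Fin d), ℂ) :=
    (A.hasCompactSupport_graphBump hqr hN hL).toSchwartzMap (A.contDiff_graphBump hqc N (F * N) (N ^ 2))
  have h1 := hC N F (F * N) (N ^ 2) hN hNF (by positivity) le_rfl hL G fun _ => rfl
  have h2 := hC₁ N N (N ^ 2) (F * N) hN le_rfl hL (by rw [sq]) G fun _ => rfl
  rw [A.surfaceNorm_graphBump_eq_zero ℓ hqr hq0 hN hL, add_zero] at h1
  rw [knapp_exponent hd hN0] at h2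
  set t := (N⁻¹ ^ (d - 1)) ^ (1 / 2 : ℝ)
  have ht : 0 < t := by positivity
  have h4 : ENNReal.ofReal ((N ^ 2) ^ 1 * (F * N) ^ (k - 1) * (F ^ (-s) * t)) ≤
      ENNReal.ofReal (C * (C₁ * (N ^ kappaExp d p * t))) := by
    refine h1.trans ((mul_le_mul_right h2 _).trans (le_of_eq ?_))
    rw [ENNReal.ofReal_mul (p := C) (by positivity), ENNReal.ofReal_mul (p := C₁) (by positivity)]
    simp only [ENNReal.ofReal_coe_nnreal]
  have h5 := (ENNReal.ofReal_le_ofReal_iff (by positivity)).1 h4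
  rw [pow_one] at h5
  refine le_of_mul_le_mul_right ?_ ht
  have e1 : 0 ≤ N ^ kappaExp d p * t := by positivity
  linarith

end AdaptedFrame

/-! ### Slabs around the surface and the exponent `σ_p`. -/

/-- Adding to `g` functions that are bounded in `L^p` and tend to zero pointwise eventually adds at
most a constant to the integral of the `p`-th power. -/
theorem eventually_lintegral_add_rpow_le {α W : Type*} [MeasurableSpace α] {μ : Measure α}
    [NormedAddCommGroup W] {p : ℝ} (hp : 1 ≤ p) {g : α → W} {f : ℕ → α → W}
    (hgm : AEStronglyMeasurable g μ) (hfm : ∀ n, AEStronglyMeasurable (f n) μ)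
    (hg : ∫⁻ x, ‖g x‖ₑ ^ p ∂μ ≠ ⊤)
    (hf : ∀ x, Filter.Tendsto (fun n => f n x) Filter.atTop (nhds 0)) {C : ℝ≥0∞}
    (hC : ∀ᶠ n in Filter.atTop, ∫⁻ x, ‖f n x‖ₑ ^ p ∂μ ≤ C) :
    ∀ᶠ n in Filter.atTop, ∫⁻ x, ‖g x + f n x‖ₑ ^ p ∂μ ≤
      ∫⁻ x, ‖g x‖ₑ ^ p ∂μ + (1 + 2 ^ (p - 1) * C) := by
  have hp0 : 0 < p := by linarith
  have h2 : (2 : ℝ≥0∞) ^ (p - 1) ≠ ⊤ := by finiteness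
  have hsum (n : ℕ) (x : α) : ‖g x + f n x‖ₑ ^ p ≤
      2 ^ (p - 1) * ‖g x‖ₑ ^ p + 2 ^ (p - 1) * ‖f n x‖ₑ ^ p := by
    rw [← mul_add]
    exact (ENNReal.rpow_le_rpow (enorm_add_le _ _) hp0.le).trans
      (ENNReal.rpow_add_le_mul_rpow_add_rpow _ _ hp)
  -- Subtracting (with truncation at zero) the part due to `f n` leaves integrands dominated by `2 ^
  -- (p - 1) * ‖g‖ ^ p` and tending pointwise to `‖g‖ ^ p`. The `1` in the claim is the slack that
  -- makes the limit usable at a finite stage.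
  have hlim := tendsto_lintegral_of_dominated_convergence' (μ := μ)
    (F := fun n x => ‖g x + f n x‖ₑ ^ p - 2 ^ (p - 1) * ‖f n x‖ₑ ^ p)
    (f := fun x => ‖g x‖ₑ ^ p)
    (fun x => 2 ^ (p - 1) * ‖g x‖ₑ ^ p)
    (fun n => (((hgm.add (hfm n)).enorm.pow_const p).sub
      (((hfm n).enorm.pow_const p).const_mul _)))
    (fun n => Filter.Eventually.of_forall fun x => tsub_le_iff_right.2 (hsum n x))
    (by rw [lintegral_const_mul' _ _ h2]; exact ENNReal.mul_ne_top h2 hg)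
    (Filter.Eventually.of_forall fun x => by
      have e1 : Filter.Tendsto (fun n => ‖g x + f n x‖ₑ ^ p) Filter.atTop (nhds (‖g x‖ₑ ^ p)) := by
        have := ((tendsto_const_nhds (x := g x)).add (hf x)).enorm
        rw [add_zero] at this
        exact (ENNReal.continuous_rpow_const.tendsto _).comp this
      have e2 : Filter.Tendsto (fun n => 2 ^ (p - 1) * ‖f n x‖ₑ ^ p) Filter.atTop (nhds 0) := by
        have := (ENNReal.continuous_rpow_const (y := p)).tendsto _ |>.comp (hf x).enorm
        rw [enorm_zero, ENNReal.zero_rpow_of_pos hp0] at this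
        simpa using ENNReal.Tendsto.const_mul this (Or.inr h2)
      simpa using ENNReal.Tendsto.sub e1 e2 (Or.inr (by simp)))
  have hlt : ∫⁻ x, ‖g x‖ₑ ^ p ∂μ < ∫⁻ x, ‖g x‖ₑ ^ p ∂μ + 1 :=
    ENNReal.lt_add_right hg one_ne_zero
  filter_upwards [hlim.eventually_lt_const hlt, hC] with n hn hCn
  calc ∫⁻ x, ‖g x + f n x‖ₑ ^ p ∂μ
      ≤ ∫⁻ x, ((‖g x + f n x‖ₑ ^ p - 2 ^ (p - 1) * ‖f n x‖ₑ ^ p) +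
          2 ^ (p - 1) * ‖f n x‖ₑ ^ p) ∂μ := lintegral_mono fun x => le_tsub_add
    _ = ∫⁻ x, (‖g x + f n x‖ₑ ^ p - 2 ^ (p - 1) * ‖f n x‖ₑ ^ p) ∂μ +
          2 ^ (p - 1) * ∫⁻ x, ‖f n x‖ₑ ^ p ∂μ := by
        rw [lintegral_add_right' _ (((hfm n).enorm.pow_const p).const_mul _),
          lintegral_const_mul' _ _ h2]
    _ ≤ (∫⁻ x, ‖g x‖ₑ ^ p ∂μ + 1) + 2 ^ (p - 1) * C := by gcongr
    _ = _ := by rw [add_assoc]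

theorem slab_exponent {d : ℕ} (hd : 1 ≤ d) {p L : ℝ} (hL : 0 < L) :
    (L⁻¹ ^ (d - 1) * L⁻¹) ^ (1 - 1 / p) * ((L / 1) ^ (d - 1)) ^ (1 / 2 : ℝ) =
      L ^ sigmaExp d p := by
  have h1 : L⁻¹ ^ (d - 1) = L ^ (-((d : ℝ) - 1)) := by
    rw [Real.rpow_neg hL.le, inv_pow, ← Real.rpow_natCast, Nat.cast_sub hd, Nat.cast_one]
  have h2 : L ^ (d - 1) = L ^ ((d : ℝ) - 1) := by
    rw [← Real.rpow_natCast, Nat.cast_sub hd, Nat.cast_one]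
  have h3 : L⁻¹ = L ^ (-1 : ℝ) := by rw [Real.rpow_neg_one]
  rw [h1, div_one, h2, h3, ← Real.rpow_add hL, ← Real.rpow_mul hL.le, ← Real.rpow_mul hL.le,
    ← Real.rpow_add hL, sigmaExp]
  congr 1
  ring

theorem SchwartzMap.enorm_fourierInv_le {n : ℕ} (F : 𝓢(EuclideanSpace ℝ (Fin n), ℂ))
    (x : EuclideanSpace ℝ (Fin n)) :
    ‖(𝓕⁻ F : 𝓢(EuclideanSpace ℝ (Fin n), ℂ)) x‖ₑ ≤ ∫⁻ y, ‖F y‖ₑ := by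
  rw [SchwartzMap.fourierInv_coe, Real.fourierInv_eq]
  refine (enorm_integral_le_lintegral_enorm _).trans (le_of_eq ?_)
  simp only [← ofReal_norm, Circle.norm_smul]

theorem SchwartzMap.lintegral_enorm_sq_fourierInv {n : ℕ} (f : 𝓢(EuclideanSpace ℝ (Fin n), ℂ)) :
    ∫⁻ z, ‖(𝓕⁻ f : 𝓢(EuclideanSpace ℝ (Fin n), ℂ)) z‖ₑ ^ 2 = ∫⁻ x, ‖f x‖ₑ ^ 2 := by
  rw [← SchwartzMap.lintegral_enorm_sq_fourier (𝓕⁻ f), FourierTransform.fourier_fourierInv_eq]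

namespace AdaptedFrame

variable {d : ℕ} {S : Set (EuclideanSpace ℝ (Fin d))} {𝒜 : SobolevAtlas S} (A : AdaptedFrame 𝒜)

/-- Functions supported in thin slabs around the hypersurface, vanishing on it, whose normal
derivative of order `k` on the hypersurface is a fixed function. -/
theorem exists_slab_sequence (hd : 1 ≤ d) {k : ℕ} (hk : 1 ≤ k) {p : ℝ} (hp : 1 ≤ p) :
    ∃ H : ℕ → 𝓢(EuclideanSpace ℝ (Fin d), ℂ),
      (∀ n, Function.support (H n) ⊆ Metric.closedBall A.x₀ A.ε) ∧
      (∀ n, ∀ ξ ∈ S, ‖ξ - A.x₀‖ < A.r₀ → iteratedFDeriv ℝ k (H n) ξ (fun _ => A.normalVector) =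
        k.factorial * A.trace 1 0 (A.T (ξ - A.x₀))) ∧
      (∀ n, ∀ ξ ∈ S, ‖ξ - A.x₀‖ < A.r₀ → H n ξ = 0) ∧
      (∀ x, Filter.Tendsto (fun n => (𝓕⁻ (H n) : 𝓢(EuclideanSpace ℝ (Fin d), ℂ)) x)
        Filter.atTop (nhds 0)) ∧
      (p < 2 → ∃ C : ℝ≥0, ∀ n, eLpNorm (𝓕⁻ (H n) : 𝓢(EuclideanSpace ℝ (Fin d), ℂ))
        (ENNReal.ofReal p) volume ≤ C * ENNReal.ofReal (((n : ℝ) + 1) ^ (sigmaExp d p - k))) ∧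
      (2 ≤ p → ∃ C : ℝ≥0, ∀ᶠ n in Filter.atTop,
        eLpNorm (𝓕⁻ (H n) : 𝓢(EuclideanSpace ℝ (Fin d), ℂ)) (ENNReal.ofReal p) volume ≤ C) := by
  obtain ⟨q, hqc, hqr, hq⟩ := exists_contDiff_eventuallyEq_pow A.r_pos k
  have hq0 : q 0 = 0 := by simpa [Nat.one_le_iff_ne_zero.1 hk] using hq.self_of_nhds
  have hL (n : ℕ) : (1 : ℝ) ≤ (n : ℝ) + 1 := by linarith [Nat.cast_nonneg (α := ℝ) n]
  let G (n : ℕ) : 𝓢(EuclideanSpace ℝ (Fin d), ℂ) :=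
    (A.hasCompactSupport_graphBump hqr le_rfl (hL n)).toSchwartzMap
      (A.contDiff_graphBump hqc 1 0 ((n : ℝ) + 1))
  -- The amplitude `L ^ (-k)` with `L = n + 1` cancels the factor `L ^ k` of the `k`-th normal
  -- derivative.
  let w (n : ℕ) : ℂ := ((((n : ℝ) + 1) ^ k)⁻¹ : ℝ)
  have hw (n : ℕ) : ‖w n‖ₑ = ENNReal.ofReal ((((n : ℝ) + 1) ^ k)⁻¹) := by
    rw [← ofReal_norm, Complex.norm_real, Real.norm_of_nonneg (by positivity)]
  have hw1 (n : ℕ) : ‖w n‖ₑ ≤ 1 := by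
    rw [hw, ← ENNReal.ofReal_one]
    exact ENNReal.ofReal_le_ofReal (inv_le_one_of_one_le₀ (one_le_pow₀ (hL n)))
  have hFw (n : ℕ) : (𝓕⁻ (w n • G n) : 𝓢(EuclideanSpace ℝ (Fin d), ℂ)) =
      w n • (𝓕⁻ (G n) : 𝓢(EuclideanSpace ℝ (Fin d), ℂ)) := FourierTransform.fourierInv_smul _ _
  have hGs (n : ℕ) : Function.support (G n) ⊆ Metric.closedBall A.x₀ A.ε :=
    A.support_graphBump q 1 0 _ hqr le_rfl (hL n)
  obtain ⟨C₁, hC₁⟩ := A.lintegral_enorm_pow_graphBump_le hqc hqr one_ne_zero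
  obtain ⟨C₂, hC₂⟩ := A.lintegral_enorm_pow_graphBump_le hqc hqr two_ne_zero
  have hpt (n : ℕ) (x : EuclideanSpace ℝ (Fin d)) :
      ‖(𝓕⁻ (w n • G n) : 𝓢(EuclideanSpace ℝ (Fin d), ℂ)) x‖ₑ ≤
        C₁ * ENNReal.ofReal ((n : ℝ) + 1)⁻¹ := by
    rw [hFw, smul_apply, enorm_smul]
    refine (mul_le_of_le_one_left (zero_le) (hw1 n)).trans
      (((G n).enorm_fourierInv_le x).trans ?_)
    have h1 := hC₁ ((n : ℝ) + 1) 0 (hL n)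
    simp only [pow_one] at h1
    exact h1
  -- The slab has volume of order `1 / L`, so the `L¹` norm on the Fourier side, and with it the
  -- supremum in physical space, tends to zero.
  have hlim : Filter.Tendsto (fun n : ℕ => C₁ * ENNReal.ofReal ((n : ℝ) + 1)⁻¹) Filter.atTop
      (nhds 0) := by
    have h := ENNReal.tendsto_ofReal (tendsto_one_div_add_atTop_nhds_zero_nat (𝕜 := ℝ))
    simp only [one_div, ENNReal.ofReal_zero] at h
    simpa using ENNReal.Tendsto.const_mul (a := C₁) h (Or.inr ENNReal.coe_ne_top)
  refine ⟨fun n => w n • G n, fun n => ?_, fun n ξ hξ hξr => ?_, fun n ξ hξ hξr => ?_, fun x => ?_,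
    fun hp2 => ?_, fun hp2 => ?_⟩
  · exact (Function.support_const_smul_subset _ _).trans (hGs n)
  · have h1 : iteratedFDeriv ℝ k (w n • G n : 𝓢(EuclideanSpace ℝ (Fin d), ℂ)) ξ =
        w n • iteratedFDeriv ℝ k (A.graphBump q 1 0 ((n : ℝ) + 1)) ξ :=
      iteratedFDeriv_const_smul_apply ((G n).smooth k).contDiffAt
    rw [h1]
    change w n * iteratedFDeriv ℝ k (A.graphBump q 1 0 ((n : ℝ) + 1)) ξ _ = _
    rw [A.iteratedFDeriv_graphBump_normalVector le_rfl hqc hq _ _ _ (A.graph ξ hξ hξr)]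
    have : w n * (((n : ℝ) + 1 : ℝ) : ℂ) ^ k = 1 := by
      have h0 : ((n : ℝ) + 1) ^ k ≠ 0 := by positivity
      simp only [w]
      rw [← Complex.ofReal_pow, ← Complex.ofReal_mul, inv_mul_cancel₀ h0, Complex.ofReal_one]
    simp only [Nat.choose_self, Nat.cast_one, one_mul, Nat.sub_self, pow_zero]
    rw [← mul_assoc, mul_left_comm, this, mul_one]
    rfl
  · change w n * A.graphBump q 1 0 ((n : ℝ) + 1) ξ = 0
    rw [A.graphBump_of_graph _ _ _ _ (A.graph ξ hξ hξr), hq0]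
    simp
  · rw [tendsto_zero_iff_enorm_tendsto_zero]
    exact tendsto_of_tendsto_of_tendsto_of_le_of_le tendsto_const_nhds hlim
      (fun n => zero_le) (fun n => hpt n x)
  · obtain ⟨C, hC⟩ := A.eLpNorm_fourierInv_graphBump_le hqc hqr hp hp2
    refine ⟨C, fun n => ?_⟩
    have h0 : (0 : ℝ) < (n : ℝ) + 1 := by positivity
    -- With `N = 1` the dilation is isotropic, `P = L = n + 1`, and the exponent becomes `σ_p`.
    have h1 := hC 1 ((n : ℝ) + 1) ((n : ℝ) + 1) 0 le_rfl (hL n) (hL n) (by simp) (G n) fun _ => rfl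
    rw [slab_exponent hd h0] at h1
    rw [hFw]
    change eLpNorm (w n • ⇑(𝓕⁻ (G n) : 𝓢(EuclideanSpace ℝ (Fin d), ℂ))) _ _ ≤ _
    rw [eLpNorm_const_smul, hw, Real.rpow_sub h0, Real.rpow_natCast, div_eq_inv_mul,
      ENNReal.ofReal_mul (by positivity), mul_left_comm]
    exact mul_le_mul_right h1 _
  · refine ⟨C₂ ^ (1 / p), ?_⟩
    filter_upwards [hlim.eventually_le_const zero_lt_one] with n hn
    refine (eLpNorm_le_of_le_one hp2 fun x => ?_).trans ?_
    · have := (hpt n x).trans hn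
      rwa [← ofReal_norm, ENNReal.ofReal_le_one] at this
    · rw [ENNReal.coe_rpow_of_nonneg _ (by positivity), SchwartzMap.lintegral_enorm_sq_fourierInv]
      refine ENNReal.rpow_le_rpow ?_ (by positivity)
      calc ∫⁻ x, ‖(w n • G n) x‖ₑ ^ 2 ≤ ∫⁻ x, ‖A.graphBump q 1 0 ((n : ℝ) + 1) x‖ₑ ^ 2 := by
            refine lintegral_mono fun x => ?_
            rw [smul_apply, enorm_smul]
            gcongr
            exact mul_le_of_le_one_left (zero_le) (hw1 n)
        _ ≤ C₂ * ENNReal.ofReal ((n : ℝ) + 1)⁻¹ := hC₂ _ _ (hL n)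
        _ ≤ C₂ := by
            refine mul_le_of_le_one_right (zero_le) (ENNReal.ofReal_le_one.2 ?_)
            exact inv_le_one_of_one_le₀ (hL n)

/-- If `σ_p < k`, the slab functions tend to zero in `L^p` and vanish on the surface, while the left
side of the estimate stays bounded below. -/
theorem le_sigmaExp_of_HDR (A : AdaptedFrame 𝒜) (hd : 1 ≤ d) {k : ℕ} (hk : 1 ≤ k) {s ℓ p : ℝ}
    (hs : 0 ≤ s) (hp : 1 ≤ p) (hp2 : p < 2) (h : HDR 𝒜 k s ℓ p) : (k : ℝ) ≤ sigmaExp d p := by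
  by_contra! hlt
  obtain ⟨C, hC⟩ := A.le_of_HDR hs h
  obtain ⟨H, hHs, hHd, hH0, -, hHp, -⟩ := A.exists_slab_sequence hd hk hp
  obtain ⟨C₁, hC₁⟩ := hHp hp2
  have h1 (n : ℕ) : ENNReal.ofReal 1 ≤
      ENNReal.ofReal (C * C₁ * ((n : ℝ) + 1) ^ (sigmaExp d p - k)) := by
    have := hC 1 1 0 le_rfl le_rfl (by simp) (H n) (hHs n) _ (hHd n)
    rw [A.surfaceNorm_eq_zero ℓ (hHs n) (hH0 n), add_zero] at this
    refine le_trans (ENNReal.ofReal_le_ofReal ?_) (this.trans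
      ((mul_le_mul_right (hC₁ n) _).trans (le_of_eq ?_)))
    · simpa using Nat.one_le_iff_ne_zero.2 k.factorial_ne_zero
    · rw [mul_assoc, ENNReal.ofReal_mul (by positivity), ENNReal.ofReal_mul (by positivity)]
      simp
  have h2 : Filter.Tendsto (fun n : ℕ => C * C₁ * ((n : ℝ) + 1) ^ (sigmaExp d p - k)) Filter.atTop
      (nhds 0) := by
    have h3 := (tendsto_rpow_neg_atTop (y := k - sigmaExp d p) (by linarith)).comp
      (Filter.tendsto_atTop_add_const_right _ (1 : ℝ) (tendsto_natCast_atTop_atTop (R := ℝ)))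
    rw [neg_sub] at h3
    simpa using h3.const_mul ((C : ℝ) * C₁)
  obtain ⟨n, hn⟩ := (h2.eventually_lt_const zero_lt_one).exists
  have := (ENNReal.ofReal_le_ofReal_iff (by positivity)).1 (h1 n)
  linarith

/-- Superpositions of slab functions of very different scales. -/
theorem exists_sum_slab (A : AdaptedFrame 𝒜) (hd : 1 ≤ d) {k : ℕ} (hk : 1 ≤ k) {p : ℝ} (hp : 1 ≤ p)
    (hσ : p < 2 → sigmaExp d p ≤ k) :
    ∃ K : ℝ≥0, ∀ J : ℕ, ∃ G : 𝓢(EuclideanSpace ℝ (Fin d), ℂ),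
      Function.support G ⊆ Metric.closedBall A.x₀ A.ε ∧
      (∀ ξ ∈ S, ‖ξ - A.x₀‖ < A.r₀ → iteratedFDeriv ℝ k G ξ (fun _ => A.normalVector) =
        ((J * k.factorial : ℕ) : ℂ) * A.trace 1 0 (A.T (ξ - A.x₀))) ∧
      (∀ ξ ∈ S, ‖ξ - A.x₀‖ < A.r₀ → G ξ = 0) ∧
      ∫⁻ x, ‖(𝓕⁻ G : 𝓢(EuclideanSpace ℝ (Fin d), ℂ)) x‖ₑ ^ p ≤ J * K := by
  have hp0 : 0 < p := by linarith
  obtain ⟨H, hHs, hHd, hH0, hlim, hHp, hHp2⟩ := A.exists_slab_sequence hd hk hp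
  have hnorm (G : 𝓢(EuclideanSpace ℝ (Fin d), ℂ)) (C : ℝ≥0)
      (h : eLpNorm G (ENNReal.ofReal p) volume ≤ C) : ∫⁻ x, ‖G x‖ₑ ^ p ≤ (C ^ p : ℝ≥0) := by
    rw [eLpNorm_eq_lintegral_rpow_enorm_toReal (by simpa using hp0) ENNReal.ofReal_ne_top,
      ENNReal.toReal_ofReal hp0.le, one_div, ENNReal.rpow_inv_le_iff hp0] at h
    rwa [ENNReal.coe_rpow_of_nonneg _ hp0.le]
  have hbound : ∃ C : ℝ≥0, ∀ᶠ n in Filter.atTop,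
      ∫⁻ x, ‖(𝓕⁻ (H n) : 𝓢(EuclideanSpace ℝ (Fin d), ℂ)) x‖ₑ ^ p ≤ C := by
    rcases lt_or_ge p 2 with h2 | h2
    · obtain ⟨C, hC⟩ := hHp h2
      refine ⟨C ^ p, Filter.Eventually.of_forall fun n => hnorm _ C ((hC n).trans ?_)⟩
      refine mul_le_of_le_one_right (zero_le) (ENNReal.ofReal_le_one.2 ?_)
      exact Real.rpow_le_one_of_one_le_of_nonpos (by simp) (by linarith [hσ h2])
    · obtain ⟨C, hC⟩ := hHp2 h2
      exact ⟨C ^ p, hC.mono fun n hn => hnorm _ C hn⟩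
  obtain ⟨C, hC⟩ := hbound
  -- The amount by which one further slab of sufficiently large index raises the integral of the
  -- `p`-th power; it does not depend on the sum already built.
  refine ⟨1 + 2 ^ (p - 1) * C, fun J => ?_⟩
  induction J with
  | zero =>
    refine ⟨0, by simp, fun ξ _ _ => ?_, fun _ _ _ => rfl, ?_⟩
    · simp
    · simp [FourierTransform.fourierInv_zero, hp0]
  | succ J ih =>
    obtain ⟨G, hGs, hGd, hG0, hG⟩ := ih
    obtain ⟨n, hn⟩ := (eventually_lintegral_add_rpow_le hp
      (𝓕⁻ G : 𝓢(EuclideanSpace ℝ (Fin d), ℂ)).continuous.aestronglyMeasurable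
      (fun n => (𝓕⁻ (H n) : 𝓢(EuclideanSpace ℝ (Fin d), ℂ)).continuous.aestronglyMeasurable)
      (ne_top_of_le_ne_top (by finiteness) hG) hlim hC).exists
    refine ⟨G + H n, ?_, fun ξ hξ hξr => ?_, fun ξ hξ hξr => ?_, ?_⟩
    · exact (Function.support_add _ _).trans (Set.union_subset hGs (hHs n))
    · have : iteratedFDeriv ℝ k (G + H n : 𝓢(EuclideanSpace ℝ (Fin d), ℂ)) ξ =
          iteratedFDeriv ℝ k G ξ + iteratedFDeriv ℝ k (H n) ξ :=
        iteratedFDeriv_add_apply (G.smooth k).contDiffAt ((H n).smooth k).contDiffAt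
      rw [this, add_apply, hGd ξ hξ hξr, hHd n ξ hξ hξr]
      push_cast
      ring
    · rw [add_apply, hG0 ξ hξ hξr, hH0 n ξ hξ hξr, add_zero]
    · rw [FourierTransform.fourierInv_add]
      refine hn.trans ((add_le_add_left hG _).trans (le_of_eq ?_))
      push_cast
      rw [ENNReal.coe_rpow_of_nonneg _ (by linarith)]
      push_cast
      ring

/-- Otherwise sums of `J` slabs would give `J ≤ C * (J * K) ^ (1 / p)` for every `J ≥ 1`, so `J ^ (p
- 1)` would be bounded. The range `p ≥ 2` is excluded by the same argument, since slabs are bounded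
in `L^p` there without any condition on `k`. -/
theorem lt_sigmaExp_of_HDR (A : AdaptedFrame 𝒜) (hd : 1 ≤ d) {k : ℕ} (hk : 1 ≤ k) {s ℓ p : ℝ}
    (hs : 0 ≤ s) (hp : 1 < p) (h : HDR 𝒜 k s ℓ p) : p < 2 ∧ (k : ℝ) < sigmaExp d p := by
  by_contra hcon
  have hp0 : 0 < p := by linarith
  obtain ⟨K, hK⟩ := A.exists_sum_slab hd hk hp.le fun h2 => not_lt.1 fun h3 => hcon ⟨h2, h3⟩
  obtain ⟨C, hC⟩ := A.le_of_HDR hs h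
  have h1 (J : ℕ) (hJ : 1 ≤ J) : (J : ℝ) ^ (p - 1) ≤ C ^ p * K := by
    obtain ⟨G, hGs, hGd, hG0, hG⟩ := hK J
    have h1 := hC 1 1 0 le_rfl le_rfl (by simp) G hGs _ hGd
    rw [A.surfaceNorm_eq_zero ℓ hGs hG0, add_zero,
      eLpNorm_eq_lintegral_rpow_enorm_toReal (by simpa using hp0) ENNReal.ofReal_ne_top,
      ENNReal.toReal_ofReal hp0.le] at h1
    have hJ0 : (0 : ℝ) < J := by exact_mod_cast hJ
    have h2 : ENNReal.ofReal J ≤ ENNReal.ofReal (C * (J * K) ^ (1 / p)) := by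
      refine le_trans (ENNReal.ofReal_le_ofReal ?_) (h1.trans
        ((mul_le_mul_right (ENNReal.rpow_le_rpow hG (by positivity)) _).trans (le_of_eq ?_)))
      · simp only [Complex.norm_natCast]
        simpa using le_mul_of_one_le_right hJ0.le
          (by exact_mod_cast Nat.one_le_iff_ne_zero.2 k.factorial_ne_zero)
      · rw [ENNReal.ofReal_mul (by positivity), ← ENNReal.ofReal_rpow_of_nonneg (by positivity)
          (by positivity), ENNReal.ofReal_mul (by positivity)]
        simp
    have h3 := Real.rpow_le_rpow hJ0.le ((ENNReal.ofReal_le_ofReal_iff (by positivity)).1 h2) hp0.le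
    rw [Real.mul_rpow (by positivity) (by positivity), ← Real.rpow_mul (by positivity),
      one_div_mul_cancel hp0.ne', Real.rpow_one] at h3
    rw [Real.rpow_sub_one hJ0.ne', div_le_iff₀ hJ0]
    linarith
  have h2 := (tendsto_rpow_atTop (y := p - 1) (by linarith)).comp
    (tendsto_natCast_atTop_atTop (R := ℝ))
  obtain ⟨J, hJ1, hJ⟩ := ((Filter.eventually_ge_atTop 1).and
    (h2.eventually_gt_atTop (C ^ p * K : ℝ))).exists
  exact absurd (h1 J hJ1) (not_le.2 hJ)

end AdaptedFrame

/-! ### Comparison of exponents and conclusion. -/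

theorem le_of_forall_rpow_le_mul_rpow {a b C : ℝ} (h : ∀ x : ℝ, 1 ≤ x → x ^ a ≤ C * x ^ b) :
    a ≤ b := by
  by_contra! hab
  obtain ⟨x, hx1, hx⟩ := ((Filter.eventually_ge_atTop 1).and
    ((tendsto_rpow_atTop (y := a - b) (by linarith)).eventually_gt_atTop C)).exists
  have hx0 : 0 < x := by linarith
  rw [Real.rpow_sub hx0, lt_div_iff₀ (by positivity)] at hx
  linarith [h x hx1]

/-- Take `N = x` and `F = x ^ a` and compare powers of `x`; the condition `a ≥ 1` is `N ≤ F`. -/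
theorem exponent_le_of_knapp {k : ℕ} {s ℓ κ C : ℝ} (hC : 0 < C)
    (h : ∀ N F : ℝ, 1 ≤ N → N ≤ F → (F * N) ^ k * F ^ (-s) ≤ C * (N ^ κ + F ^ ℓ)) {a : ℝ}
    (ha : 1 ≤ a) : a * (k - s) + k ≤ max κ (a * ℓ) := by
  refine le_of_forall_rpow_le_mul_rpow (C := C * 2) fun x hx => ?_
  have hx0 : 0 < x := by linarith
  have h1 := h x (x ^ a) hx (by simpa using Real.rpow_le_rpow_of_exponent_le hx ha)
  have h2 : (x ^ a * x) ^ k * (x ^ a) ^ (-s) = x ^ (a * (k - s) + k) := by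
    rw [← Real.rpow_add_one hx0.ne', ← Real.rpow_natCast, ← Real.rpow_mul hx0.le,
      ← Real.rpow_mul hx0.le, ← Real.rpow_add hx0]
    ring_nf
  rw [h2, ← Real.rpow_mul hx0.le] at h1
  have h3 := Real.rpow_le_rpow_of_exponent_le hx (le_max_left κ (a * ℓ))
  have h4 := Real.rpow_le_rpow_of_exponent_le hx (le_max_right κ (a * ℓ))
  calc _ ≤ _ := h1
    _ ≤ C * (x ^ max κ (a * ℓ) + x ^ max κ (a * ℓ)) := by gcongr
    _ = _ := by ring

theorem exponent_le_of_vanishing_knapp {k : ℕ} (hk : 1 ≤ k) {s κ C : ℝ}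
    (h : ∀ N F : ℝ, 1 ≤ N → N ≤ F → N ^ 2 * (F * N) ^ (k - 1) * F ^ (-s) ≤ C * N ^ κ) {a : ℝ}
    (ha : 1 ≤ a) : a * (k - 1 - s) + (k + 1) ≤ κ := by
  refine le_of_forall_rpow_le_mul_rpow (C := C) fun x hx => ?_
  have hx0 : 0 < x := by linarith
  refine le_trans (le_of_eq ?_)
    (h x (x ^ a) hx (by simpa using Real.rpow_le_rpow_of_exponent_le hx ha))
  rw [← Real.rpow_add_one hx0.ne', ← Real.rpow_natCast, ← Real.rpow_natCast, ← Real.rpow_mul hx0.le,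
    ← Real.rpow_mul hx0.le, ← Real.rpow_add hx0, ← Real.rpow_add hx0, Nat.cast_sub hk]
  push_cast
  ring_nf

theorem proposition1p7 (d : ℕ) (hd : 2 ≤ d) (S : Set (EuclideanSpace ℝ (Fin d)))
    (hS : IsSmoothHypersurface S) (hclosed : IsClosed S) (hne : S.Nonempty)
    (hcurv : NonvanishingPrincipalCurvatures S) (𝒜 : SobolevAtlas S)
    (k : ℕ) (hk : 1 ≤ k) (s ℓ p : ℝ) (hs : 0 ≤ s) (hℓ : 0 ≤ ℓ) (hp : 1 ≤ p)
    (hHDR : HDR 𝒜 k s ℓ p) :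
    (k : ℝ) ≤ s + ℓ ∧
    (k : ℝ) ≤ s + 1 ∧
    (1 < p → (k : ℝ) < sigmaExp d p) ∧
    (p = 1 → (k : ℝ) ≤ sigmaExp d p) ∧
    (s < (k : ℝ) → (k : ℝ) < s + ℓ ∧ (k : ℝ) * ℓ / (s + ℓ - k) ≤ kappaExp d p) ∧
    2 * (k : ℝ) - s ≤ kappaExp d p := by
  obtain ⟨A⟩ := 𝒜.nonempty_adaptedFrame hne
  have hd1 : 1 ≤ d := by omega
  have hp2 : p < 2 := by
    rcases hp.eq_or_lt with h1 | h1
    · linarith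
    · exact (A.lt_sigmaExp_of_HDR hd1 hk hs h1 hHDR).1
  obtain ⟨C, hC, hA⟩ := A.knapp_le_of_HDR hd1 hs hℓ hp hp2 hHDR
  obtain ⟨C', -, hB⟩ := A.vanishing_knapp_le_of_HDR hd1 hk hs hp hp2 hHDR
  have hk1 : (1 : ℝ) ≤ k := by exact_mod_cast hk
  have hA' {a : ℝ} (ha : 1 ≤ a) := exponent_le_of_knapp hC hA ha
  have hB' {a : ℝ} (ha : 1 ≤ a) := exponent_le_of_vanishing_knapp hk hB ha
  set κ := kappaExp d p
  -- The vanishing Knapp examples with `a = 1`, that is, `F = N`.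
  have h5 : 2 * (k : ℝ) - s ≤ κ := by linarith [hB' le_rfl]
  have h4 (hsk : s < k) : (k : ℝ) < s + ℓ := by
    by_contra! hle
    have hpos : 0 < (k : ℝ) - s := by linarith
    -- For `a` this large both `κ` and `a * ℓ` are at most `a * (k - s)`, and the Knapp inequality
    -- would force `k ≤ 0`.
    set a := max 1 (κ / (k - s))
    have ha : 1 ≤ a := le_max_left _ _
    have h1 : κ ≤ a * (k - s) := (div_le_iff₀ hpos).1 (le_max_right _ _)
    have h2 : a * ℓ ≤ a * (k - s) := mul_le_mul_of_nonneg_left (by linarith) (by linarith)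
    linarith [hA' ha, max_le h1 h2]
  refine ⟨?_, ?_, fun h1 => (A.lt_sigmaExp_of_HDR hd1 hk hs h1 hHDR).2,
    fun _ => A.le_sigmaExp_of_HDR hd1 hk hs hp hp2 hHDR, fun hsk => ⟨h4 hsk, ?_⟩, h5⟩
  · rcases le_or_gt (k : ℝ) s with h | h
    · linarith
    · exact (h4 h).le
  · by_contra! hlt
    have hpos : 0 < (k : ℝ) - 1 - s := by linarith
    -- If `k > s + 1`, the left side of the vanishing Knapp inequality grows with `a`; this `a`
    -- already makes it exceed `κ`.
    have h1 : κ ≤ max 1 (κ / (k - 1 - s)) * (k - 1 - s) := (div_le_iff₀ hpos).1 (le_max_right _ _)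
    linarith [hB' (le_max_left 1 (κ / (k - 1 - s)))]
  · have hlt := h4 hsk
    rw [div_le_iff₀ (by linarith)]
    rcases le_or_gt ℓ κ with hle | hgt
    · have hℓ0 : 0 < ℓ := by linarith
      -- The choice `a = κ / ℓ` balances the two terms on the right of the Knapp inequality.
      have h1 := hA' ((one_le_div₀ hℓ0).2 hle)
      rw [div_mul_cancel₀ κ hℓ0.ne', max_self, div_mul_eq_mul_div, ← le_sub_iff_add_le,
        div_le_iff₀ hℓ0] at h1
      linarith
    -- For `ℓ > κ` the balancing exponent would be less than `1`. Here the bound already follows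
    -- from `2 * k - s ≤ κ`, which together with `s < k` also gives `k ≤ κ`.
    · nlinarith [mul_nonneg (sub_nonneg.2 hgt.le) (by linarith : 0 ≤ κ - k),
        mul_nonneg (by linarith : 0 ≤ κ) (by linarith : 0 ≤ κ - 2 * k + s)]
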